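/- Let $\Gamma$ be a finite constraint language over $\mathbb{Q}$ each of whose relations is definable in $(\mathbb{Q};<)$ by a quantifier-free formula, i.e. by a Boolean combination (using $\bot,\neg,\wedge,\vee$) of atoms $x_i<x_j$. An instance $\mathcal{I}=(V,C)$ of $\mathrm{CSP}(\Gamma)$ consists of a finite set $V$ of variables and a finite list $C$ of constraints $R(v_1,\dots,v_k)$ with $R\in\Gamma$ and $v_1,\dots,v_k\in V$; the question is whether some $f\colon V\to\mathbb{Q}$ satisfies $(f(v_1),\dots,f(v_k))\in R$ for every constraint in $C$. The primal graph of $\mathcal{I}$ has vertex set $V$, and two distinct variables are adjacent if and only if they occur together in the scope of some constraint. Then $\mathrm{CSP}(\Gamma)$ is fixed-parameter tractable parameterized by the treewidth of the primal graph: there are a computable function $f\colon\mathbb{N}\to\mathbb{N}$, a constant $c\in\mathbb{N}$ and a single program for a random access machine (with unit-cost assignment, addition, truncated subtraction, indirect load and store, and tests for zero) which, for every instance $\mathcal{I}$ of $\mathrm{CSP}(\Gamma)$, halts after at most $f(w)\cdot(n+1)^c$ steps and decides correctly whether $\mathcal{I}$ is satisfiable. Here $w$ is the treewidth of the primal graph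 of $\mathcal{I}$ (taken to be $0$ if $V=\varnothing$) and $n$ is the size of $\mathcal{I}$, i.e. $|V|$ plus the sum over all constraints in $C$ of one plus the arity of the constraint. The program receives only $\mathcal{I}$, neither $w$ nor a tree decomposition. -/

import Mathlib

/-! ### Constraint languages, quantifier-free definability, constraint satisfaction -/

/-- A finite constraint language over the domain `D`: a relational structure with finitely many
relation symbols, numbered `0, …, card - 1`. -/
structure ConstraintLanguage (D : Type) where
  card : ℕ
  arity : Fin card → ℕ
  rel : (i : Fin card) → Set (Fin (arity i) → D)

/-- Quantifier-free formulas in `k` variables whose only atoms are `⊥` and the relations of `A`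
applied to (not necessarily distinct) variables; equality is not available as an atom. -/
inductive QFFormula {D : Type} (A : ConstraintLanguage D) (k : ℕ) : Type
  | falsum : QFFormula A k
  | atom (i : Fin A.card) (v : Fin (A.arity i) → Fin k) : QFFormula A k
  | neg (φ : QFFormula A k) : QFFormula A k
  | conj (φ ψ : QFFormula A k) : QFFormula A k
  | disj (φ ψ : QFFormula A k) : QFFormula A k

/-- Truth of a quantifier-free formula at a tuple of domain elements. -/
def QFFormula.Holds {D : Type} {A : ConstraintLanguage D} {k : ℕ} :
    QFFormula A k → (Fin k → D) → Prop
  | .falsum, _ => False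
  | .atom i v, t => (fun j => t (v j)) ∈ A.rel i
  | .neg φ, t => ¬ φ.Holds t
  | .conj φ ψ, t => φ.Holds t ∧ ψ.Holds t
  | .disj φ ψ, t => φ.Holds t ∨ ψ.Holds t

/-- The relation `R` is definable by a quantifier-free formula that uses only the relations
of `A`. -/
def QFDefinable {D : Type} (A : ConstraintLanguage D) {k : ℕ} (R : Set (Fin k → D)) : Prop :=
  ∃ φ : QFFormula A k, ∀ t : Fin k → D, t ∈ R ↔ φ.Holds t

/-- The structure `(ℚ; <)`, as a language with one binary relation. -/
def rationalOrder : ConstraintLanguage ℚ where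
  card := 1
  arity := fun _ => 2
  rel := fun _ => {t : Fin 2 → ℚ | t 0 < t 1}

/-- A constraint `R(v₁, …, v_k)` over the variables `0, …, n - 1`. -/
structure CSPConstraint {D : Type} (Γ : ConstraintLanguage D) (n : ℕ) where
  symbol : Fin Γ.card
  scope : Fin (Γ.arity symbol) → Fin n

/-- An instance of `CSP(Γ)`: the variables are `0, …, numVars - 1`, and the constraints are
listed in an arbitrary order. -/
structure CSPInstance {D : Type} (Γ : ConstraintLanguage D) where
  numVars : ℕ
  constraints : List (CSPConstraint Γ numVars)

namespace CSPInstance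

variable {D : Type} {Γ : ConstraintLanguage D}

def Satisfiable (I : CSPInstance Γ) : Prop :=
  ∃ f : Fin I.numVars → D, ∀ c ∈ I.constraints, (fun j => f (c.scope j)) ∈ Γ.rel c.symbol

/-- Two distinct variables are adjacent iff they occur in the scope of a common constraint. -/
def primalGraph (I : CSPInstance Γ) : SimpleGraph (Fin I.numVars) where
  Adj u v := u ≠ v ∧ ∃ c ∈ I.constraints, (∃ i, c.scope i = u) ∧ (∃ j, c.scope j = v)
  symm := ⟨fun _ _ ⟨hne, c, hc, hu, hv⟩ => ⟨hne.symm, c, hc, hv, hu⟩⟩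
  loopless := ⟨fun _ h => h.1 rfl⟩

/-- The size of an instance: the number of variables plus, for each constraint, the number of
symbols needed to write it down (one for the relation and one for each entry of the scope). -/
def size (I : CSPInstance Γ) : ℕ :=
  I.numVars + (I.constraints.map fun c => 1 + Γ.arity c.symbol).sum

/-- The input presented to a machine: the number of variables, followed, for each constraint, by
the number of its relation symbol and the variables of its scope. -/
def encode (I : CSPInstance Γ) : List ℕ :=
  I.numVars :: I.constraints.flatMap fun c =>
    (c.symbol : ℕ) :: List.ofFn fun j => (c.scope j : ℕ)

end CSPInstance

/-! ### Treewidth -/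

/-- A tree decomposition of `G`: a finite tree with a bag of vertices at each node. -/
structure TreeDecomposition {V : Type} [DecidableEq V] (G : SimpleGraph V) where
  numNodes : ℕ
  tree : SimpleGraph (Fin numNodes)
  isTree : tree.IsTree
  bag : Fin numNodes → Finset V
  vertex_mem : ∀ v : V, ∃ t, v ∈ bag t
  edge_mem : ∀ u v : V, G.Adj u v → ∃ t, u ∈ bag t ∧ v ∈ bag t
  bag_inter : ∀ (t₁ t₂ t₃ : Fin numNodes) (p : tree.Walk t₁ t₃),
    p.IsPath → t₂ ∈ p.support → bag t₁ ∩ bag t₃ ⊆ bag t₂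

/-- The treewidth: the least `w` such that some tree decomposition has all bags of size at most
`w + 1`. (It is `0` for the graph without vertices.) -/
noncomputable def treewidth {V : Type} [DecidableEq V] (G : SimpleGraph V) : ℕ :=
  sInf {w : ℕ | ∃ T : TreeDecomposition G, ∀ t, (T.bag t).card ≤ w + 1}

/-! ### Random access machines and fixed-parameter tractability -/

/-- A configuration of a random access machine: registers, which programs address directly, and a
memory, which is addressed through the contents of registers. -/
structure RAMState where
  reg : ℕ → ℕ
  mem : ℕ → ℕ

/-- Programs of a random access machine in structured form. The arithmetic is addition and
truncated subtraction; a program is a finite object and mentions finitely many registers. -/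
inductive RAMProgram : Type
  | skip : RAMProgram
  | const (x a : ℕ) : RAMProgram
  | copy (x y : ℕ) : RAMProgram
  | add (x y z : ℕ) : RAMProgram
  | sub (x y z : ℕ) : RAMProgram
  | load (x y : ℕ) : RAMProgram
  | store (x y : ℕ) : RAMProgram
  | seq (p q : RAMProgram) : RAMProgram
  | ite (x : ℕ) (p q : RAMProgram) : RAMProgram
  | while (x : ℕ) (p : RAMProgram) : RAMProgram

/-- Register `x` is set to `a`. -/
def RAMState.setReg (s : RAMState) (x a : ℕ) : RAMState :=
  { s with reg := Function.update s.reg x a }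

/-- Memory cell `a` is set to `b`. -/
def RAMState.setMem (s : RAMState) (a b : ℕ) : RAMState :=
  { s with mem := Function.update s.mem a b }

/-- `RunsTo p s t s'`: started in `s`, the program `p` halts in `s'` after exactly `t` steps.
Every elementary instruction and every evaluation of a test `x ≠ 0` counts as one step. -/
inductive RunsTo : RAMProgram → RAMState → ℕ → RAMState → Prop
  | skip (s : RAMState) : RunsTo .skip s 1 s
  | const (s : RAMState) (x a : ℕ) : RunsTo (.const x a) s 1 (s.setReg x a)
  | copy (s : RAMState) (x y : ℕ) : RunsTo (.copy x y) s 1 (s.setReg x (s.reg y))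
  | add (s : RAMState) (x y z : ℕ) :
      RunsTo (.add x y z) s 1 (s.setReg x (s.reg y + s.reg z))
  | sub (s : RAMState) (x y z : ℕ) :
      RunsTo (.sub x y z) s 1 (s.setReg x (s.reg y - s.reg z))
  | load (s : RAMState) (x y : ℕ) :
      RunsTo (.load x y) s 1 (s.setReg x (s.mem (s.reg y)))
  | store (s : RAMState) (x y : ℕ) :
      RunsTo (.store x y) s 1 (s.setMem (s.reg x) (s.reg y))
  | seq {p q : RAMProgram} {s₁ s₂ s₃ : RAMState} {t₁ t₂ : ℕ} :
      RunsTo p s₁ t₁ s₂ → RunsTo q s₂ t₂ s₃ → RunsTo (.seq p q) s₁ (t₁ + t₂) s₃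
  | ite_pos {x : ℕ} {p q : RAMProgram} {s s' : RAMState} {t : ℕ} :
      s.reg x ≠ 0 → RunsTo p s t s' → RunsTo (.ite x p q) s (t + 1) s'
  | ite_neg {x : ℕ} {p q : RAMProgram} {s s' : RAMState} {t : ℕ} :
      s.reg x = 0 → RunsTo q s t s' → RunsTo (.ite x p q) s (t + 1) s'
  | while_stop {x : ℕ} {p : RAMProgram} {s : RAMState} :
      s.reg x = 0 → RunsTo (.while x p) s 1 s
  | while_step {x : ℕ} {p : RAMProgram} {s₁ s₂ s₃ : RAMState} {t₁ t₂ : ℕ} :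
      s₁.reg x ≠ 0 → RunsTo p s₁ t₁ s₂ → RunsTo (.while x p) s₂ t₂ s₃ →
        RunsTo (.while x p) s₁ (t₁ + t₂ + 1) s₃

/-- The initial configuration on a finite sequence of numbers: the sequence is stored in the
memory from address `0` on, its length is in register `0`, and everything else is `0`. -/
def RAMState.init (input : List ℕ) : RAMState where
  reg := fun x => if x = 0 then input.length else 0
  mem := fun a => input.getD a 0

/-- The decision problem `L`, whose instances `x` have an encoding, a size and a parameter, is
fixed-parameter tractable: one program decides every instance `x`, answering `1` or `0` in
register `0`, within `f (param x) * (size x + 1) ^ c` steps, for a computable function `f` and a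
constant `c`. The parameter is not given to the program. -/
def IsFPT {α : Type} (encode : α → List ℕ) (size param : α → ℕ) (L : α → Prop) : Prop :=
  ∃ (P : RAMProgram) (f : ℕ → ℕ) (c : ℕ), Computable f ∧
    ∀ x : α, ∃ (t : ℕ) (s : RAMState), RunsTo P (RAMState.init (encode x)) t s ∧
      t ≤ f (param x) * (size x + 1) ^ c ∧
      (L x → s.reg 0 = 1) ∧ (¬ L x → s.reg 0 = 0)

/-- `CSP(Γ)` is fixed-parameter tractable in the treewidth of the primal graph. -/
def CSPIsFPT {D : Type} (Γ : ConstraintLanguage D) : Prop :=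
  IsFPT (CSPInstance.encode (Γ := Γ)) CSPInstance.size
    (fun I => treewidth I.primalGraph) CSPInstance.Satisfiable

/-!
The program tries `k = 1, 2, …` as strict upper bounds for the treewidth until it succeeds.

For fixed `k` it builds a decomposition of the primal graph greedily. Let `D` be the set of vertices
that are in bags already. The invariant (`PartialBags`) is that the border of each component of the
remaining graph, that is, the set of its neighbours in `D`, has at most `m = 5k + 1` elements and
lies in one bag. The next bag consists of the border `W` of the component of a new vertex `s`, of
`s`, and of the vertices in the component of a set `X` of at most `k` vertices that separates two
subsets of `W` with more than `k` elements each. A component of what remains cannot touch both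
subsets outside `X`, so its border loses at least as many vertices of `W` as `s` and `X` add, and
the invariant is preserved (`card_border_le`, `PartialBags.step`). The set `X` is only needed if `W`
has `m` elements; it is sought by trying all pairs of subsets of `W` and computing vertex cuts by
augmenting paths (`Stm.exec_maxFlow`, `exists_cut_of_splits`, `splits_of_cut`). If the treewidth is
less than `k`, then some bag of an optimal tree decomposition is such a set `X`
(`TreeDecomposition.exists_split`). So round `k` succeeds at the latest when `k` is the treewidth
plus one, and in any case the bags have at most `K = 6k + 2` elements.

Given the bags, satisfiability is decided by dynamic programming. Whether an assignment satisfies a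
quantifier-free formula only depends on the order of its values (`QFFormula.holds_congr`), hence
each bag has at most `K ^ K` relevant assignments, with values below `K`. From the last bag to the
first, an assignment is kept if it satisfies the constraints inside the bag and agrees, up to order,
with some kept assignment of each later bag. Every constraint lies in some bag
(`BagSequence.exists_clique_subset`), and since the order of the rationals is dense without
endpoints, a rational assignment to the vertices of the first bags can be extended to the next one,
whose old vertices all lie in one earlier bag (`exists_extend_order`, `BagSequence.exists_order`).
So there is a solution if and only if each bag keeps an assignment (`Stm.satisfiable_iff`).

For the running time, the algorithm is written in a small language of arrays and loops, all of whose
loops are bounded by variables. Compiled programs of this language run on the random access machine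
in time polynomial in a common bound on the variables (`Exp.compile_runs`, `Stm.compile_runs`), with
an exponent that only depends on the program. A suitable bound in the first `w + 1` rounds, where
`w` is the treewidth, is the sum of a linear function of the size and of `K ^ K` for
`K = 6(w + 1) + 2`, which gives the claim.
-/

/-! ### A structured array language and its compilation -/

/-- Sixteen two-dimensional arrays of natural numbers, each indexed by all pairs of naturals. -/
abbrev Arrays := Fin 16 → ℕ → ℕ → ℕ

/-- The cell `(i, j)` of array `a` is set to `v`. -/
def Arrays.set (A : Arrays) (a : Fin 16) (i j v : ℕ) : Arrays :=
  fun a' i' j' => if a' = a ∧ i' = i ∧ j' = j then v else A a' i' j'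

/-- Side-effect free expressions over named variables, the input and the arrays. Array indices and
ranges of sums are variables, so that a bound on all variables bounds the evaluation time. -/
inductive Exp : Type
  | var (x : ℕ) : Exp
  | const (c : ℕ) : Exp
  | add (e f : Exp) : Exp
  | sub (e f : Exp) : Exp
  | inp (e : Exp) : Exp
  | get (a : Fin 16) (x y : ℕ) : Exp
  | ite (c e f : Exp) : Exp
  | sum (x y : ℕ) (e : Exp) : Exp
  | bind (x y : ℕ) (e f : Exp) : Exp

/-- The value of an expression, for the input `I`, the variables `V` and the arrays `A`. In
`sum x y e` the variable `x` ranges over the numbers below the value of `y`; in `bind x y e f` it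
has the value of `e`, cut off at that of `y`, so that bounds on the variables are preserved. -/
def Exp.eval (I : ℕ → ℕ) : Exp → (ℕ → ℕ) → Arrays → ℕ
  | .var x, V, _ => V x
  | .const c, _, _ => c
  | .add e f, V, A => e.eval I V A + f.eval I V A
  | .sub e f, V, A => e.eval I V A - f.eval I V A
  | .inp e, V, A => I (e.eval I V A)
  | .get a x y, V, A => A a (V x) (V y)
  | .ite c e f, V, A => if c.eval I V A = 0 then f.eval I V A else e.eval I V A
  | .sum x y e, V, A => ∑ i ∈ Finset.range (V y), e.eval I (Function.update V x i) A
  | .bind x y e f, V, A => f.eval I (Function.update V x (min (e.eval I V A) (V y))) A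

/-- Statements: they change arrays only, and all their loops are bounded by variables. -/
inductive Stm : Type
  | skip : Stm
  | store (a : Fin 16) (x y : ℕ) (e : Exp) : Stm
  | seq (p q : Stm) : Stm
  | ite (c : Exp) (p q : Stm) : Stm
  | loop (x y : ℕ) (p : Stm) : Stm
  | bind (x y : ℕ) (e : Exp) (p : Stm) : Stm

/-- The effect of a statement on the arrays. -/
def Stm.exec (I : ℕ → ℕ) : Stm → (ℕ → ℕ) → Arrays → Arrays
  | .skip, _, A => A
  | .store a x y e, V, A => A.set a (V x) (V y) (e.eval I V A)
  | .seq p q, V, A => q.exec I V (p.exec I V A)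
  | .ite c p q, V, A => if c.eval I V A = 0 then q.exec I V A else p.exec I V A
  | .loop x y p, V, A =>
      Nat.rec A (fun i A' => p.exec I (Function.update V x i) A') (V y)
  | .bind x y e p, V, A => p.exec I (Function.update V x (min (e.eval I V A) (V y))) A

namespace RAM

/-- The register of the variable `x`. Register `0` keeps the length of the input. -/
def R (x : ℕ) : ℕ := 2 * x + 2

/-- The `d`-th register for temporary values. -/
def T (d : ℕ) : ℕ := 2 * d + 1

@[simp] lemma R_inj {x y : ℕ} : R x = R y ↔ x = y := by unfold R; omega
@[simp] lemma T_inj {x y : ℕ} : T x = T y ↔ x = y := by unfold T; omega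
@[simp] lemma R_ne_T {x y : ℕ} : R x ≠ T y := by unfold R T; omega
@[simp] lemma T_ne_R {x y : ℕ} : T x ≠ R y := by unfold R T; omega
@[simp] lemma R_ne_zero {x : ℕ} : R x ≠ 0 := by unfold R; omega
@[simp] lemma zero_ne_R {x : ℕ} : 0 ≠ R x := by unfold R; omega
@[simp] lemma zero_ne_T {x : ℕ} : 0 ≠ T x := by unfold T; omega

@[simp] lemma reg_setReg (s : RAMState) (x a y : ℕ) :
    (s.setReg x a).reg y = if y = x then a else s.reg y := by
  simp [RAMState.setReg, Function.update_apply]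

@[simp] lemma mem_setReg (s : RAMState) (x a : ℕ) : (s.setReg x a).mem = s.mem := rfl

/-- Started in `s`, the program `p` halts within `c` steps in a state that satisfies `Q`. -/
def Runs (p : RAMProgram) (s : RAMState) (c : ℕ) (Q : RAMState → Prop) : Prop :=
  ∃ t s', RunsTo p s t s' ∧ t ≤ c ∧ Q s'

section Runs

variable {s : RAMState} {Q : RAMState → Prop} {c : ℕ} {q : RAMProgram}

lemma Runs.mono {p : RAMProgram} {c c' : ℕ} {Q Q' : RAMState → Prop} (h : Runs p s c Q)
    (hc : c ≤ c') (hQ : ∀ s', Q s' → Q' s') : Runs p s c' Q' := by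
  obtain ⟨t, s', h1, h2, h3⟩ := h
  exact ⟨t, s', h1, h2.trans hc, hQ _ h3⟩

lemma Runs.seq {p : RAMProgram} {c₁ c₂ : ℕ} {Q₁ : RAMState → Prop} (h : Runs p s c₁ Q₁)
    (h' : ∀ s', Q₁ s' → Runs q s' c₂ Q) : Runs (.seq p q) s (c₁ + c₂) Q := by
  obtain ⟨t, s', h1, h2, h3⟩ := h
  obtain ⟨t', s'', h1', h2', h3'⟩ := h' s' h3
  exact ⟨_, _, .seq h1 h1', by omega, h3'⟩

lemma Runs.skip (h : Q s) : Runs .skip s 1 Q := ⟨_, _, .skip _, le_rfl, h⟩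

lemma Runs.const {x a : ℕ} (h : Q (s.setReg x a)) : Runs (.const x a) s 1 Q :=
  ⟨_, _, .const _ _ _, le_rfl, h⟩

lemma Runs.copy {x y : ℕ} (h : Q (s.setReg x (s.reg y))) : Runs (.copy x y) s 1 Q :=
  ⟨_, _, .copy _ _ _, le_rfl, h⟩

lemma Runs.add {x y z : ℕ} (h : Q (s.setReg x (s.reg y + s.reg z))) :
    Runs (.add x y z) s 1 Q := ⟨_, _, .add _ _ _ _, le_rfl, h⟩

lemma Runs.sub {x y z : ℕ} (h : Q (s.setReg x (s.reg y - s.reg z))) :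
    Runs (.sub x y z) s 1 Q := ⟨_, _, .sub _ _ _ _, le_rfl, h⟩

lemma Runs.load {x y : ℕ} (h : Q (s.setReg x (s.mem (s.reg y)))) :
    Runs (.load x y) s 1 Q := ⟨_, _, .load _ _ _, le_rfl, h⟩

lemma Runs.store {x y : ℕ} (h : Q (s.setMem (s.reg x) (s.reg y))) :
    Runs (.store x y) s 1 Q := ⟨_, _, .store _ _ _, le_rfl, h⟩

lemma Runs.ite {p : RAMProgram} {x : ℕ} (h₁ : s.reg x ≠ 0 → Runs p s c Q)
    (h₂ : s.reg x = 0 → Runs q s c Q) : Runs (.ite x p q) s (c + 1) Q := by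
  by_cases h : s.reg x = 0
  · obtain ⟨t, s', a, b, e⟩ := h₂ h
    exact ⟨_, _, .ite_neg h a, by omega, e⟩
  · obtain ⟨t, s', a, b, e⟩ := h₁ h
    exact ⟨_, _, .ite_pos h a, by omega, e⟩

lemma runsTo_while_of_eq_zero {p : RAMProgram} {x : ℕ} (h : s.reg x = 0) :
    RunsTo (.while x p) s 1 s := by
  constructor
  exact h

/-- A loop that is controlled by a decreasing counter. -/
lemma Runs.countdown {x : ℕ} {p : RAMProgram} (Inv : ℕ → RAMState → Prop)
    (hpos : ∀ i s, Inv (i + 1) s → s.reg x ≠ 0 ∧ Runs p s c (Inv i))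
    (hzero : ∀ s, Inv 0 s → s.reg x = 0) (n : ℕ) (h : Inv n s) :
    Runs (.while x p) s (n * (c + 1) + 1) (Inv 0) := by
  induction n generalizing s with
  | zero => exact ⟨_, _, runsTo_while_of_eq_zero (hzero _ h), by omega, h⟩
  | succ n ih =>
    obtain ⟨h0, t, s', a, b, e⟩ := hpos n s h
    obtain ⟨t', s'', a', b', e'⟩ := ih e
    exact ⟨_, _, .while_step h0 a a', by rw [Nat.succ_mul]; omega, e'⟩

lemma Runs.const_seq {x a : ℕ} (h : Runs q (s.setReg x a) c Q) :
    Runs (.seq (.const x a) q) s (1 + c) Q :=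
  (Runs.const (Q := (· = s.setReg x a)) rfl).seq fun _ e => e ▸ h

lemma Runs.copy_seq {x y : ℕ} (h : Runs q (s.setReg x (s.reg y)) c Q) :
    Runs (.seq (.copy x y) q) s (1 + c) Q :=
  (Runs.copy (Q := (· = s.setReg x (s.reg y))) rfl).seq fun _ e => e ▸ h

lemma Runs.add_seq {x y z : ℕ} (h : Runs q (s.setReg x (s.reg y + s.reg z)) c Q) :
    Runs (.seq (.add x y z) q) s (1 + c) Q :=
  (Runs.add (Q := (· = s.setReg x (s.reg y + s.reg z))) rfl).seq fun _ e => e ▸ h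

lemma Runs.sub_seq {x y z : ℕ} (h : Runs q (s.setReg x (s.reg y - s.reg z)) c Q) :
    Runs (.seq (.sub x y z) q) s (1 + c) Q :=
  (Runs.sub (Q := (· = s.setReg x (s.reg y - s.reg z))) rfl).seq fun _ e => e ▸ h

end Runs

/-- The address of the cell `(i, j)` of array `a` when the input has length `L`. Since
`(i + j) ^ 2 + i` determines `i` and `j`, different cells have different addresses, and none of
them belongs to the input. -/
def addr (L : ℕ) (a : Fin 16) (i j : ℕ) : ℕ := L + (16 * ((i + j) * (i + j) + i) + a)

lemma addr_inj {L : ℕ} {a a' : Fin 16} {i j i' j' : ℕ} (h : addr L a i j = addr L a' i' j') :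
    a' = a ∧ i' = i ∧ j' = j := by
  unfold addr at h
  have h1 : (i + j) * (i + j) + i = (i' + j') * (i' + j') + i' := by omega
  have h2 : i + j = i' + j' := by
    rcases lt_trichotomy (i + j) (i' + j') with h2 | h2 | h2
    · nlinarith
    · exact h2
    · nlinarith
  rw [h2] at h1
  have h3 : i = i' := by omega
  exact ⟨Fin.ext (by subst h3; omega), h3.symm, by omega⟩

/-- The machine state `s` represents the input `I` of length `L`, the variables `V` and the
arrays `A`. -/
structure Repr (I : ℕ → ℕ) (L : ℕ) (V : ℕ → ℕ) (A : Arrays) (s : RAMState) : Prop where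
  base : s.reg 0 = L
  var : ∀ x, s.reg (R x) = V x
  inp : ∀ i < L, s.mem i = I i
  arr : ∀ a i j, s.mem (addr L a i j) = A a i j

/-- The first `d` temporary registers of `s` and `s'` agree. -/
def Keep (d : ℕ) (s s' : RAMState) : Prop := ∀ d' < d, s'.reg (T d') = s.reg (T d')

section Repr

variable {I V : ℕ → ℕ} {L : ℕ} {A : Arrays} {s s' s'' : RAMState} {d d' : ℕ}

lemma Repr.setT (h : Repr I L V A s) (d v : ℕ) : Repr I L V A (s.setReg (T d) v) :=
  ⟨by simp [h.base], fun x => by simp [h.var], h.inp, h.arr⟩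

lemma Repr.setR (h : Repr I L V A s) (x v : ℕ) :
    Repr I L (Function.update V x v) A (s.setReg (R x) v) :=
  ⟨by simp [h.base], fun y => by simp [h.var, Function.update_apply], h.inp, h.arr⟩

lemma Repr.setArr (h : Repr I L V A s) (a : Fin 16) (i j v : ℕ) :
    Repr I L V (A.set a i j v) (s.setMem (addr L a i j) v) := by
  refine ⟨h.base, h.var, fun i' hi => ?_, fun a' i' j' => ?_⟩
  · simp only [RAMState.setMem]
    rw [Function.update_of_ne (by unfold addr; omega), h.inp _ hi]
  · simp only [RAMState.setMem, Function.update_apply, Arrays.set]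
    by_cases h' : addr L a' i' j' = addr L a i j
    · rw [if_pos h', if_pos (addr_inj h'.symm)]
    · rw [if_neg h', if_neg (by rintro ⟨rfl, rfl, rfl⟩; exact h' rfl), h.arr]

lemma Keep.refl : Keep d s s := fun _ _ => rfl

lemma Keep.trans (h : Keep d s s') (h' : Keep d' s' s'') (hd : d ≤ d') : Keep d s s'' :=
  fun i hi => (h' i (by omega)).trans (h i hi)

lemma Keep.setT (h : Keep d s s') (hd : d ≤ d') (v : ℕ) : Keep d s (s'.setReg (T d') v) :=
  fun i hi => by simp [show i ≠ d' by omega, h i hi]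

lemma Keep.setR (h : Keep d s s') (x v : ℕ) : Keep d s (s'.setReg (R x) v) :=
  fun i hi => by simp [h i hi]

end Repr

/-- Computes the address of the cell `(x, y)` of array `a` in the temporary register `d`. -/
def address (a : Fin 16) (x y d : ℕ) : RAMProgram :=
  .seq (.add (T (d + 1)) (R x) (R y)) <|
  .seq (.copy (T d) (R x)) <|
  .seq (.copy (T (d + 2)) (T (d + 1))) <|
  .seq (.const (T (d + 3)) 1) <|
  .seq (.while (T (d + 2)) (.seq (.add (T d) (T d) (T (d + 1)))
    (.sub (T (d + 2)) (T (d + 2)) (T (d + 3))))) <|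
  .seq (.add (T d) (T d) (T d)) <|
  .seq (.add (T d) (T d) (T d)) <|
  .seq (.add (T d) (T d) (T d)) <|
  .seq (.add (T d) (T d) (T d)) <|
  .seq (.const (T (d + 1)) a) <|
  .seq (.add (T d) (T d) (T (d + 1))) <|
  .add (T d) 0 (T d)

lemma address_runs {I V : ℕ → ℕ} {L : ℕ} {A : Arrays} {s : RAMState} (h : Repr I L V A s)
    (a : Fin 16) (x y d : ℕ) :
    Runs (address a x y d) s ((V x + V y) * 3 + 12) fun s' =>
      Repr I L V A s' ∧ s'.reg (T d) = addr L a (V x) (V y) ∧ Keep d s s' ∧ s'.mem = s.mem := by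
  unfold address
  refine Runs.mono (c := 1 + (1 + (1 + (1 + (((V x + V y) * (2 + 1) + 1) +
    (1 + (1 + (1 + (1 + (1 + (1 + 1))))))))))) ?_ (by omega) (fun _ => id)
  refine .add_seq <| .copy_seq <| .copy_seq <| .const_seq ?_
  refine Runs.seq (Runs.countdown (c := 2) (fun i s' => Repr I L V A s' ∧ s'.reg (T (d + 2)) = i ∧
    s'.reg (T (d + 1)) = V x + V y ∧ s'.reg (T (d + 3)) = 1 ∧
    s'.reg (T d) + i * (V x + V y) = (V x + V y) * (V x + V y) + V x ∧
    Keep d s s' ∧ s'.mem = s.mem) ?_ ?_ (V x + V y) ?_) ?_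
  · rintro i s' ⟨h1, h2, h3, h4, h5, h6, h7⟩
    refine ⟨by omega, (Runs.add_seq (Runs.sub ?_)).mono le_rfl fun _ => id⟩
    refine ⟨(h1.setT _ _).setT _ _, ?_, ?_, ?_, ?_, (h6.setT le_rfl _).setT (by omega) _, h7⟩
    · simp [h2, h4]
    · simp [h3]
    · simp [h4]
    · simp [h3]; linarith [Nat.succ_mul i (V x + V y)]
  · rintro s' ⟨h1, h2, -⟩
    exact h2
  · refine ⟨(((h.setT _ _).setT _ _).setT _ _).setT _ _, ?_, ?_, ?_, ?_, ?_, rfl⟩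
    · simp [h.var]
    · simp [h.var]
    · simp
    · simp [h.var]; ring
    · exact (((Keep.refl.setT (by omega) _).setT le_rfl _).setT (by omega) _).setT (by omega) _
  · rintro s' ⟨h1, h2, h3, h4, h5, h6, h7⟩
    refine .add_seq <| .add_seq <| .add_seq <| .add_seq <| .const_seq <| .add_seq <| .add ?_
    refine ⟨((((((h1.setT _ _).setT _ _).setT _ _).setT _ _).setT _ _).setT _ _).setT _ _, ?_, ?_,
      h7⟩
    · simp [h1.base, addr]; omega
    · exact ((((((h6.setT le_rfl _).setT le_rfl _).setT le_rfl _).setT le_rfl _).setT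
        (by omega) _).setT le_rfl _).setT le_rfl _

end RAM

open RAM

/-- Compilation of an expression: its value is computed in the temporary register `d`, using only
temporary registers from `d` on. -/
def Exp.compile : Exp → ℕ → RAMProgram
  | .var x, d => .copy (T d) (R x)
  | .const c, d => .const (T d) c
  | .add e f, d => .seq (e.compile d) <| .seq (f.compile (d + 1)) <| .add (T d) (T d) (T (d + 1))
  | .sub e f, d => .seq (e.compile d) <| .seq (f.compile (d + 1)) <| .sub (T d) (T d) (T (d + 1))
  | .inp e, d => .seq (e.compile d) <| .seq (.sub (T (d + 1)) 0 (T d)) <|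
      .ite (T (d + 1)) (.load (T d) (T d)) (.const (T d) 0)
  | .get a x y, d => .seq (address a x y d) (.load (T d) (T d))
  | .ite c e f, d => .seq (c.compile d) (.ite (T d) (e.compile d) (f.compile d))
  | .sum x y e, d =>
      .seq (.const (T d) 0) <|
      .seq (.copy (T (d + 1)) (R x)) <|
      .seq (.copy (T (d + 2)) (R y)) <|
      .seq (.const (R x) 0) <|
      .seq (.while (T (d + 2)) <|
        .seq (e.compile (d + 3)) <|
        .seq (.add (T d) (T d) (T (d + 3))) <|
        .seq (.const (T (d + 3)) 1) <|
        .seq (.add (R x) (R x) (T (d + 3))) <|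
        .sub (T (d + 2)) (T (d + 2)) (T (d + 3))) <|
      .copy (R x) (T (d + 1))
  | .bind x y e f, d =>
      .seq (e.compile (d + 1)) <|
      .seq (.sub (T (d + 2)) (T (d + 1)) (R y)) <|
      .seq (.sub (T (d + 2)) (T (d + 1)) (T (d + 2))) <|
      .seq (.copy (T (d + 1)) (R x)) <|
      .seq (.copy (R x) (T (d + 2))) <|
      .seq (f.compile (d + 2)) <|
      .seq (.copy (R x) (T (d + 1))) <|
      .copy (T d) (T (d + 2))

/-- Compilation of a statement, using only temporary registers from `d` on. -/
def Stm.compile : Stm → ℕ → RAMProgram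
  | .skip, _ => .skip
  | .store a x y e, d =>
      .seq (e.compile d) <| .seq (address a x y (d + 1)) <| .store (T (d + 1)) (T d)
  | .seq p q, d => .seq (p.compile d) (q.compile d)
  | .ite c p q, d => .seq (c.compile d) (.ite (T d) (p.compile d) (q.compile d))
  | .loop x y p, d =>
      .seq (.copy (T (d + 1)) (R x)) <|
      .seq (.copy (T (d + 2)) (R y)) <|
      .seq (.const (R x) 0) <|
      .seq (.while (T (d + 2)) <|
        .seq (p.compile (d + 3)) <|
        .seq (.const (T (d + 3)) 1) <|
        .seq (.add (R x) (R x) (T (d + 3))) <|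
        .sub (T (d + 2)) (T (d + 2)) (T (d + 3))) <|
      .copy (R x) (T (d + 1))
  | .bind x y e p, d =>
      .seq (e.compile (d + 1)) <|
      .seq (.sub (T (d + 2)) (T (d + 1)) (R y)) <|
      .seq (.sub (T (d + 2)) (T (d + 1)) (T (d + 2))) <|
      .seq (.copy (T (d + 1)) (R x)) <|
      .seq (.copy (R x) (T (d + 2))) <|
      .seq (p.compile (d + 2)) <|
      .copy (R x) (T (d + 1))

/-- The exponent in the time bound of an expression. -/
def Exp.deg : Exp → ℕ
  | .var _ => 0
  | .const _ => 0
  | .add e f => e.deg + (f.deg + 1) + 1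
  | .sub e f => e.deg + (f.deg + 1) + 1
  | .inp e => e.deg + 3
  | .get _ _ _ => 5
  | .ite c e f => c.deg + (e.deg + f.deg + 1) + 1
  | .sum _ _ e => e.deg + 7
  | .bind _ _ e f => e.deg + f.deg + 5

/-- The exponent in the time bound of a statement. -/
def Stm.deg : Stm → ℕ
  | .skip => 0
  | .store _ _ _ e => e.deg + 6
  | .seq p q => p.deg + q.deg + 1
  | .ite c p q => c.deg + (p.deg + q.deg + 1) + 1
  | .loop _ _ p => p.deg + 7
  | .bind _ _ e p => e.deg + p.deg + 5

namespace RAM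

lemma bound_add {x a b a' b' : ℕ} (hx : 2 ≤ x) (ha : a ≤ x ^ a') (hb : b ≤ x ^ b') :
    a + b ≤ x ^ (a' + b' + 1) := by
  have h1 : x ^ a' ≤ x ^ (a' + b') := Nat.pow_le_pow_right (by omega) (by omega)
  have h2 : x ^ b' ≤ x ^ (a' + b') := Nat.pow_le_pow_right (by omega) (by omega)
  have h3 : x ^ (a' + b') * 2 ≤ x ^ (a' + b') * x := Nat.mul_le_mul_left _ hx
  rw [pow_succ]; omega

lemma bound_const (B a n : ℕ) (h : a ≤ 2 ^ n) : a ≤ (B + 2) ^ n :=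
  h.trans (Nat.pow_le_pow_left (by omega) _)

lemma bound_add_one (B n : ℕ) : (B + 2) ^ n + 1 ≤ (B + 2) ^ (n + 1) :=
  bound_add (b' := 0) (by omega) le_rfl (by simp)

lemma bound_mul {B n a a' : ℕ} (hn : n ≤ B) (ha : a ≤ (B + 2) ^ a') :
    n * a ≤ (B + 2) ^ (a' + 1) := by
  rw [pow_succ, mul_comm]; exact Nat.mul_le_mul ha (by omega)

lemma bound_loop {B n a a' : ℕ} (hn : n ≤ B) (ha : a ≤ (B + 2) ^ a') :
    n * ((a + 4) + 1) + 6 ≤ (B + 2) ^ (a' + 7) := by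
  have h1 := bound_add (by omega) ha (bound_const B 5 3 (by norm_num))
  calc n * ((a + 4) + 1) + 6 ≤ (B + 2) ^ (a' + 3 + 1 + 1) + 6 :=
        Nat.add_le_add_right (bound_mul hn h1) _
    _ ≤ (B + 2) ^ (a' + 5) + (B + 2) ^ (a' + 5) := Nat.add_le_add le_rfl (bound_const B 6 _ (by
        calc 6 ≤ 2 ^ 5 := by norm_num
          _ ≤ _ := Nat.pow_le_pow_right (by omega) (by omega)))
    _ ≤ (B + 2) ^ (a' + 5) * (B + 2) ^ 2 := by
      rw [← mul_two]; exact Nat.mul_le_mul_left _ (bound_const B 2 2 (by norm_num))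
    _ = _ := by rw [← pow_add]

lemma update_le {V : ℕ → ℕ} {B : ℕ} (hV : ∀ x, V x ≤ B) {v : ℕ} (hv : v ≤ B) (x y : ℕ) :
    Function.update V x v y ≤ B := by
  rw [Function.update_apply]; split_ifs <;> simp_all

end RAM

/-- A compiled expression is evaluated correctly, in time polynomial in a bound on the variables;
variables, arrays and lower temporary registers keep their contents. -/
theorem Exp.compile_runs {I : ℕ → ℕ} {L : ℕ} (hI : ∀ i, L ≤ i → I i = 0) {A : Arrays} {B : ℕ}
    (e : Exp) : ∀ {V : ℕ → ℕ} {s : RAMState} (d : ℕ), Repr I L V A s → (∀ x, V x ≤ B) →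
    Runs (e.compile d) s ((B + 2) ^ e.deg) fun s' =>
      Repr I L V A s' ∧ s'.reg (T d) = e.eval I V A ∧ Keep d s s' ∧ s'.mem = s.mem := by
  induction e with
  | var x =>
    intro V s d h hV
    exact Runs.copy ⟨h.setT _ _, by simp [h.var, Exp.eval], Keep.refl.setT le_rfl _, rfl⟩
  | const c =>
    intro V s d h hV
    exact Runs.const ⟨h.setT _ _, by simp [Exp.eval], Keep.refl.setT le_rfl _, rfl⟩
  | add e f ihe ihf =>
    intro V s d h hV
    refine Runs.mono ((ihe d h hV).seq fun s1 ⟨h1, h2, h3, h4⟩ =>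
      (ihf (d + 1) h1 hV).seq fun s2 ⟨h5, h6, h7, h8⟩ => Runs.add ?_)
      (bound_add (by omega) le_rfl (bound_add_one B f.deg)) (fun _ => id)
    exact ⟨h5.setT _ _, by simp [h6, h7 d (by omega), h2, Exp.eval],
      (h3.trans h7 (by omega)).setT le_rfl _, h8.trans h4⟩
  | sub e f ihe ihf =>
    intro V s d h hV
    refine Runs.mono ((ihe d h hV).seq fun s1 ⟨h1, h2, h3, h4⟩ =>
      (ihf (d + 1) h1 hV).seq fun s2 ⟨h5, h6, h7, h8⟩ => Runs.sub ?_)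
      (bound_add (by omega) le_rfl (bound_add_one B f.deg)) (fun _ => id)
    exact ⟨h5.setT _ _, by simp [h6, h7 d (by omega), h2, Exp.eval],
      (h3.trans h7 (by omega)).setT le_rfl _, h8.trans h4⟩
  | inp e ihe =>
    intro V s d h hV
    refine Runs.mono ((ihe d h hV).seq fun s1 ⟨h1, h2, h3, h4⟩ =>
      Runs.sub_seq <| Runs.ite (c := 1) (fun hx => Runs.load ?_) (fun hx => Runs.const ?_))
      (bound_add (b' := 2) (by omega) le_rfl (bound_const _ _ _ (by norm_num))) (fun _ => id)
    · simp [h2, h1.base] at hx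
      exact ⟨(h1.setT _ _).setT _ _, by simp [h2, Exp.eval, ← h1.inp _
          (show e.eval I V A < L by omega)],
        (h3.setT (by omega) _).setT le_rfl _, h4⟩
    · simp [h2, h1.base] at hx
      exact ⟨(h1.setT _ _).setT _ _, by simp [Exp.eval, hI _ (show L ≤ e.eval I V A by omega)],
        (h3.setT (by omega) _).setT le_rfl _, h4⟩
  | get a x y =>
    intro V s d h hV
    refine Runs.mono ((address_runs h a x y d).seq fun s1 ⟨h1, h2, h3, h4⟩ => Runs.load ?_) ?_
      (fun _ => id)
    · exact ⟨h1.setT _ _, by simp [h2, h1.arr, Exp.eval], h3.setT le_rfl _, h4⟩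
    · have h1 := hV x
      have h2 := hV y
      have : (B + 2) ^ 5 = (B + 2) * (B + 2) ^ 4 := by ring
      have h4 : 2 ^ 4 ≤ (B + 2) ^ 4 := bound_const _ _ _ le_rfl
      have h5 := Nat.mul_le_mul_left (B + 2) h4
      simp only [Exp.deg]; omega
  | ite c e f ihc ihe ihf =>
    intro V s d h hV
    refine Runs.mono ((ihc d h hV).seq fun s1 ⟨h1, h2, h3, h4⟩ =>
      Runs.ite (c := (B + 2) ^ (e.deg + f.deg)) (fun hx => (ihe d h1 hV).mono ?_ ?_)
        (fun hx => (ihf d h1 hV).mono ?_ ?_)) (bound_add (by omega) le_rfl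
          (bound_add_one B _)) (fun _ => id)
    · exact Nat.pow_le_pow_right (by omega) (by omega)
    · rintro s2 ⟨h5, h6, h7, h8⟩
      rw [h2] at hx
      exact ⟨h5, by simp [h6, Exp.eval, hx], h3.trans h7 le_rfl, h8.trans h4⟩
    · exact Nat.pow_le_pow_right (by omega) (by omega)
    · rintro s2 ⟨h5, h6, h7, h8⟩
      rw [h2] at hx
      exact ⟨h5, by simp [h6, Exp.eval, hx], h3.trans h7 le_rfl, h8.trans h4⟩
  | sum x y e ihe =>
    intro V s d h hV
    have hb : 1 + (1 + (1 + (1 + ((V y * (((B + 2) ^ e.deg + (1 + (1 + (1 + 1)))) + 1) + 1) + 1))))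
        ≤ (B + 2) ^ (e.deg + 7) := by
      have h1 := bound_loop (hV y) (le_refl ((B + 2) ^ e.deg))
      have h2 : V y * (((B + 2) ^ e.deg + (1 + (1 + (1 + 1)))) + 1) ≤
        V y * (((B + 2) ^ e.deg + 4) + 1) := Nat.mul_le_mul_left _ (by omega)
      exact le_trans (by omega) h1
    refine Runs.mono (Runs.const_seq <| Runs.copy_seq <| Runs.copy_seq <| Runs.const_seq <|
      Runs.seq (Runs.countdown (fun i s' => ∃ j, i + j = V y ∧
        Repr I L (Function.update V x j) A s' ∧
        s'.reg (T d) = ∑ i ∈ Finset.range j, e.eval I (Function.update V x i) A ∧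
        s'.reg (T (d + 1)) = V x ∧ s'.reg (T (d + 2)) = i ∧ Keep d s s' ∧ s'.mem = s.mem)
        (c := (B + 2) ^ e.deg + (1 + (1 + (1 + 1))))
        ?_ ?_ (V y) ?_) ?_) hb (fun _ => id)
    · rintro i s1 ⟨j, h1, h2, h3, h4, h5, h6, h7⟩
      refine ⟨by omega, (ihe (d + 3) h2 (update_le hV (by have := hV y; omega) _)).seq ?_⟩
      rintro s2 ⟨h8, h9, h10, h11⟩
      refine Runs.add_seq <| Runs.const_seq <| Runs.add_seq <| Runs.sub
          ⟨j + 1, by omega, ?_, ?_, ?_,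
        ?_, ?_, h11.trans h7⟩
      · have := ((((h8.setT d (s2.reg (T d) + s2.reg (T (d + 3)))).setT (d + 3) 1).setR x
          (j + 1)).setT (d + 2) i)
        rw [Function.update_idem] at this
        convert this using 2
        · simp [h8.var]
        · simp [h10 (d + 2) (by omega), h5]
      · simp [h9, h10 d (by omega), h3, Finset.sum_range_succ]
      · simp [h10 (d + 1) (by omega), h4]
      · simp [h10 (d + 2) (by omega), h5]
      · exact ((((h6.trans h10 (by omega)).setT le_rfl _).setT (by omega) _).setR _ _).setT
          (by omega) _
    · rintro s1 ⟨j, h1, h2, h3, h4, h5, h6, h7⟩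
      exact h5
    · refine ⟨0, rfl, (((h.setT _ _).setT _ _).setT _ _).setR _ _, ?_, ?_, ?_, ?_, rfl⟩
      · simp
      · simp [h.var]
      · simp [h.var]
      · exact (((Keep.refl.setT le_rfl _).setT (by omega) _).setT (by omega) _).setR _ _
    · rintro s1 ⟨j, h1, h2, h3, h4, h5, h6, h7⟩
      refine Runs.copy ⟨?_, ?_, h6.setR _ _, h7⟩
      · have := h2.setR x (V x)
        rw [h4]
        simpa using this
      · have : j = V y := by omega
        simp [h3, Exp.eval, this]
  | bind x y e f ihe ihf =>
    intro V s d h hV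
    have hb : (B + 2) ^ e.deg + (1 + (1 + (1 + (1 + ((B + 2) ^ f.deg + (1 + 1)))))) ≤
        (B + 2) ^ (e.deg + f.deg + 5) := by
      have h1 := bound_add (by omega) (le_refl ((B + 2) ^ f.deg)) (bound_const B 6 3 (by norm_num))
      have h2 := bound_add (by omega) (le_refl ((B + 2) ^ e.deg)) h1
      calc _ = (B + 2) ^ e.deg + ((B + 2) ^ f.deg + 6) := by ring
        _ ≤ _ := h2
        _ = _ := by ring_nf
    refine Runs.mono ((ihe (d + 1) h hV).seq fun s1 ⟨h1, h2, h3, h4⟩ =>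
      Runs.sub_seq <| Runs.sub_seq <| Runs.copy_seq <| Runs.copy_seq <|
      (ihf (V := Function.update V x (min (e.eval I V A) (V y))) (d + 2) ?_
        (update_le hV ((min_le_right _ _).trans (hV y)) _)).seq
      fun s2 ⟨h5, h6, h7, h8⟩ => Runs.copy_seq <| Runs.copy ?_) hb (fun _ => id)
    · have hm : s1.reg (T (d + 1)) - (s1.reg (T (d + 1)) - V y) = min (e.eval I V A) (V y) := by
        rw [h2]; omega
      have := ((((h1.setT (d + 2) (s1.reg (T (d + 1)) - V y)).setT (d + 2)
        (min (e.eval I V A) (V y))).setT (d + 1) (V x)).setR x (min (e.eval I V A) (V y)))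
      convert this using 2 <;> simp [h1.var, hm]
    · refine ⟨?_, ?_, ?_, h8.trans h4⟩
      · have := (h5.setR x (V x)).setT d (s2.reg (T (d + 2)))
        rw [Function.update_idem, Function.update_eq_self] at this
        convert this using 2
        · simp [h7 (d + 1) (by omega), h1.var]
        · simp
      · simp [h6, Exp.eval]
      · intro d' hd
        rw [← h3 d' (by omega)]
        have := h7 d' (by omega)
        simp [show d' ≠ d + 1 by omega, show d' ≠ d + 2 by omega] at this
        simp [this, show d' ≠ d by omega]

/-- A compiled statement has the right effect on the arrays, in time polynomial in a bound on the
variables; variables and lower temporary registers keep their contents. -/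
theorem Stm.compile_runs {I : ℕ → ℕ} {L : ℕ} (hI : ∀ i, L ≤ i → I i = 0) {B : ℕ}
    (p : Stm) : ∀ {V : ℕ → ℕ} {A : Arrays} {s : RAMState} (d : ℕ), Repr I L V A s →
    (∀ x, V x ≤ B) → Runs (p.compile d) s ((B + 2) ^ p.deg) fun s' =>
      Repr I L V (p.exec I V A) s' ∧ Keep d s s' := by
  induction p with
  | skip =>
    intro V A s d h hV
    exact Runs.skip ⟨h, Keep.refl⟩
  | store a x y e =>
    intro V A s d h hV
    refine Runs.mono ((e.compile_runs hI d h hV).seq fun s1 ⟨h1, h2, h3, h4⟩ =>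
      (address_runs h1 a x y (d + 1)).seq fun s2 ⟨h5, h6, h7, h8⟩ => Runs.store ?_)
      (bound_add (by omega) le_rfl (b' := 5) ?_) (fun _ => id)
    · rw [h6, h7 d (by omega), h2]
      exact ⟨h5.setArr _ _ _ _, fun i hi => (h7 i (by omega)).trans (h3 i hi)⟩
    · have h1 := hV x
      have h2 := hV y
      have : (B + 2) ^ 5 = (B + 2) * (B + 2) ^ 4 := by ring
      have h4 : 2 ^ 4 ≤ (B + 2) ^ 4 := bound_const _ _ _ le_rfl
      have h5 := Nat.mul_le_mul_left (B + 2) h4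
      omega
  | seq p q ihp ihq =>
    intro V A s d h hV
    exact Runs.mono ((ihp d h hV).seq fun s1 ⟨h1, h2⟩ => (ihq d h1 hV).mono le_rfl
      fun s2 ⟨h3, h4⟩ => ⟨h3, h2.trans h4 le_rfl⟩) (bound_add (by omega) le_rfl le_rfl)
      (fun _ => id)
  | ite c p q ihp ihq =>
    intro V A s d h hV
    refine Runs.mono ((c.compile_runs hI d h hV).seq fun s1 ⟨h1, h2, h3, h4⟩ =>
      Runs.ite (c := (B + 2) ^ (p.deg + q.deg)) (fun hx => (ihp d h1 hV).mono ?_ ?_)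
        (fun hx => (ihq d h1 hV).mono ?_ ?_)) (bound_add (by omega) le_rfl
          (bound_add_one B _)) (fun _ => id)
    · exact Nat.pow_le_pow_right (by omega) (by omega)
    · rintro s2 ⟨h5, h7⟩
      rw [h2] at hx
      exact ⟨by simpa [Stm.exec, hx] using h5, h3.trans h7 le_rfl⟩
    · exact Nat.pow_le_pow_right (by omega) (by omega)
    · rintro s2 ⟨h5, h7⟩
      rw [h2] at hx
      exact ⟨by simpa [Stm.exec, hx] using h5, h3.trans h7 le_rfl⟩
  | loop x y p ihp =>
    intro V A s d h hV
    have hb : 1 + (1 + (1 + ((V y * (((B + 2) ^ p.deg + (1 + (1 + 1))) + 1) + 1) + 1)))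
        ≤ (B + 2) ^ (p.deg + 7) := by
      have h1 := bound_loop (hV y) (le_refl ((B + 2) ^ p.deg))
      have h2 : V y * (((B + 2) ^ p.deg + (1 + (1 + 1))) + 1) ≤
        V y * (((B + 2) ^ p.deg + 4) + 1) := Nat.mul_le_mul_left _ (by omega)
      exact le_trans (by omega) h1
    refine Runs.mono (Runs.copy_seq <| Runs.copy_seq <| Runs.const_seq <|
      Runs.seq (Runs.countdown (fun i s' => ∃ j, i + j = V y ∧
        Repr I L (Function.update V x j)
          (Nat.rec A (fun i A' => p.exec I (Function.update V x i) A') j) s' ∧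
        s'.reg (T (d + 1)) = V x ∧ s'.reg (T (d + 2)) = i ∧ Keep d s s')
        (c := (B + 2) ^ p.deg + (1 + (1 + 1)))
        ?_ ?_ (V y) ?_) ?_) hb (fun _ => id)
    · rintro i s1 ⟨j, h1, h2, h4, h5, h6⟩
      refine ⟨by omega, (ihp (d + 3) h2 (update_le hV (by have := hV y; omega) _)).seq ?_⟩
      rintro s2 ⟨h8, h10⟩
      refine Runs.const_seq <| Runs.add_seq <| Runs.sub ⟨j + 1, by omega, ?_, ?_, ?_, ?_⟩
      · have := (((h8.setT (d + 3) 1).setR x (j + 1)).setT (d + 2) i)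
        rw [Function.update_idem] at this
        convert this using 2
        · simp [h8.var]
        · simp [h10 (d + 2) (by omega), h5]
      · simp [h10 (d + 1) (by omega), h4]
      · simp [h10 (d + 2) (by omega), h5]
      · exact (((h6.trans h10 (by omega)).setT (by omega) _).setR _ _).setT (by omega) _
    · rintro s1 ⟨j, h1, h2, h4, h5, h6⟩
      exact h5
    · refine ⟨0, rfl, ((h.setT _ _).setT _ _).setR _ _, ?_, ?_, ?_⟩
      · simp [h.var]
      · simp [h.var]
      · exact ((Keep.refl.setT (by omega) _).setT (by omega) _).setR _ _
    · rintro s1 ⟨j, h1, h2, h4, h5, h6⟩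
      refine Runs.copy ⟨?_, h6.setR _ _⟩
      have := h2.setR x (V x)
      have hj : j = V y := by omega
      subst hj
      rw [h4]
      rw [Function.update_idem, Function.update_eq_self] at this
      exact this
  | bind x y e p ihp =>
    intro V A s d h hV
    have hb : (B + 2) ^ e.deg + (1 + (1 + (1 + (1 + ((B + 2) ^ p.deg + 1))))) ≤
        (B + 2) ^ (e.deg + p.deg + 5) := by
      have h1 := bound_add (by omega) (le_refl ((B + 2) ^ p.deg)) (bound_const B 5 3 (by norm_num))
      have h2 := bound_add (by omega) (le_refl ((B + 2) ^ e.deg)) h1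
      calc _ = (B + 2) ^ e.deg + ((B + 2) ^ p.deg + 5) := by ring
        _ ≤ _ := h2
        _ = _ := by ring_nf
    refine Runs.mono ((e.compile_runs hI (d + 1) h hV).seq fun s1 ⟨h1, h2, h3, h4⟩ =>
      Runs.sub_seq <| Runs.sub_seq <| Runs.copy_seq <| Runs.copy_seq <|
      (ihp (V := Function.update V x (min (e.eval I V A) (V y))) (A := A) (d + 2) ?_
        (update_le hV ((min_le_right _ _).trans (hV y)) _)).seq
      fun s2 ⟨h5, h7⟩ => Runs.copy ?_) hb (fun _ => id)
    · have hm : s1.reg (T (d + 1)) - (s1.reg (T (d + 1)) - V y) = min (e.eval I V A) (V y) := by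
        rw [h2]; omega
      have := ((((h1.setT (d + 2) (s1.reg (T (d + 1)) - V y)).setT (d + 2)
        (min (e.eval I V A) (V y))).setT (d + 1) (V x)).setR x (min (e.eval I V A) (V y)))
      convert this using 2 <;> simp [h1.var, hm]
    · refine ⟨?_, ?_⟩
      · have := (h5.setR x (V x))
        rw [Function.update_idem, Function.update_eq_self] at this
        have hx : s2.reg (T (d + 1)) = V x := by simp [h7 (d + 1) (by omega), h1.var]
        rwa [hx]
      · intro d' hd
        rw [← h3 d' (by omega)]
        have := h7 d' (by omega)
        simp [show d' ≠ d + 1 by omega, show d' ≠ d + 2 by omega] at this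
        simp [this]

/-! ### Derived expressions and reasoning about loops -/

namespace Exp

/-- An expression is read as a condition: it holds if its value is not `0`. -/
def Holds (I : ℕ → ℕ) (V : ℕ → ℕ) (A : Arrays) (e : Exp) : Prop := e.eval I V A ≠ 0

instance (I : ℕ → ℕ) (V : ℕ → ℕ) (A : Arrays) (e : Exp) : Decidable (e.Holds I V A) :=
  inferInstanceAs (Decidable (_ ≠ 0))

/-- Subtraction is truncated, so `f - e` is not `0` exactly if `e < f`. -/
def lt (e f : Exp) : Exp := .sub f e

def le (e f : Exp) : Exp := .sub (.const 1) (.sub e f)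

def not (e : Exp) : Exp := .sub (.const 1) e

def and (e f : Exp) : Exp := .ite e f (.const 0)

def or (e f : Exp) : Exp := .add e f

def eq (e f : Exp) : Exp := (le e f).and (le f e)

def ex (x y : ℕ) (e : Exp) : Exp := .sum x y e

def all (x y : ℕ) (e : Exp) : Exp := (ex x y e.not).not

/-- The number of values of `x` below `y` for which `e` holds. -/
def count (x y : ℕ) (e : Exp) : Exp := .sum x y (.ite e (.const 1) (.const 0))

/-- Disjunction of a list of conditions. -/
def any (l : List Exp) : Exp := l.foldr or (.const 0)

/-- Conjunction of a list of conditions. -/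
def every (l : List Exp) : Exp := l.foldr and (.const 1)

variable {I V : ℕ → ℕ} {A : Arrays} {e f c : Exp} {x y : ℕ}

@[simp] lemma eval_var : (Exp.var x).eval I V A = V x := rfl
@[simp] lemma eval_const {n : ℕ} : (Exp.const n).eval I V A = n := rfl
@[simp] lemma eval_add : (e.add f).eval I V A = e.eval I V A + f.eval I V A := rfl
@[simp] lemma eval_sub : (e.sub f).eval I V A = e.eval I V A - f.eval I V A := rfl
@[simp] lemma eval_inp : (Exp.inp e).eval I V A = I (e.eval I V A) := rfl
@[simp] lemma eval_get {a : Fin 16} : (Exp.get a x y).eval I V A = A a (V x) (V y) := rfl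
@[simp] lemma eval_sum : (Exp.sum x y e).eval I V A =
    ∑ i ∈ Finset.range (V y), e.eval I (Function.update V x i) A := rfl
@[simp] lemma eval_bind : (Exp.bind x y e f).eval I V A =
    f.eval I (Function.update V x (min (e.eval I V A) (V y))) A := rfl

@[simp] lemma eval_ite : (Exp.ite c e f).eval I V A =
    if c.Holds I V A then e.eval I V A else f.eval I V A := by
  by_cases h : c.eval I V A = 0 <;> simp [Exp.eval, Holds, h]

@[simp] lemma holds_get {a : Fin 16} : (Exp.get a x y).Holds I V A ↔ A a (V x) (V y) ≠ 0 := Iff.rfl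

@[simp] lemma holds_lt : (e.lt f).Holds I V A ↔ e.eval I V A < f.eval I V A := by
  simp [Holds, lt]; omega

@[simp] lemma holds_le : (e.le f).Holds I V A ↔ e.eval I V A ≤ f.eval I V A := by
  simp [Holds, le]; omega

@[simp] lemma holds_not : e.not.Holds I V A ↔ ¬ e.Holds I V A := by
  simp [Holds, not]; omega

@[simp] lemma holds_and : (e.and f).Holds I V A ↔ e.Holds I V A ∧ f.Holds I V A := by
  by_cases h : e.eval I V A = 0 <;> simp [Exp.eval, Holds, and, h]

@[simp] lemma holds_or : (e.or f).Holds I V A ↔ e.Holds I V A ∨ f.Holds I V A := by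
  simp [Holds, or]; tauto

@[simp] lemma holds_eq : (e.eq f).Holds I V A ↔ e.eval I V A = f.eval I V A := by
  simp [eq, le_antisymm_iff]

@[simp] lemma holds_ex : (ex x y e).Holds I V A ↔
    ∃ i < V y, e.Holds I (Function.update V x i) A := by
  simp [Holds, ex]

@[simp] lemma holds_all : (all x y e).Holds I V A ↔
    ∀ i < V y, e.Holds I (Function.update V x i) A := by
  simp [all]

@[simp] lemma holds_bind : (Exp.bind x y e f).Holds I V A ↔
    f.Holds I (Function.update V x (min (e.eval I V A) (V y))) A := Iff.rfl

@[simp] lemma eval_count : (count x y e).eval I V A =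
    ((Finset.range (V y)).filter fun i => e.Holds I (Function.update V x i) A).card := by
  rw [count, eval_sum, Finset.card_filter]; simp

@[simp] lemma holds_any {l : List Exp} : (any l).Holds I V A ↔ ∃ e ∈ l, e.Holds I V A := by
  induction l with
  | nil => simp [any, Holds]
  | cons a l ih => simp only [any, List.foldr_cons, holds_or, List.mem_cons] at ih ⊢; simp [ih]

@[simp] lemma holds_every {l : List Exp} : (every l).Holds I V A ↔ ∀ e ∈ l, e.Holds I V A := by
  induction l with
  | nil => simp [every, Holds]
  | cons a l ih => simp only [every, List.foldr_cons, holds_and, List.mem_cons] at ih ⊢; simp [ih]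

/-- The array `a` occurs in the expression. -/
def Reads (a : Fin 16) : Exp → Prop
  | .var _ => False
  | .const _ => False
  | .add e f => e.Reads a ∨ f.Reads a
  | .sub e f => e.Reads a ∨ f.Reads a
  | .inp e => e.Reads a
  | .get b _ _ => a = b
  | .ite c e f => c.Reads a ∨ e.Reads a ∨ f.Reads a
  | .sum _ _ e => e.Reads a
  | .bind _ _ e f => e.Reads a ∨ f.Reads a

/-- An expression only depends on the arrays that occur in it. -/
lemma eval_congr {A' : Arrays} {e : Exp} (h : ∀ a, e.Reads a → A a = A' a) :
    e.eval I V A = e.eval I V A' := by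
  induction e generalizing V with
  | var | const => rfl
  | add e f ihe ihf | sub e f ihe ihf =>
    rw [Exp.eval, Exp.eval, ihe fun a ha => h a (Or.inl ha), ihf fun a ha => h a (Or.inr ha)]
  | inp e ih => rw [Exp.eval, Exp.eval, ih h]
  | get b x y => rw [Exp.eval, Exp.eval, h b rfl]
  | ite c e f ihc ihe ihf =>
    rw [Exp.eval, Exp.eval, ihc fun a ha => h a (Or.inl ha),
      ihe fun a ha => h a (Or.inr (Or.inl ha)), ihf fun a ha => h a (Or.inr (Or.inr ha))]
  | sum x y e ih =>
    rw [Exp.eval, Exp.eval]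
    exact Finset.sum_congr rfl fun i _ => ih h
  | bind x y e f ihe ihf =>
    rw [Exp.eval, Exp.eval, ihe fun a ha => h a (Or.inl ha), ihf fun a ha => h a (Or.inr ha)]

lemma eval_le : (e.le f).eval I V A = if e.eval I V A ≤ f.eval I V A then 1 else 0 := by
  simp only [le, eval_sub, eval_const]; split_ifs <;> omega

end Exp

namespace Stm

variable {I V : ℕ → ℕ} {A : Arrays}

@[simp] lemma exec_skip : Stm.skip.exec I V A = A := rfl
@[simp] lemma exec_store {a : Fin 16} {x y : ℕ} {e : Exp} :
    (Stm.store a x y e).exec I V A = A.set a (V x) (V y) (e.eval I V A) := rfl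
@[simp] lemma exec_seq {p q : Stm} : (p.seq q).exec I V A = q.exec I V (p.exec I V A) := rfl
@[simp] lemma exec_bind {x y : ℕ} {e : Exp} {p : Stm} : (Stm.bind x y e p).exec I V A =
    p.exec I (Function.update V x (min (e.eval I V A) (V y))) A := rfl

@[simp] lemma exec_ite {c : Exp} {p q : Stm} : (Stm.ite c p q).exec I V A =
    if c.Holds I V A then p.exec I V A else q.exec I V A := by
  by_cases h : c.eval I V A = 0 <;> simp [exec, Exp.Holds, h]

/-- The rule of invariants for loops. -/
lemma loop_induct {x y : ℕ} {p : Stm} (P : ℕ → Arrays → Prop) (h0 : P 0 A)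
    (hstep : ∀ i A', i < V y → P i A' → P (i + 1) (p.exec I (Function.update V x i) A')) :
    P (V y) ((Stm.loop x y p).exec I V A) := by
  have : ∀ n ≤ V y, P n (Nat.rec A (fun i A' => p.exec I (Function.update V x i) A') n) := by
    intro n hn
    induction n with
    | zero => exact h0
    | succ n ih => exact hstep n _ hn (ih (by omega))
  exact this _ le_rfl

/-- The statement has a store instruction for the array `a`. -/
def Writes (a : Fin 16) : Stm → Prop
  | .skip => False
  | .store b _ _ _ => a = b
  | .seq p q => p.Writes a ∨ q.Writes a
  | .ite _ p q => p.Writes a ∨ q.Writes a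
  | .loop _ _ p => p.Writes a
  | .bind _ _ _ p => p.Writes a

/-- The frame rule: a statement leaves every array alone that it does not store into. -/
lemma exec_of_not_writes {a : Fin 16} {p : Stm} (h : ¬ p.Writes a) : p.exec I V A a = A a := by
  induction p generalizing V A with
  | skip => rfl
  | store b x y e =>
    funext i j
    simp only [Writes] at h
    simp [Arrays.set, h]
  | seq p q ihp ihq =>
    simp only [Writes, not_or] at h
    rw [exec_seq, ihq h.2, ihp h.1]
  | ite c p q ihp ihq =>
    simp only [Writes, not_or] at h
    rw [exec_ite]
    split_ifs
    · exact ihp h.1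
    · exact ihq h.2
  | loop x y p ih =>
    exact loop_induct (P := fun _ A' => A' a = A a) rfl fun i A' _ h' => by rw [ih h, h']
  | bind x y e p ih => exact ih h

/-- Assigns values to row `z` of array `a`: entry `x` becomes the value of `e`, for `x` below
`y`. -/
def row (a : Fin 16) (z x y : ℕ) (e : Exp) : Stm := .loop x y (.store a z x e)

@[simp] lemma writes_row {a b : Fin 16} {z x y : ℕ} {e : Exp} :
    (row a z x y e).Writes b ↔ b = a := Iff.rfl

/-- The effect of `row`, where `F` gives the new entries. The expression may refer to the row
itself, in which the entries before the current one have been replaced already. -/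
lemma exec_row {a : Fin 16} {z x y : ℕ} {e : Exp} (hz : z ≠ x) (F : ℕ → ℕ)
    (h : ∀ i < V y, ∀ A' : Arrays, (∀ b ≠ a, A' b = A b) → (∀ r ≠ V z, A' a r = A a r) →
      (∀ j < i, A' a (V z) j = F j) → (∀ j ≥ i, A' a (V z) j = A a (V z) j) →
      e.eval I (Function.update V x i) A' = F i) :
    (∀ j < V y, (row a z x y e).exec I V A a (V z) j = F j) ∧
    (∀ j ≥ V y, (row a z x y e).exec I V A a (V z) j = A a (V z) j) ∧
    ∀ r ≠ V z, (row a z x y e).exec I V A a r = A a r := by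
  have := loop_induct (I := I) (V := V) (A := A) (x := x) (y := y) (p := .store a z x e)
    (P := fun i A' => (∀ b ≠ a, A' b = A b) ∧ (∀ j < i, A' a (V z) j = F j) ∧
      (∀ j ≥ i, A' a (V z) j = A a (V z) j) ∧ ∀ r ≠ V z, A' a r = A a r)
    ⟨fun _ _ => rfl, fun j hj => by omega, fun _ _ => rfl, fun _ _ => rfl⟩ ?_
  · exact ⟨this.2.1, this.2.2.1, this.2.2.2⟩
  · rintro i A' hi ⟨h1, h2, h3, h4⟩
    rw [exec_store, h i hi A' h1 h4 h2 h3]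
    simp only [Function.update_self, Function.update_of_ne hz]
    refine ⟨fun b hb => ?_, fun j hj => ?_, fun j hj => ?_, fun r hr => ?_⟩
    · rw [← h1 b hb]; funext i' j'; simp [Arrays.set, hb]
    · by_cases hji : j = i
      · simp [Arrays.set, hji]
      · simp [Arrays.set, hji, h2 j (by omega)]
    · simp [Arrays.set, show j ≠ i by omega, h3 j (by omega)]
    · rw [← h4 r hr]; funext j'; simp [Arrays.set, hr]

/-- The effect of `row` if the value of `e` is not affected by the changes. -/
lemma exec_row_of_eq {a : Fin 16} {z x y : ℕ} {e : Exp} (hz : z ≠ x)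
    (h : ∀ i < V y, ∀ A' : Arrays, (∀ b ≠ a, A' b = A b) → (∀ r ≠ V z, A' a r = A a r) →
      (∀ j ≥ i, A' a (V z) j = A a (V z) j) →
      e.eval I (Function.update V x i) A' = e.eval I (Function.update V x i) A) :
    ∀ j < V y, (row a z x y e).exec I V A a (V z) j = e.eval I (Function.update V x j) A :=
  (exec_row hz (fun i => e.eval I (Function.update V x i) A)
    fun i hi A' h1 h2 _ h4 => h i hi A' h1 h2 h4).1

lemma exec_row_of_not_reads {a : Fin 16} {z x y : ℕ} {e : Exp} (hz : z ≠ x) (h : ¬ e.Reads a) :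
    ∀ j < V y, (row a z x y e).exec I V A a (V z) j = e.eval I (Function.update V x j) A :=
  exec_row_of_eq hz fun _ _ _ hA' _ _ => Exp.eval_congr fun b hb =>
    hA' b fun hba => h (hba ▸ hb)

/-- Assigns values to a rectangle of array `a`. -/
def table (a : Fin 16) (x y x' y' : ℕ) (e : Exp) : Stm := .loop x y (row a x x' y' e)

/-- The effect of `table`, where `F` gives the new entries. They may be computed from earlier rows.
-/
lemma exec_table {a : Fin 16} {x y x' y' : ℕ} {e : Exp} (hx : x ≠ x') (hy : x ≠ y')
    (F : ℕ → ℕ → ℕ)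
    (h : ∀ i < V y, ∀ j < V y', ∀ A' : Arrays, (∀ b ≠ a, A' b = A b) →
      (∀ r < i, ∀ j < V y', A' a r j = F r j) →
      e.eval I (Function.update (Function.update V x i) x' j) A' = F i j) :
    ∀ i < V y, ∀ j < V y', (table a x y x' y' e).exec I V A a i j = F i j := by
  have := loop_induct (I := I) (V := V) (A := A) (x := x) (y := y) (p := row a x x' y' e)
    (P := fun i A' => (∀ b ≠ a, A' b = A b) ∧ (∀ r < i, ∀ j < V y', A' a r j = F r j))
    ⟨fun _ _ => rfl, fun j hj => by omega⟩ ?_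
  · exact this.2
  · rintro i A' hi ⟨h1, h2⟩
    have h3 := exec_row (I := I) (V := Function.update V x i) (A := A') (a := a) (z := x) (x := x')
      (y := y') (e := e) hx (F i) (by
        simp only [Function.update_self, Function.update_of_ne hy.symm]
        intro j hj A'' h4 h5 h6 h7
        refine h i hi j hj A'' (fun b hb => (h4 b hb).trans (h1 b hb)) fun r hr j' hj' => ?_
        rw [h5 r (by omega), h2 r hr j' hj'])
    simp only [Function.update_self, Function.update_of_ne hy.symm] at h3
    refine ⟨fun b hb => ?_, fun r hr j hj => ?_⟩
    · rw [exec_of_not_writes (by simpa using hb), h1 b hb]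
    · by_cases hri : r = i
      · subst hri; exact h3.1 j hj
      · rw [h3.2.2 r hri, h2 r (by omega) j hj]

@[simp] lemma writes_table {a b : Fin 16} {x y x' y' : ℕ} {e : Exp} :
    (table a x y x' y' e).Writes b ↔ b = a := Iff.rfl

end Stm

/-! ### Breadth-first search -/

/-- The function `l` assigns to the vertices below `n` their breadth-first search levels, counted
from `1`, in the digraph `E` with sources `S`; unreachable vertices have level `0`. -/
structure IsLevel (n : ℕ) (S : ℕ → Prop) (E : ℕ → ℕ → Prop) (l : ℕ → ℕ) : Prop where
  src : ∀ i < n, l i = 1 ↔ S i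
  pred : ∀ i < n, 2 ≤ l i → ∃ w < n, l w ≠ 0 ∧ l w < l i ∧ E w i
  closed : ∀ w < n, ∀ i < n, l w ≠ 0 → E w i → l i ≠ 0
  le : ∀ i < n, l i ≤ n + 1

lemma IsLevel.reachable {n : ℕ} {S : ℕ → Prop} {E : ℕ → ℕ → Prop} {l : ℕ → ℕ}
    (h : IsLevel n S E l) {i : ℕ} (hi : i < n) (hl : l i ≠ 0) :
    ∃ j < n, S j ∧ Relation.ReflTransGen (fun a b => E a b ∧ b < n) j i := by
  induction hm : l i using Nat.strong_induction_on generalizing i with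
  | _ m ih =>
    by_cases h1 : l i = 1
    · exact ⟨i, hi, (h.src i hi).1 h1, .refl⟩
    · obtain ⟨w, hw, h2, h3, h4⟩ := h.pred i hi (by omega)
      obtain ⟨j, hj, h5, h6⟩ := ih (l w) (by omega) hw h2 rfl
      exact ⟨j, hj, h5, h6.tail ⟨h4, hi⟩⟩

lemma IsLevel.of_reachable {n : ℕ} {S : ℕ → Prop} {E : ℕ → ℕ → Prop} {l : ℕ → ℕ}
    (h : IsLevel n S E l) {i j : ℕ} (hj : j < n) (hS : S j)
    (hr : Relation.ReflTransGen (fun a b => E a b ∧ b < n) j i) : i < n ∧ l i ≠ 0 := by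
  induction hr with
  | refl => exact ⟨hj, by have := (h.src j hj).2 hS; omega⟩
  | tail _ h2 ih => exact ⟨h2.2, h.closed _ ih.1 _ h2.2 ih.2 h2.1⟩

section Names

/-! Variables `0` to `9` hold parameters that stay fixed while a statement runs: the length of the
input, the number `N` of vertices, `2 * N`, the bounds `k`, `m` and `K` on cuts, borders and bags,
the number `H` of codes, `N + 1`, zero, and whether another round is needed. The other names are
for the variables of loops and bindings. -/

notation "vL" => (0 : ℕ)
notation "vN" => (1 : ℕ)
notation "vNN" => (2 : ℕ)
notation "vk" => (3 : ℕ)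
notation "vm" => (4 : ℕ)
notation "vK" => (5 : ℕ)
notation "vH" => (6 : ℕ)
notation "vNs" => (7 : ℕ)
notation "vO" => (8 : ℕ)
notation "vRun" => (9 : ℕ)
notation "xs" => (10 : ℕ)
notation "xq" => (11 : ℕ)
notation "xj" => (12 : ℕ)
notation "xz" => (13 : ℕ)
notation "xt" => (20 : ℕ)
notation "xu" => (21 : ℕ)
notation "xw" => (22 : ℕ)
notation "xc" => (23 : ℕ)
notation "xx" => (30 : ℕ)
notation "xy" => (31 : ℕ)
notation "xv" => (32 : ℕ)

/-! The arrays: starts of constraints, adjacency matrix, vertices in bags, bags, current component,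
its border, residual capacities, search levels, the cut, the two selected subsets of the border,
failure, kept valuations, quotients, digits, current vertex of the flow, and whether a cut has been
found. Most of them use row `0` only. -/

notation "aStart" => (0 : Fin 16)
notation "aAdj" => (1 : Fin 16)
notation "aD" => (2 : Fin 16)
notation "aBag" => (3 : Fin 16)
notation "aC" => (4 : Fin 16)
notation "aW" => (5 : Fin 16)
notation "aR" => (6 : Fin 16)
notation "aLev" => (7 : Fin 16)
notation "aX" => (8 : Fin 16)
notation "aAB" => (9 : Fin 16)
notation "aFail" => (10 : Fin 16)
notation "aAlive" => (11 : Fin 16)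
notation "aQ" => (12 : Fin 16)
notation "aDig" => (13 : Fin 16)
notation "aCur" => (14 : Fin 16)
notation "aFound" => (15 : Fin 16)

end Names

/-- Breadth-first search on the vertices below the variable `y`, by as many rounds as there are
vertices. The condition `src` on `xu` selects the sources, the condition `edge` on `xw` and `xu`
says that there is an arc from `xw` to `xu`. The levels are stored in row `vO` of array `a`. -/
def Stm.reach (a : Fin 16) (y : ℕ) (src edge : Exp) : Stm :=
  (row a vO xu y (.ite src (.const 1) (.const 0))).seq <|
  .loop xt y <| row a vO xu y <|
    .ite (.get a vO xu) (.get a vO xu) <|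
      .ite (.ex xw y <| (Exp.get a vO xw).and <|
          ((Exp.get a vO xw).le (.add (.var xt) (.const 1))).and edge)
        (.add (.var xt) (.const 2)) (.const 0)

/-- The array computed by `reach` contains breadth-first search levels; `y < 20` says that `y` is
not one of the loop variables of `reach`. -/
lemma Stm.exec_reach {I V : ℕ → ℕ} {A : Arrays} {a : Fin 16} {y n : ℕ} {src edge : Exp}
    {S : ℕ → Prop} {E : ℕ → ℕ → Prop} (hy : V y = n) (hy' : y < 20) (hO : V vO = 0)
    (hS : ∀ i < n, ∀ A' : Arrays, (∀ b ≠ a, A' b = A b) →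
      (src.Holds I (Function.update V xu i) A' ↔ S i))
    (hE : ∀ t, ∀ i < n, ∀ w < n, ∀ A' : Arrays, (∀ b ≠ a, A' b = A b) →
      (edge.Holds I (Function.update (Function.update (Function.update V xt t) xu i) xw w) A' ↔
        E w i)) :
    IsLevel n S E ((reach a y src edge).exec I V A a 0) ∧
      ∀ b ≠ a, (reach a y src edge).exec I V A b = A b := by
  classical
  have hframe : ∀ b ≠ a, (reach a y src edge).exec I V A b = A b := fun b hb =>
    exec_of_not_writes (by simp [reach, Writes, hb])
  refine ⟨?_, hframe⟩
  have hyt : y ≠ xt := by omega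
  have hyu : y ≠ xu := by omega
  set A₀ := (row a vO xu y (.ite src (.const 1) (.const 0))).exec I V A with hA₀
  have h0 : ∀ i < n, A₀ a 0 i = if S i then 1 else 0 := by
    have := (exec_row (I := I) (V := V) (A := A) (a := a) (z := vO) (x := xu) (y := y)
      (e := .ite src (.const 1) (.const 0)) (by decide) (fun i => if S i then 1 else 0) (by
        intro i hi A' h1 _ _ _
        simp [hS i (hy ▸ hi) A' h1])).1
    rw [hO, hy] at this
    exact this
  have hA₀' : ∀ b ≠ a, A₀ b = A b := fun b hb => exec_of_not_writes (by simpa using hb)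
  -- Either the set of reached vertices is closed, or every round has added a vertex.
  have key := loop_induct (I := I) (V := V) (A := A₀) (x := xt) (y := y) (p := row a vO xu y <|
    .ite (.get a vO xu) (.get a vO xu) <|
      .ite (.ex xw y <| (Exp.get a vO xw).and <|
          ((Exp.get a vO xw).le (.add (.var xt) (.const 1))).and edge)
        (.add (.var xt) (.const 2)) (.const 0))
    (P := fun t A' => (∀ b ≠ a, A' b = A b) ∧ (∀ i < n, A' a 0 i ≤ t + 1) ∧
      (∀ i < n, A' a 0 i = 1 ↔ S i) ∧
      (∀ i < n, 2 ≤ A' a 0 i → ∃ w < n, A' a 0 w ≠ 0 ∧ A' a 0 w < A' a 0 i ∧ E w i) ∧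
      ((∀ w < n, ∀ i < n, A' a 0 w ≠ 0 → E w i → A' a 0 i ≠ 0) ∨
        t < ((Finset.range n).filter fun i => A' a 0 i ≠ 0).card)) ?_ ?_
  · rw [hy] at key
    obtain ⟨h1, h2, h3, h4, h5⟩ := key
    refine ⟨h3, h4, h5.resolve_right ?_, h2⟩
    have := Finset.card_filter_le (Finset.range n) fun i => (Stm.exec I
        (Stm.loop xt y <| row a vO xu y <|
    .ite (.get a vO xu) (.get a vO xu) <|
      .ite (.ex xw y <| (Exp.get a vO xw).and <|
          ((Exp.get a vO xw).le (.add (.var xt) (.const 1))).and edge)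
        (.add (.var xt) (.const 2)) (.const 0)) V A₀) a 0 i ≠ 0
    rw [Finset.card_range] at this
    omega
  · refine ⟨hA₀', fun i hi => ?_, fun i hi => ?_, fun i hi => ?_, ?_⟩
    · rw [h0 i hi]; split_ifs <;> omega
    · rw [h0 i hi]; simp
    · rw [h0 i hi]; split_ifs <;> omega
    · by_cases hex : ∃ i < n, S i
      · right
        obtain ⟨i, hi, hi'⟩ := hex
        exact Finset.card_pos.2 ⟨i, by simp [hi, h0 i hi, hi']⟩
      · left
        intro w hw i hi h1
        rw [h0 w hw] at h1
        exact absurd ⟨w, hw, by simpa using h1⟩ hex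
  · rintro t A' ht ⟨h1, h2, h3, h4, h5⟩
    have hr := exec_row (I := I) (V := Function.update V xt t) (A := A') (a := a) (z := vO)
        (x := xu)
      (y := y) (e := .ite (.get a vO xu) (.get a vO xu) <|
        .ite (.ex xw y <| (Exp.get a vO xw).and <|
          ((Exp.get a vO xw).le (.add (.var xt) (.const 1))).and edge)
        (.add (.var xt) (.const 2)) (.const 0)) (by decide)
      (fun i => if A' a 0 i ≠ 0 then A' a 0 i else
        if ∃ w < n, A' a 0 w ≠ 0 ∧ E w i then t + 2 else 0) (by
        simp only [Function.update_of_ne hyt, Function.update_of_ne (show vO ≠ xt by decide), hO,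
            hy]
        intro i hi A'' g1 g2 g3 g4
        have hw : ∀ w < n, (A'' a 0 w ≠ 0 ∧ A'' a 0 w ≤ t + 1) ↔ A' a 0 w ≠ 0 := by
          intro w hw
          rcases lt_or_ge w i with hwi | hwi
          · rw [g3 w hwi]
            have := h2 w hw
            split_ifs <;> simp_all
          · rw [g4 w hwi]
            have := h2 w hw
            simp [this]
        simp [hO, hyt, hyu, hy, g4 i le_rfl]
        congr 2
        refine propext (exists_congr fun w => and_congr_right fun hwn => ?_)
        have e1 := hE t i hi w hwn A'' (fun b hb => (g1 b hb).trans (h1 b hb))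
        have e2 := hw w hwn
        simp only [ne_eq] at e2
        rw [e1, ← and_assoc, e2])
    simp only [Function.update_of_ne hyt, Function.update_of_ne (show vO ≠ xt by decide), hO, hy]
      at hr
    set A₁ := (row a vO xu y (.ite (.get a vO xu) (.get a vO xu) <|
        .ite (.ex xw y <| (Exp.get a vO xw).and <|
          ((Exp.get a vO xw).le (.add (.var xt) (.const 1))).and edge)
        (.add (.var xt) (.const 2)) (.const 0))).exec I (Function.update V xt t) A' with hA₁
    have hr1 := hr.1
    have hold : ∀ i < n, A' a 0 i ≠ 0 → A₁ a 0 i = A' a 0 i := fun i hi h => by simp [hr1 i hi, h]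
    have hnew : ∀ i < n, A' a 0 i = 0 → A₁ a 0 i ≠ 0 → A₁ a 0 i = t + 2 ∧
        ∃ w < n, A' a 0 w ≠ 0 ∧ E w i := by
      intro i hi h h'
      have := hr1 i hi
      simp only [h, ne_eq, not_true, if_false] at this
      split_ifs at this with hc
      · exact ⟨this, hc⟩
      · exact absurd this h'
    refine ⟨fun b hb => ?_, fun i hi => ?_, fun i hi => ?_, fun i hi h6 => ?_, ?_⟩
    · rw [hA₁, exec_of_not_writes (by simpa using hb), h1 b hb]
    · by_cases h : A' a 0 i = 0
      · by_cases h' : A₁ a 0 i = 0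
        · omega
        · rw [(hnew i hi h h').1]
      · rw [hold i hi h]; have := h2 i hi; omega
    · rw [← h3 i hi]
      by_cases h : A' a 0 i = 0
      · by_cases h' : A₁ a 0 i = 0
        · omega
        · rw [(hnew i hi h h').1]; omega
      · rw [hold i hi h]
    · by_cases h : A' a 0 i = 0
      · obtain ⟨h7, w, hw, h8, h9⟩ := hnew i hi h (by omega)
        refine ⟨w, hw, ?_, ?_, h9⟩
        · rwa [hold w hw h8]
        · rw [hold w hw h8, h7]; have := h2 w hw; omega
      · rw [hold i hi h] at h6 ⊢
        obtain ⟨w, hw, h8, h9, h10⟩ := h4 i hi h6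
        exact ⟨w, hw, by rwa [hold w hw h8], by rwa [hold w hw h8], h10⟩
    · by_cases hc : ∀ w < n, ∀ i < n, A' a 0 w ≠ 0 → E w i → A' a 0 i ≠ 0
      · left
        have hsame : ∀ i < n, A₁ a 0 i ≠ 0 → A' a 0 i ≠ 0 := by
          intro i hi h h'
          obtain ⟨-, w, hw, h8, h9⟩ := hnew i hi h' h
          exact hc w hw i hi h8 h9 h'
        intro w hw i hi h h'
        have := hc w hw i hi (hsame w hw h) h'
        rwa [hold i hi this]
      · right
        have h5' := h5.resolve_left hc
        push Not at hc
        obtain ⟨w, hw, i, hi, h6, h7, h8⟩ := hc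
        refine lt_of_le_of_lt (Nat.succ_le_of_lt h5') (Finset.card_lt_card ?_)
        refine Finset.ssubset_iff_of_subset (fun j hj => ?_) |>.2 ⟨i, ?_, ?_⟩
        · simp only [Finset.mem_filter, Finset.mem_range] at hj ⊢
          rw [hold j hj.1 hj.2]; exact hj
        · have : A₁ a 0 i = t + 2 := by
            rw [hr1 i hi, if_neg (by simpa using h8), if_pos ⟨w, hw, h6, h7⟩]
          simp [hi, this]
        · simp [h8]

/-! ### Minimum vertex cuts by augmenting paths -/

/-- The capacity of the cut `(S, Sᶜ)` in the digraph on the vertices below `n` with capacities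
`r`. -/
def cutValue (n : ℕ) (r : ℕ → ℕ → ℕ) (S : Finset ℕ) : ℤ :=
  ∑ x ∈ Finset.range n, ∑ y ∈ Finset.range n, if x ∈ S ∧ y ∉ S then (r x y : ℤ) else 0

lemma cutValue_nonneg (n : ℕ) (r : ℕ → ℕ → ℕ) (S : Finset ℕ) : 0 ≤ cutValue n r S :=
  Finset.sum_nonneg fun _ _ => Finset.sum_nonneg fun _ _ => by split_ifs <;> simp

lemma cutValue_eq_zero_iff {n : ℕ} {r : ℕ → ℕ → ℕ} {S : Finset ℕ} :
    cutValue n r S = 0 ↔ ∀ x < n, ∀ y < n, x ∈ S → y ∉ S → r x y = 0 := by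
  unfold cutValue
  rw [Finset.sum_eq_zero_iff_of_nonneg
    fun _ _ => Finset.sum_nonneg fun _ _ => by split_ifs <;> simp]
  refine ⟨fun h x hx y hy h1 h2 => ?_, fun h x hx => Finset.sum_eq_zero fun y hy => ?_⟩
  · have := h x (by simpa using hx)
    rw [Finset.sum_eq_zero_iff_of_nonneg fun _ _ => by split_ifs <;> simp] at this
    simpa [h1, h2] using this y (by simpa using hy)
  · split_ifs with h'
    · simpa using h x (by simpa using hx) y (by simpa using hy) h'.1 h'.2
    · rfl

/-- Sending one unit along the arc from `w` to `c` in the residual digraph. -/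
def pushArc (r : ℕ → ℕ → ℕ) (w c : ℕ) : ℕ → ℕ → ℕ := fun x y =>
  if x = c ∧ y = w then r c w + 1 else if x = w ∧ y = c then r w c - 1 else r x y

/-- Sending one unit of flow along the single arc from `w` to `c` changes the capacity of a cut by
the difference of the indicators of `w` and `c`. Summed over a path from `a` to `b` this telescopes,
so it does not matter which arcs of the path cross the cut. -/
lemma cutValue_pushArc {n : ℕ} {r : ℕ → ℕ → ℕ} {w c : ℕ} (hw : w < n) (hc : c < n) (hwc : w ≠ c)
    (hr : r w c ≠ 0) (S : Finset ℕ) : cutValue n (pushArc r w c) S =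
      cutValue n r S - (if w ∈ S then 1 else 0) + (if c ∈ S then 1 else 0) := by
  have h : ∀ x y, (if x ∈ S ∧ y ∉ S then (pushArc r w c x y : ℤ) else 0) =
      (if x ∈ S ∧ y ∉ S then (r x y : ℤ) else 0)
      - (if x = w then (if y = c then (if w ∈ S ∧ c ∉ S then 1 else 0) else 0) else 0)
      + (if x = c then (if y = w then (if c ∈ S ∧ w ∉ S then 1 else 0) else 0) else 0) := by
    intro x y
    unfold pushArc
    by_cases h1 : x = c ∧ y = w
    · obtain ⟨rfl, rfl⟩ := h1
      by_cases h2 : x ∈ S ∧ y ∉ S <;> simp [h2, hwc.symm]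
    · by_cases h2 : x = w ∧ y = c
      · obtain ⟨rfl, rfl⟩ := h2
        by_cases h3 : x ∈ S ∧ y ∉ S
        · simp [h3, hwc, Nat.cast_sub (Nat.one_le_iff_ne_zero.2 hr)]
        · simp [h3, hwc]
      · have e1 : (if x = w then (if y = c then (if w ∈ S ∧ c ∉ S then (1 : ℤ) else 0) else 0)
            else 0) = 0 := by
          split_ifs <;> simp_all
        have e2 : (if x = c then (if y = w then (if c ∈ S ∧ w ∉ S then (1 : ℤ) else 0) else 0)
            else 0) = 0 := by
          split_ifs <;> simp_all
        rw [if_neg h1, if_neg h2, e1, e2]; ring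
  have e : ∀ a b : ℕ, a < n → b < n → ∀ t : ℤ, (∑ x ∈ Finset.range n, ∑ y ∈ Finset.range n,
      if x = a then (if y = b then t else 0) else 0) = t := by
    intro a b ha hb t
    rw [Finset.sum_eq_single a]
    · simp [hb]
    · intro x _ hx; simp [hx]
    · intro h'; exact absurd (Finset.mem_range.2 ha) h'
  unfold cutValue
  simp only [h, Finset.sum_add_distrib, Finset.sum_sub_distrib]
  rw [e w c hw hc, e c w hc hw]
  by_cases h1 : w ∈ S <;> by_cases h2 : c ∈ S <;> simp [h1, h2]

/-- The set `S` contains all sources and no sink. -/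
def Separates (n : ℕ) (src sink : ℕ → Prop) (S : Finset ℕ) : Prop :=
  (∀ x < n, src x → x ∈ S) ∧ ∀ x < n, sink x → x ∉ S

namespace Stm

/-- Walks back in the breadth-first search levels from the current vertex to a source and sends
one unit along each arc on the way. -/
def walk : Stm :=
  .loop xt vNN <| .loop xw vNN <| .bind xc vNN (.get aCur vO vO) <|
    .ite ((Exp.lt (.const 1) (.get aLev vO xc)).and <| (Exp.get aLev vO xw).and <|
        (Exp.lt (.get aLev vO xw) (.get aLev vO xc)).and (.get aR xw xc))
      ((Stm.store aR xw xc (.sub (.get aR xw xc) (.const 1))).seq <|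
        (Stm.store aR xc xw (.add (.get aR xc xw) (.const 1))).seq <|
        .store aCur vO vO (.var xw))
      .skip

lemma set_set_eq_pushArc (A : Arrays) (w c v : ℕ) (hwc : w ≠ c) :
    (((A.set aR w c (A aR w c - 1)).set aR c w (A.set aR w c (A aR w c - 1) aR c w + 1)).set
      aCur 0 0 v) aR = pushArc (A aR) w c := by
  funext x y
  simp only [Arrays.set, pushArc]
  by_cases h1 : x = c ∧ y = w
  · simp [h1, hwc.symm]
  · by_cases h2 : x = w ∧ y = c
    · simp [h2, hwc]
    · simp [h1, h2]

/-- If the current vertex has been reached, `walk` sends one unit of flow from some source `a` to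
it. -/
lemma exec_walk {I V : ℕ → ℕ} {A : Arrays} {n : ℕ} {src : ℕ → Prop} (hn : V vNN = n)
    (hO : V vO = 0) (hl : IsLevel n src (fun x y => A aR x y ≠ 0) (A aLev 0))
    (hb : A aCur 0 0 < n) (hb' : A aLev 0 (A aCur 0 0) ≠ 0) :
    ∃ a < n, src a ∧ ∀ S : Finset ℕ, cutValue n (walk.exec I V A aR) S =
      cutValue n (A aR) S - (if a ∈ S then 1 else 0) + (if A aCur 0 0 ∈ S then 1 else 0) := by
  set l := A aLev 0 with hl0
  set r := A aR with hr0
  set b := A aCur 0 0 with hb0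
  -- Arcs that leave lower levels than that of the current vertex are untouched.
  let Inv : Arrays → Prop := fun A' => A' aLev 0 = l ∧ A' aCur 0 0 < n ∧ l (A' aCur 0 0) ≠ 0 ∧
    (∀ x y, l x < l (A' aCur 0 0) → A' aR x y = r x y) ∧
    ∀ S : Finset ℕ, cutValue n (A' aR) S =
      cutValue n r S - (if A' aCur 0 0 ∈ S then 1 else 0) + (if b ∈ S then 1 else 0)
  have key := loop_induct (I := I) (V := V) (A := A) (x := xt) (y := vNN)
    (p := .loop xw vNN <| .bind xc vNN (.get aCur vO vO) <|
    .ite ((Exp.lt (.const 1) (.get aLev vO xc)).and <| (Exp.get aLev vO xw).and <|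
        (Exp.lt (.get aLev vO xw) (.get aLev vO xc)).and (.get aR xw xc))
      ((Stm.store aR xw xc (.sub (.get aR xw xc) (.const 1))).seq <|
        (Stm.store aR xc xw (.add (.get aR xc xw) (.const 1))).seq <|
        .store aCur vO vO (.var xw))
      .skip)
    (P := fun t A' => Inv A' ∧ (l (A' aCur 0 0) = 1 ∨ l (A' aCur 0 0) + t ≤ n + 1)) ?_ ?_
  · rw [hn] at key
    obtain ⟨⟨h1, h2, h3, h4, h5⟩, h6⟩ := key
    exact ⟨_, h2, (hl.src _ h2).1 (by omega), h5⟩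
  · refine ⟨⟨rfl, hb, hb', fun _ _ _ => rfl, fun S => ?_⟩, Or.inr (hl.le b hb)⟩
    rw [← hb0]; ring
  · rintro t A' ht ⟨hInv, hlev⟩
    set c₀ := A' aCur 0 0 with hc₀
    have inner := loop_induct (I := I) (V := Function.update V xt t) (A := A') (x := xw) (y := vNN)
      (p := .bind xc vNN (.get aCur vO vO) <|
    .ite ((Exp.lt (.const 1) (.get aLev vO xc)).and <| (Exp.get aLev vO xw).and <|
        (Exp.lt (.get aLev vO xw) (.get aLev vO xc)).and (.get aR xw xc))
      ((Stm.store aR xw xc (.sub (.get aR xw xc) (.const 1))).seq <|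
        (Stm.store aR xc xw (.add (.get aR xc xw) (.const 1))).seq <|
        .store aCur vO vO (.var xw))
      .skip)
      (P := fun i A'' => Inv A'' ∧ (l (A'' aCur 0 0) < l c₀ ∨ (A'' aCur 0 0 = c₀ ∧
        ∀ w < i, ¬ (1 < l c₀ ∧ l w ≠ 0 ∧ l w < l c₀ ∧ r w c₀ ≠ 0)))) ?_ ?_
    · simp only [Function.update_of_ne (show vNN ≠ xt by decide), hn] at inner
      refine (?_ : ∀ A₁, (Inv A₁ ∧ (l (A₁ aCur 0 0) < l c₀ ∨ (A₁ aCur 0 0 = c₀ ∧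
        ∀ w < n, ¬ (1 < l c₀ ∧ l w ≠ 0 ∧ l w < l c₀ ∧ r w c₀ ≠ 0)))) →
        Inv A₁ ∧ (l (A₁ aCur 0 0) = 1 ∨ l (A₁ aCur 0 0) + (t + 1) ≤ n + 1)) _ inner
      clear inner
      intro A₁ inner
      refine ⟨inner.1, ?_⟩
      rcases inner.2 with h | ⟨h, h'⟩
      · have h8 := inner.1.2.2.1
        omega
      · rw [h]
        by_cases h1 : l c₀ = 1
        · exact Or.inl h1
        · have h2 : l c₀ ≠ 0 := hInv.2.2.1
          obtain ⟨w, hw, h3, h4, h5⟩ := hl.pred c₀ hInv.2.1 (by omega)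
          exact absurd ⟨by omega, h3, h4, h5⟩ (h' w hw)
    · exact ⟨hInv, Or.inr ⟨rfl, fun w hw => by omega⟩⟩
    · rintro i A'' hi ⟨⟨h1, h2, h3, h4, h5⟩, h6⟩
      simp only [Function.update_of_ne (show vNN ≠ xt by decide), hn] at hi
      set c := A'' aCur 0 0 with hc
      have hmin : min c n = c := by omega
      simp only [exec_bind, Exp.eval_get, Function.update_of_ne (show vO ≠ xt by decide),
        Function.update_of_ne (show vO ≠ xw by decide),
        Function.update_of_ne (show vO ≠ xc by decide), hO, ← hc,
        Function.update_of_ne (show vNN ≠ xt by decide),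
        Function.update_of_ne (show vNN ≠ xw by decide), hn, hmin, exec_ite, Exp.holds_and,
        Exp.holds_lt, Exp.eval_const, Function.update_self, h1, Exp.holds_get,
        Function.update_of_ne (show xw ≠ xc by decide), exec_seq, exec_store, exec_skip,
        Exp.eval_sub, Exp.eval_add, Exp.eval_var]
      split_ifs with hcond
      · obtain ⟨g1, g2, g3, g4⟩ := hcond
        have hic : i ≠ c := fun h => by rw [h] at g3; omega
        have hcur : (((A''.set aR i c (A'' aR i c - 1)).set aR c i
            (A''.set aR i c (A'' aR i c - 1) aR c i + 1)).set aCur 0 0 i) aCur 0 0 = i := by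
          simp [Arrays.set]
        refine ⟨⟨?_, ?_, ?_, ?_, ?_⟩, ?_⟩
        · rw [← h1]; funext j; simp [Arrays.set]
        · rwa [hcur]
        · rwa [hcur]
        · rw [hcur]
          intro x y hx
          rw [set_set_eq_pushArc _ _ _ _ hic]
          have e1 : x ≠ c := fun h => by rw [h] at hx; omega
          have e2 : x ≠ i := fun h => by rw [h] at hx; omega
          simp only [pushArc, e1, e2, false_and, if_false]
          exact h4 x y (by omega)
        · intro S
          rw [set_set_eq_pushArc _ _ _ _ hic, hcur, cutValue_pushArc hi h2 hic g4, h5]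
          ring
        · rw [hcur]
          rcases h6 with h6 | h6
          · left; omega
          · left; rw [← h6.1]; exact g3
      · refine ⟨⟨h1, h2, h3, h4, h5⟩, ?_⟩
        rcases h6 with h6 | ⟨h6, h7⟩
        · exact Or.inl h6
        · refine Or.inr ⟨h6, fun w hw h8 => ?_⟩
          rcases Nat.lt_succ_iff_lt_or_eq.1 hw with hw | rfl
          · exact h7 w hw h8
          · refine hcond ⟨by rw [h6]; exact h8.1, h8.2.1, by rw [h6]; exact h8.2.2.1, ?_⟩
            rw [h4 w c (by rw [h6]; exact h8.2.2.1), h6]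
            exact h8.2.2.2

/-- The vertices `v + N` with `v` in the second set are the sinks. -/
def sinkCond : Exp :=
  .ex xw vN <| (Exp.eq (.var xu) (.add (.var xw) (.var vN))).and <|
    Exp.eq (.get aAB vO xw) (.const 2)

/-- The vertices `v < N` in the first set are the sources. -/
def srcCond : Exp := (Exp.lt (.var xu) (.var vN)).and <| Exp.eq (.get aAB vO xu) (.const 1)

/-- Breadth-first search from the sources in the residual digraph. -/
def searchResidual : Stm := reach aLev vNN srcCond (.get aR xw xu)

/-- Augments the flow by one unit if there is an augmenting path. -/
def augment : Stm :=
  searchResidual.seq <|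
  (Stm.store aCur vO vO (.var vNN)).seq <|
  (Stm.loop xu vNN <| .ite (sinkCond.and (.get aLev vO xu)) (.store aCur vO vO (.var xu)) .skip).seq
  <| .ite (Exp.lt (.get aCur vO vO) (.var vNN)) walk .skip

/-- A vertex `v < N` of the first set, as a vertex of the split digraph. -/
def IsSource (N : ℕ) (A : Arrays) (x : ℕ) : Prop := x < N ∧ A aAB 0 x = 1

/-- The second copy of a vertex `v < N` of the second set. -/
def IsSink (N : ℕ) (A : Arrays) (x : ℕ) : Prop := ∃ v < N, x = v + N ∧ A aAB 0 v = 2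

lemma holds_sinkCond {I V : ℕ → ℕ} {A : Arrays} {N : ℕ} (hN : V vN = N) (hO : V vO = 0) (x : ℕ) :
    sinkCond.Holds I (Function.update V xu x) A ↔ IsSink N A x := by
  simp [sinkCond, IsSink, hN, hO]

section

variable {I V : ℕ → ℕ} {A : Arrays} {N : ℕ}

lemma exec_searchResidual (hN : V vN = N) (hNN : V vNN = 2 * N) (hO : V vO = 0) :
    IsLevel (2 * N) (IsSource N A) (fun x y => A aR x y ≠ 0) (searchResidual.exec I V A aLev 0) ∧
      ∀ b ≠ aLev, searchResidual.exec I V A b = A b := by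
  refine exec_reach hNN (by decide) hO (fun i _ A' h => ?_) (fun t i _ w _ A' h => ?_)
  · simp [srcCond, IsSource, hN, hO, h aAB (by decide)]
  · simp [h aR (by decide)]

/-- Either there is a saturated cut and nothing happens, or the residual capacity of each cut that
separates sources and sinks decreases by one. -/
lemma exec_augment (hN : V vN = N) (hNN : V vNN = 2 * N) (hO : V vO = 0) :
    (∃ S, Separates (2 * N) (IsSource N A) (IsSink N A) S ∧ cutValue (2 * N) (A aR) S = 0 ∧
      augment.exec I V A aR = A aR) ∨
    (∀ S, Separates (2 * N) (IsSource N A) (IsSink N A) S →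
      cutValue (2 * N) (augment.exec I V A aR) S = cutValue (2 * N) (A aR) S - 1) := by
  obtain ⟨hl, hf⟩ := exec_searchResidual (I := I) (A := A) hN hNN hO
  set A₁ := searchResidual.exec I V A with hA₁
  set l := A₁ aLev 0 with hl0
  have hS : IsSink N A = IsSink N A₁ := by funext x; simp only [IsSink, hf aAB (by decide)]
  have hsink := loop_induct (I := I) (V := V) (A := A₁.set aCur 0 0 (2 * N)) (x := xu) (y := vNN)
    (p := .ite (sinkCond.and (.get aLev vO xu)) (.store aCur vO vO (.var xu)) .skip)
    (P := fun i A' => (∀ b ≠ aCur, A' b = A₁ b) ∧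
      ((A' aCur 0 0 = 2 * N ∧ ∀ x < i, IsSink N A x → l x = 0) ∨
        (A' aCur 0 0 < 2 * N ∧ IsSink N A (A' aCur 0 0) ∧ l (A' aCur 0 0) ≠ 0))) ?_ ?_
  · have hE : augment.exec I V A = (Stm.ite (Exp.lt (.get aCur vO vO) (.var vNN)) walk .skip).exec
        I V ((Stm.loop xu vNN
          (.ite (sinkCond.and (.get aLev vO xu)) (.store aCur vO vO (.var xu)) .skip)).exec I V
          (A₁.set aCur 0 0 (2 * N))) := by
      simp only [augment, exec_seq, exec_store, hO, Exp.eval_var, hNN, ← hA₁]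
    rw [hE]
    rw [hNN] at hsink
    revert hsink
    generalize (Stm.loop xu vNN
          (.ite (sinkCond.and (.get aLev vO xu)) (.store aCur vO vO (.var xu)) .skip)).exec I V
          (A₁.set aCur 0 0 (2 * N)) = A₂
    rintro ⟨h1, h2⟩
    have hR : A₂ aR = A aR := (h1 _ (by decide)).trans (hf _ (by decide))
    simp only [exec_ite, Exp.holds_lt, Exp.eval_get, Exp.eval_var, hO, hNN, exec_skip]
    rcases h2 with ⟨h2, h3⟩ | ⟨h2, h3, h4⟩
    · left
      rw [if_neg (by omega)]
      refine ⟨(Finset.range (2 * N)).filter fun x => l x ≠ 0, ⟨fun x hx hx' => ?_,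
        fun x hx hx' => ?_⟩, ?_, hR⟩
      · simp [hx, (hl.src x hx).2 hx']
      · simp [h3 x hx hx']
      · rw [cutValue_eq_zero_iff]
        intro x hx y hy hx' hy'
        by_contra h
        simp only [Finset.mem_filter, Finset.mem_range, not_and, not_not] at hx' hy'
        exact hl.closed x hx y hy hx'.2 h (hy' hy)
    · right
      rw [if_pos h2]
      have hlev : A₂ aLev 0 = l := by rw [h1 _ (by decide)]
      obtain ⟨a, ha, ha', hcut⟩ := exec_walk (I := I) (A := A₂) (src := IsSource N A) hNN hO
        (by rw [hlev, hR]; exact hl) h2 (by rw [hlev]; exact h4)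
      intro S hS'
      rw [hcut, hR, if_pos (hS'.1 a ha ha'), if_neg (hS'.2 _ h2 h3)]
      ring
  · refine ⟨fun b hb => ?_, Or.inl ⟨by simp [Arrays.set], fun x hx => by omega⟩⟩
    funext i j; simp [Arrays.set, hb]
  · rintro i A' hi ⟨h1, h2⟩
    rw [hNN] at hi
    have hS' : IsSink N A' = IsSink N A := by
      rw [hS]; funext x; simp only [IsSink, h1 aAB (by decide)]
    have hcond : (sinkCond.and (.get aLev vO xu)).Holds I (Function.update V xu i) A' ↔
        IsSink N A i ∧ l i ≠ 0 := by
      rw [Exp.holds_and, holds_sinkCond hN hO, hS']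
      simp [hO, h1 aLev (by decide), hl0]
    rw [exec_ite]
    by_cases hc : (sinkCond.and (.get aLev vO xu)).Holds I (Function.update V xu i) A'
    · rw [if_pos hc]
      rw [hcond] at hc
      simp only [exec_store, Function.update_of_ne (show vO ≠ xu by decide), hO, Exp.eval_var,
        Function.update_self]
      refine ⟨fun b hb => ?_, Or.inr ?_⟩
      · rw [← h1 b hb]; funext i j; simp [Arrays.set, hb]
      · simpa [Arrays.set, hi] using hc
    · rw [if_neg hc]
      rw [hcond] at hc
      refine ⟨h1, h2.imp (fun h => ⟨h.1, fun x hx hx' => ?_⟩) id⟩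
      rcases Nat.lt_succ_iff_lt_or_eq.1 hx with hx | rfl
      · exact h.2 x hx hx'
      · by_contra h'
        exact hc ⟨hx', h'⟩

/-- The capacities of the split digraph: the arc from `v` to `v + N` has capacity `1`, and edges
have a capacity above `k`. -/
def _root_.splitCapacity (adj : ℕ → ℕ → Prop) [DecidableRel adj] (N k x y : ℕ) : ℕ :=
  if x < N then (if y = x + N then 1 else 0) else if y < N ∧ adj (x - N) y then k + 1 else 0

/-- Searches for a vertex cut of size at most `k` between the two sets. -/
def maxFlow : Stm :=
  (table aR xx vNN xy vNN <| .ite (Exp.lt (.var xx) (.var vN))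
    (.ite (Exp.eq (.var xy) (.add (.var xx) (.var vN))) (.const 1) (.const 0))
    (.ite ((Exp.lt (.var xy) (.var vN)).and <| .ex xv vN <|
      (Exp.eq (.var xx) (.add (.var xv) (.var vN))).and (.get aAdj xv xy))
      (.add (.var vk) (.const 1)) (.const 0))).seq <|
  (Stm.loop xj vk augment).seq searchResidual

open Classical in
/-- After `k` augmentations, the sinks are unreachable in the residual digraph if and only if some
cut has capacity at most `k`, and then the reachable vertices form such a cut. -/
lemma exec_maxFlow {k : ℕ} (hN : V vN = N) (hNN : V vNN = 2 * N) (hO : V vO = 0) (hk : V vk = k) :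
    ((∀ x < 2 * N, IsSink N A x → maxFlow.exec I V A aLev 0 x = 0) →
      ∃ S, Separates (2 * N) (IsSource N A) (IsSink N A) S ∧
      (∀ x < 2 * N, x ∈ S ↔ maxFlow.exec I V A aLev 0 x ≠ 0) ∧
      cutValue (2 * N) (splitCapacity (fun u v => A aAdj u v ≠ 0) N k) S ≤ k) ∧
    ((∃ x < 2 * N, IsSink N A x ∧ maxFlow.exec I V A aLev 0 x ≠ 0) →
      ∀ S, Separates (2 * N) (IsSource N A) (IsSink N A) S →
        k < cutValue (2 * N) (splitCapacity (fun u v => A aAdj u v ≠ 0) N k) S) := by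
  set cap := splitCapacity (fun u v => A aAdj u v ≠ 0) N k with hcap
  have hE : maxFlow.exec I V A = searchResidual.exec I V ((Stm.loop xj vk augment).exec I V
      ((table aR xx vNN xy vNN <| .ite (Exp.lt (.var xx) (.var vN))
    (.ite (Exp.eq (.var xy) (.add (.var xx) (.var vN))) (.const 1) (.const 0))
    (.ite ((Exp.lt (.var xy) (.var vN)).and <| .ex xv vN <|
      (Exp.eq (.var xx) (.add (.var xv) (.var vN))).and (.get aAdj xv xy))
      (.add (.var vk) (.const 1)) (.const 0))).exec I V A)) := rfl
  rw [hE]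
  have h0 := exec_table (I := I) (V := V) (A := A) (a := aR) (x := xx) (y := vNN) (x' := xy)
    (y' := vNN) (e := .ite (Exp.lt (.var xx) (.var vN))
    (.ite (Exp.eq (.var xy) (.add (.var xx) (.var vN))) (.const 1) (.const 0))
    (.ite ((Exp.lt (.var xy) (.var vN)).and <| .ex xv vN <|
      (Exp.eq (.var xx) (.add (.var xv) (.var vN))).and (.get aAdj xv xy))
      (.add (.var vk) (.const 1)) (.const 0))) (by decide) (by decide) cap ?_
  · rw [hNN] at h0
    have h0' : ∀ b ≠ aR, (table aR xx vNN xy vNN (.ite (Exp.lt (.var xx) (.var vN))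
      (.ite (Exp.eq (.var xy) (.add (.var xx) (.var vN))) (.const 1) (.const 0))
      (.ite ((Exp.lt (.var xy) (.var vN)).and <| .ex xv vN <|
        (Exp.eq (.var xx) (.add (.var xv) (.var vN))).and (.get aAdj xv xy))
      (.add (.var vk) (.const 1)) (.const 0)))).exec I V A b = A b := fun b hb =>
        exec_of_not_writes (by simpa using hb)
    revert h0 h0'
    generalize (table aR xx vNN xy vNN (.ite (Exp.lt (.var xx) (.var vN))
      (.ite (Exp.eq (.var xy) (.add (.var xx) (.var vN))) (.const 1) (.const 0))
      (.ite ((Exp.lt (.var xy) (.var vN)).and <| .ex xv vN <|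
        (Exp.eq (.var xx) (.add (.var xv) (.var vN))).and (.get aAdj xv xy))
      (.add (.var vk) (.const 1)) (.const 0)))).exec I V A = A₁
    intro h0 h0'
    have hc1 : ∀ S, cutValue (2 * N) (A₁ aR) S = cutValue (2 * N) cap S := by
      intro S
      refine Finset.sum_congr rfl fun x hx => Finset.sum_congr rfl fun y hy => ?_
      rw [h0 x (by simpa using hx) y (by simpa using hy)]
    have key := loop_induct (I := I) (V := V) (A := A₁) (x := xj) (y := vk) (p := augment)
      (P := fun j A' => A' aAB = A aAB ∧ ∃ a ≤ j, (∀ S, Separates (2 * N) (IsSource N A)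
          (IsSink N A) S →
        cutValue (2 * N) (A' aR) S = cutValue (2 * N) cap S - a) ∧ (a = j ∨
        ∃ S, Separates (2 * N) (IsSource N A) (IsSink N A) S ∧ cutValue (2 * N) (A' aR) S = 0)) ?_
            ?_
    · rw [hk] at key
      revert key
      generalize (Stm.loop xj vk augment).exec I V A₁ = A₂
      rintro ⟨hAB, a, hak, h1, h2⟩
      obtain ⟨hl, hf⟩ := exec_searchResidual (I := I) (A := A₂) hN hNN hO
      have e1 : IsSource N A₂ = IsSource N A := by funext x; simp only [IsSource, hAB]
      rw [e1] at hl
      revert hl hf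
      generalize searchResidual.exec I V A₂ = A₃
      intro hl hf
      constructor
      · intro hs
        have hsep : Separates (2 * N) (IsSource N A) (IsSink N A)
            ((Finset.range (2 * N)).filter fun x => A₃ aLev 0 x ≠ 0) := by
          refine ⟨fun x hx hx' => ?_, fun x hx hx' => ?_⟩
          · simp [hx, (hl.src x hx).2 hx']
          · simp [hs x hx hx']
        refine ⟨_, hsep, fun x hx => by simp [hx], ?_⟩
        have h3 := h1 _ hsep
        have : cutValue (2 * N) (A₂ aR) ((Finset.range (2 * N)).filter fun x => A₃ aLev 0 x ≠ 0)
            = 0 := by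
          rw [cutValue_eq_zero_iff]
          intro x hx y hy hx' hy'
          by_contra h
          simp only [Finset.mem_filter, Finset.mem_range, not_and, not_not] at hx' hy'
          exact hl.closed x hx y hy hx'.2 h (hy' hy)
        omega
      · rintro ⟨x, hx, hx', hx''⟩ S hS
        by_contra hcut
        have : ∃ S, Separates (2 * N) (IsSource N A) (IsSink N A) S ∧
            cutValue (2 * N) (A₂ aR) S = 0 := by
          rcases h2 with rfl | h2
          · refine ⟨S, hS, ?_⟩
            have := h1 S hS
            have := cutValue_nonneg (2 * N) (A₂ aR) S
            omega
          · exact h2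
        obtain ⟨S', hS', h0⟩ := this
        rw [cutValue_eq_zero_iff] at h0
        obtain ⟨j, hj, hj', hr⟩ := hl.reachable hx hx''
        refine hS'.2 x hx hx' ?_
        suffices h : x ∈ S' ∧ x < 2 * N from h.1
        clear hx hx' hx''
        induction hr with
        | refl => exact ⟨hS'.1 j hj hj', hj⟩
        | tail _ h4 ih =>
          refine ⟨?_, h4.2⟩
          by_contra h5
          exact h4.1 (h0 _ ih.2 _ h4.2 ih.1 h5)
    · exact ⟨h0' _ (by decide), 0, le_rfl, fun S _ => by simp [hc1], Or.inl rfl⟩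
    · rintro j A' hj ⟨hAB, a, ha, h1, h2⟩
      have e1 : IsSource N A' = IsSource N A := by funext x; simp only [IsSource, hAB]
      have e2 : IsSink N A' = IsSink N A := by funext x; simp only [IsSink, hAB]
      have haug := exec_augment (I := I) (V := Function.update V xj j) (A := A') (N := N)
        (by simpa using hN) (by simpa using hNN) (by simpa using hO)
      rw [e1, e2] at haug
      refine ⟨(exec_of_not_writes ?_).trans hAB, ?_⟩
      · simp [augment, searchResidual, reach, walk, Writes]
      rcases haug with ⟨S, hS, h3, h4⟩ | h3
      · exact ⟨a, by omega, by rw [h4]; exact h1, Or.inr ⟨S, hS, by rw [h4]; exact h3⟩⟩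
      · rcases h2 with rfl | ⟨S, hS, h4⟩
        · refine ⟨a + 1, le_rfl, fun S hS => ?_, Or.inl rfl⟩
          rw [h3 S hS, h1 S hS]; push_cast; ring
        · have := h3 S hS
          have := cutValue_nonneg (2 * N) (augment.exec I (Function.update V xj j) A' aR) S
          omega
  · intro x hx y hy A' hA' _
    rw [hNN] at hx hy
    have h1 : (∃ v < N, x = v + N ∧ A aAdj v y ≠ 0) ↔ (N ≤ x ∧ A aAdj (x - N) y ≠ 0) := by
      constructor
      · rintro ⟨v, hv, rfl, h⟩
        exact ⟨by omega, by simpa using h⟩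
      · rintro ⟨h2, h3⟩
        exact ⟨x - N, by omega, by omega, h3⟩
    have h2 := hA' aAdj (by decide)
    simp only [ne_eq] at h1
    by_cases hx' : x < N
    · simp [hcap, splitCapacity, hN, hx']
    · simp [hcap, splitCapacity, hN, hk, hx', h2, h1, Nat.le_of_not_lt hx']

end

end Stm

/-! ### Growing a decomposition bag by bag -/

/-- `y` can be reached from `x` by a walk all of whose later vertices avoid `D` and are below `N`.
For `x` outside `D` this says that `y` is in the component of `x` of the graph without `D`. -/
def Conn (N : ℕ) (adj : ℕ → ℕ → Prop) (D : Finset ℕ) : ℕ → ℕ → Prop :=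
  Relation.ReflTransGen fun a b => (adj a b ∧ b ∉ D) ∧ b < N

open Classical in
/-- The vertices of `D` that are adjacent to the component of `x` outside `D`. -/
noncomputable def border (N : ℕ) (adj : ℕ → ℕ → Prop) (D : Finset ℕ) (x : ℕ) : Finset ℕ :=
  D.filter fun v => ∃ y, Conn N adj D x y ∧ adj y v

/-- The set `X` has at most `k` elements and separates two large subsets `S` and `T` of `W`: the
set `R` contains everything that can be reached from `S` outside `X`. -/
def Splits (N : ℕ) (adj : ℕ → ℕ → Prop) (k : ℕ) (W X S T R : Finset ℕ) : Prop :=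
  X.card ≤ k ∧ S ⊆ W ∧ T ⊆ W ∧ k < S.card ∧ k < T.card ∧ S ⊆ R ∪ X ∧ Disjoint T R ∧
    ∀ u ∈ R, ∀ v < N, adj u v → v ∈ R ∪ X

/-- A sequence of bags on the vertices `0, …, N - 1`, in which the old vertices of each bag are
contained in an earlier bag and include all old neighbours of its new vertices. It amounts to a
tree decomposition. -/
structure BagSequence (N : ℕ) (adj : ℕ → ℕ → Prop) (K s : ℕ) (bag : ℕ → Finset ℕ) : Prop where
  subset : ∀ i, bag i ⊆ Finset.range N
  card : ∀ i, (bag i).card ≤ K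
  old : ∀ i < s, bag i ∩ (Finset.range i).biUnion bag = ∅ ∨
    ∃ j < i, bag i ∩ (Finset.range i).biUnion bag ⊆ bag j
  edge : ∀ i < s, ∀ u ∈ bag i, u ∉ (Finset.range i).biUnion bag →
    ∀ v ∈ (Finset.range i).biUnion bag, adj u v → v ∈ bag i

/-- The situation before stage `s`: the vertices `D` are in bags, and the border of each component
of the remaining graph is small and contained in a bag. -/
structure PartialBags (N : ℕ) (adj : ℕ → ℕ → Prop) (K m s : ℕ) (bag : ℕ → Finset ℕ)
    (D : Finset ℕ) : Prop extends BagSequence N adj K s bag where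
  union : D = (Finset.range s).biUnion bag
  processed : ∀ v < s, v < N → v ∈ D
  later : ∀ i ≥ s, bag i = ∅
  border_card : ∀ x < N, x ∉ D → (border N adj D x).card ≤ m
  border_subset : ∀ x < N, x ∉ D → border N adj D x = ∅ ∨ ∃ j < s, border N adj D x ⊆ bag j

section

variable {N : ℕ} {adj : ℕ → ℕ → Prop} {K m s k : ℕ} {bag : ℕ → Finset ℕ} {D : Finset ℕ}

lemma Conn.mono {D D' : Finset ℕ} (hD : D ⊆ D') {x y : ℕ} (h : Conn N adj D' x y) :
    Conn N adj D x y := by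
  induction h with
  | refl => exact .refl
  | tail _ h ih => exact ih.tail ⟨⟨h.1.1, fun h' => h.1.2 (hD h')⟩, h.2⟩

lemma Conn.not_mem {x y : ℕ} (h : Conn N adj D x y) (hx : x ∉ D) : y ∉ D := by
  induction h with
  | refl => exact hx
  | tail _ h _ => exact h.1.2

lemma Conn.lt {x y : ℕ} (h : Conn N adj D x y) (hx : x < N) : y < N := by
  induction h with
  | refl => exact hx
  | tail _ h _ => exact h.2

lemma Conn.symm (hsymm : ∀ u < N, ∀ v < N, adj u v → adj v u) {x y : ℕ}
    (h : Conn N adj D x y) (hx : x ∉ D) (hxN : x < N) : Conn N adj D y x := by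
  induction h with
  | refl => exact .refl
  | @tail b c h1 h2 ih =>
    exact .head ⟨⟨hsymm _ (Conn.lt h1 hxN) _ h2.2 h2.1.1, Conn.not_mem h1 hx⟩, Conn.lt h1 hxN⟩ ih

lemma mem_border {D : Finset ℕ} {x v : ℕ} :
    v ∈ border N adj D x ↔ v ∈ D ∧ ∃ y, Conn N adj D x y ∧ adj y v := by simp [border]

lemma border_subset_left {D : Finset ℕ} {x : ℕ} : border N adj D x ⊆ D :=
  fun _ h => (mem_border.1 h).1

/-- A stage whose vertex is in a bag already adds no bag. -/
lemma PartialBags.skip (h : PartialBags N adj K m s bag D) (hs : s ∈ D) :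
    PartialBags N adj K m (s + 1) bag D where
  subset := h.subset
  card := h.card
  old i hi := by
    rcases Nat.lt_succ_iff_lt_or_eq.1 hi with hi | rfl
    · exact h.old i hi
    · left; simp [h.later i le_rfl]
  edge i hi := by
    rcases Nat.lt_succ_iff_lt_or_eq.1 hi with hi | rfl
    · exact h.edge i hi
    · simp [h.later i le_rfl]
  union := by
    rw [Finset.range_add_one, Finset.biUnion_insert, h.later s le_rfl, ← h.union]; simp
  processed v hv := by
    rcases Nat.lt_succ_iff_lt_or_eq.1 hv with hv | rfl
    · exact h.processed v hv
    · exact fun _ => hs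
  later i hi := h.later i (by omega)
  border_card := h.border_card
  border_subset x hx hxD := (h.border_subset x hx hxD).imp_right fun ⟨j, hj, h'⟩ =>
    ⟨j, by omega, h'⟩

/-- Removing a cut from a component leaves components with small borders: such a component cannot
have neighbours on both sides of the cut, so its border misses many vertices of the old one. -/
lemma card_border_le (hsymm : ∀ u < N, ∀ v < N, adj u v → adj v u) {W X S T R Y B : Finset ℕ}
    (hWD : W ⊆ D) (hDN : D ⊆ Finset.range N) (hsplit : Splits N adj k W X S T R) {s : ℕ}
    (hs : s ∉ D) (hsN : s < N) (hW : W = border N adj D s)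
    (hY : ∀ y, y ∈ Y ↔ y ∈ X ∧ Conn N adj D s y) (hB : B = W ∪ insert s Y) {x : ℕ}
    (hx : Conn N adj D s x) (hxB : x ∉ D ∪ B) : (border N adj (D ∪ B) x).card ≤ W.card := by
  obtain ⟨hX, hSW, hTW, hS, hT, hSR, hTR, hR⟩ := hsplit
  have hsub : border N adj (D ∪ B) x ⊆ W ∪ insert s Y := by
    intro v hv
    obtain ⟨h1, y, h2, h3⟩ := mem_border.1 hv
    by_cases hvD : v ∈ D
    · refine Finset.mem_union_left _ ?_
      rw [hW, mem_border]
      exact ⟨hvD, y, hx.trans (h2.mono Finset.subset_union_left), h3⟩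
    · rw [hB] at h1
      simp only [Finset.mem_union] at h1 ⊢
      tauto
  have hYX : Y ⊆ X := fun y hy => ((hY y).1 hy).1
  have hYD : ∀ y ∈ Y, y ∉ D := fun y hy => ((hY y).1 hy).2.not_mem hs
  -- The component of `x` outside the new bag avoids the cut.
  have havoid : ∀ y, Conn N adj (D ∪ B) x y → y ∉ X := by
    intro y hy hyX
    have h1 : Conn N adj D s y := hx.trans (hy.mono Finset.subset_union_left)
    have h2 := hy.not_mem hxB
    rw [hB] at h2
    simp only [Finset.mem_union, Finset.mem_insert, hY] at h2
    tauto
  have count : ∀ S' ⊆ W, k < S'.card → Disjoint (border N adj (D ∪ B) x) (S' \ X) →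
      (border N adj (D ∪ B) x).card ≤ W.card := by
    intro S' hS' hk hdis
    have h1 : border N adj (D ∪ B) x ⊆ (W \ (S' \ X)) ∪ insert s Y := by
      intro v hv
      have h2 := hsub hv
      have h3 : v ∉ S' \ X := fun h => Finset.disjoint_left.1 hdis hv h
      simp only [Finset.mem_union, Finset.mem_sdiff] at h2 h3 ⊢
      tauto
    have h2 := (Finset.card_le_card h1).trans (Finset.card_union_le _ _)
    have h3 := Finset.card_insert_le s Y
    have h4 : (W \ (S' \ X)).card + (S' \ X).card = W.card :=
      Finset.card_sdiff_add_card_eq_card (Finset.sdiff_subset.trans hS')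
    have h5 : (S' \ X).card + (S' ∩ X).card = S'.card := Finset.card_sdiff_add_card_inter S' X
    have h6 : Y.card + (S' ∩ X).card ≤ X.card := by
      rw [← Finset.card_union_of_disjoint]
      · exact Finset.card_le_card (Finset.union_subset hYX Finset.inter_subset_right)
      · rw [Finset.disjoint_left]
        intro y hy hy'
        exact hYD y hy (hWD (hS' (Finset.mem_inter.1 hy').1))
    omega
  by_cases hdis : Disjoint (border N adj (D ∪ B) x) (S \ X)
  · exact count S hSW hS hdis
  · refine count T hTW hT ?_
    rw [Finset.disjoint_left]
    intro t ht htT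
    obtain ⟨v, hv, hvS⟩ := Finset.not_disjoint_iff.1 hdis
    obtain ⟨-, y, hy, hyv⟩ := mem_border.1 hv
    obtain ⟨-, z, hz, hzt⟩ := mem_border.1 ht
    rw [Finset.mem_sdiff] at hvS htT
    have hvR : v ∈ R := by
      have := hSR hvS.1
      rw [Finset.mem_union] at this
      tauto
    have hxN : x < N := hx.lt hsN
    have hstep : ∀ a ∈ R, ∀ b < N, b ∉ X → adj a b → b ∈ R := by
      intro a ha b hb hbX hab
      have := hR a ha b hb hab
      rw [Finset.mem_union] at this
      tauto
    have hyR : y ∈ R := hstep v hvR y (hy.lt hxN) (havoid y hy)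
      (hsymm _ (hy.lt hxN) _ (Finset.mem_range.1 (hDN (hWD (hSW hvS.1)))) hyv)
    have hcl : ∀ z, Conn N adj (D ∪ B) y z → z ∈ R := by
      intro z hz
      induction hz with
      | refl => exact hyR
      | @tail b c h1 h2 ih => exact hstep b ih c h2.2 (havoid c (hy.trans (h1.tail h2))) h2.1.1
    have hzR : z ∈ R := hcl z ((hy.symm hsymm hxB hxN).trans hz)
    have htR : t ∈ R ∪ X := hR z hzR t (Finset.mem_range.1 (hDN (hWD (hTW htT.1)))) hzt
    rw [Finset.mem_union] at htR
    exact Finset.disjoint_left.1 hTR htT.1 (htR.resolve_right htT.2)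

/-- One stage: the new bag consists of the border `W` of the component of `s`, of `s` itself, and of
the part `Y` of a cut in the component if `W` has been split; this may be omitted if `W` has less
than `m` elements. The borders of the components of the remaining graph do not exceed `m` again. -/
lemma PartialBags.step (hsymm : ∀ u < N, ∀ v < N, adj u v → adj v u)
    (h : PartialBags N adj K m s bag D)
    (hs : s ∉ D) (hsN : s < N) (hK : m + 1 + k ≤ K) {W Y B : Finset ℕ} {bag' : ℕ → Finset ℕ}
    (hW : W = border N adj D s) (hB : B = W ∪ insert s Y)
    (hbag : ∀ i, bag' i = if i = s then B else bag i)
    (hY : (Y = ∅ ∧ W.card < m) ∨ ∃ X S T R, Splits N adj k W X S T R ∧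
      ∀ y, y ∈ Y ↔ y ∈ X ∧ Conn N adj D s y) :
    PartialBags N adj K m (s + 1) bag' (D ∪ B) := by
  have hWD : W ⊆ D := by rw [hW]; exact border_subset_left
  have hDN : D ⊆ Finset.range N := by
    rw [h.union]; exact Finset.biUnion_subset.2 fun i _ => h.subset i
  have hYC : ∀ y ∈ Y, Conn N adj D s y := by
    rcases hY with ⟨rfl, -⟩ | ⟨X, S, T, R, -, hY⟩
    · simp
    · exact fun y hy => ((hY y).1 hy).2
  have hnew : ∀ y ∈ insert s Y, Conn N adj D s y := by
    intro y hy
    rcases Finset.mem_insert.1 hy with rfl | hy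
    · exact .refl
    · exact hYC y hy
  have hpre : ∀ i ≤ s, (Finset.range i).biUnion bag' = (Finset.range i).biUnion bag := by
    intro i hi
    refine Finset.biUnion_congr rfl fun j hj => ?_
    rw [hbag, if_neg (by have := Finset.mem_range.1 hj; omega)]
  have hWm : W.card ≤ m := by rw [hW]; exact h.border_card s hsN hs
  have hBN : B ⊆ Finset.range N := by
    rw [hB]
    refine Finset.union_subset (hWD.trans hDN) fun y hy => ?_
    exact Finset.mem_range.2 ((hnew y hy).lt hsN)
  have hYk : Y.card ≤ k := by
    rcases hY with ⟨rfl, -⟩ | ⟨X, S, T, R, hsp, hY⟩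
    · simp
    · exact (Finset.card_le_card fun y hy => ((hY y).1 hy).1).trans hsp.1
  have hBK : B.card ≤ K := by
    have h1 := Finset.card_union_le W (insert s Y)
    have h2 := Finset.card_insert_le s Y
    rw [hB]; omega
  have hBD : B ∩ D = W := by
    rw [hB]
    ext v
    simp only [Finset.mem_inter, Finset.mem_union]
    refine ⟨fun ⟨h1, h2⟩ => h1.resolve_right fun h3 => (hnew v h3).not_mem hs h2,
      fun h1 => ⟨Or.inl h1, hWD h1⟩⟩
  have hunion : (Finset.range (s + 1)).biUnion bag' = D ∪ B := by
    rw [Finset.range_add_one, Finset.biUnion_insert, hpre s le_rfl, ← h.union, hbag, if_pos rfl,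
      Finset.union_comm]
  have hborder : ∀ x < N, x ∉ D ∪ B →
      (border N adj (D ∪ B) x ⊆ B ∧ (border N adj (D ∪ B) x).card ≤ m) ∨
      border N adj (D ∪ B) x ⊆ border N adj D x := by
    intro x hx hxB
    by_cases hC : Conn N adj D s x
    · left
      have h1 : border N adj (D ∪ B) x ⊆ B := by
        intro v hv
        obtain ⟨h1, y, h2, h3⟩ := mem_border.1 hv
        by_cases hvD : v ∈ D
        · rw [hB]
          refine Finset.mem_union_left _ ?_
          rw [hW, mem_border]
          exact ⟨hvD, y, hC.trans (h2.mono Finset.subset_union_left), h3⟩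
        · exact (Finset.mem_union.1 h1).resolve_left hvD
      refine ⟨h1, ?_⟩
      rcases hY with ⟨rfl, hlt⟩ | ⟨X, S, T, R, hsp, hY⟩
      · have h2 := Finset.card_le_card h1
        have h3 := Finset.card_union_le W (insert s ∅)
        rw [← hB] at h3
        have h4 : (insert s (∅ : Finset ℕ)).card = 1 := rfl
        omega
      · exact (card_border_le hsymm hWD hDN hsp hs hsN hW hY hB hC hxB).trans hWm
    · right
      intro v hv
      obtain ⟨h1, y, h2, h3⟩ := mem_border.1 hv
      have h4 : Conn N adj D x y := h2.mono Finset.subset_union_left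
      have hxD : x ∉ D := fun h => hxB (Finset.mem_union_left _ h)
      refine mem_border.2 ⟨?_, y, h4, h3⟩
      by_contra hvD
      have hvB := (Finset.mem_union.1 h1).resolve_left hvD
      rw [hB] at hvB
      have h5 := hnew v ((Finset.mem_union.1 hvB).resolve_left fun h => hvD (hWD h))
      refine hC (h5.trans (.head ⟨⟨hsymm _ (h4.lt hx) _ ((h5.lt hsN)) h3, h4.not_mem hxD⟩, h4.lt
          hx⟩ ?_))
      exact h4.symm hsymm hxD hx
  refine ⟨⟨fun i => ?_, fun i => ?_, fun i hi => ?_, fun i hi => ?_⟩, hunion.symm, fun v hv hvN =>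
      ?_,
    fun i hi => ?_, fun x hx hxB => ?_, fun x hx hxB => ?_⟩
  · rw [hbag]; split_ifs
    · exact hBN
    · exact h.subset i
  · rw [hbag]; split_ifs
    · exact hBK
    · exact h.card i
  · rw [hpre i (by omega)]
    rcases Nat.lt_succ_iff_lt_or_eq.1 hi with hi | rfl
    · rw [hbag, if_neg (by omega)]
      refine (h.old i hi).imp_right fun ⟨j, hj, h'⟩ => ⟨j, hj, ?_⟩
      rwa [hbag, if_neg (by omega)]
    · rw [hbag, if_pos rfl, ← h.union, hBD, hW]
      refine (h.border_subset i hsN hs).imp_right fun ⟨j, hj, h'⟩ => ⟨j, hj, ?_⟩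
      rwa [hbag, if_neg (by omega)]
  · rw [hpre i (by omega)]
    rcases Nat.lt_succ_iff_lt_or_eq.1 hi with hi | rfl
    · rw [hbag, if_neg (by omega)]
      exact h.edge i hi
    · rw [hbag, if_pos rfl, ← h.union]
      intro u hu huD v hv huv
      rw [hB] at hu ⊢
      refine Finset.mem_union_left _ ?_
      have hu' := (Finset.mem_union.1 hu).resolve_left fun h => huD (hWD h)
      rw [hW, mem_border]
      exact ⟨hv, u, hnew u hu', huv⟩
  · rcases Nat.lt_succ_iff_lt_or_eq.1 hv with hv | rfl
    · exact Finset.mem_union_left _ (h.processed v hv hvN)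
    · exact Finset.mem_union_right _ (by rw [hB]; simp)
  · rw [hbag, if_neg (by omega), h.later i (by omega)]
  · have hxD : x ∉ D := fun h => hxB (Finset.mem_union_left _ h)
    rcases hborder x hx hxB with h1 | h1
    · exact h1.2
    · exact (Finset.card_le_card h1).trans (h.border_card x hx hxD)
  · have hxD : x ∉ D := fun h => hxB (Finset.mem_union_left _ h)
    rcases hborder x hx hxB with h1 | h1
    · exact Or.inr ⟨s, by omega, by rw [hbag, if_pos rfl]; exact h1.1⟩
    · rcases h.border_subset x hx hxD with h2 | ⟨j, hj, h2⟩
      · exact Or.inl (Finset.subset_empty.1 (h2 ▸ h1))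
      · exact Or.inr ⟨j, by omega, by rw [hbag, if_neg (by omega)]; exact h1.trans h2⟩

end

/-! ### Vertex cuts and the split digraph -/

section

variable {N k : ℕ} {adj : ℕ → ℕ → Prop} [DecidableRel adj]

/-- A vertex cut gives a cut of the split digraph that only contains arcs `(v, v + N)`. -/
lemma exists_cut_of_splits {W X S T R : Finset ℕ} (h : Splits N adj k W X S T R)
    {src sink : ℕ → Prop} (hsrc : ∀ x < 2 * N, src x → x < N ∧ x ∈ S)
    (hsink : ∀ x < 2 * N, sink x → ∃ v ∈ T, x = v + N) :
    ∃ C, Separates (2 * N) src sink C ∧ cutValue (2 * N) (splitCapacity adj N k) C ≤ k := by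
  obtain ⟨hX, -, -, -, -, hSR, hTR, hR⟩ := h
  let C := (Finset.range (2 * N)).filter fun x => (x < N ∧ x ∈ R ∪ X) ∨ (N ≤ x ∧ x - N ∈ R)
  have hC : ∀ x < 2 * N, x ∈ C ↔ (x < N ∧ x ∈ R ∪ X) ∨ (N ≤ x ∧ x - N ∈ R) := by
    intro x hx; simp [C, hx]
  refine ⟨C, ⟨fun x hx hx' => ?_, fun x hx hx' => ?_⟩, ?_⟩
  · obtain ⟨h1, h2⟩ := hsrc x hx hx'
    exact (hC x hx).2 (Or.inl ⟨h1, hSR h2⟩)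
  · obtain ⟨v, hv, rfl⟩ := hsink x hx hx'
    rw [hC _ hx]
    rintro (⟨h1, -⟩ | ⟨-, h2⟩)
    · omega
    · rw [Nat.add_sub_cancel] at h2
      exact Finset.disjoint_left.1 hTR hv h2
  · have h1 : ∀ x ∈ Finset.range (2 * N), ∀ y ∈ Finset.range (2 * N),
        (if x ∈ C ∧ y ∉ C then (splitCapacity adj N k x y : ℤ) else 0) ≤
          if y = x + N then (if x ∈ X then 1 else 0) else 0 := by
      intro x hx y hy
      rw [Finset.mem_range] at hx hy
      by_cases hxy : x ∈ C ∧ y ∉ C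
      · rw [if_pos hxy]
        rw [hC x hx, hC y hy] at hxy
        unfold splitCapacity
        by_cases hxN : x < N
        · rw [if_pos hxN]
          by_cases hyx : y = x + N
          · subst hyx
            simp only [Nat.add_sub_cancel, Finset.mem_union] at hxy
            have : x ∈ X := by
              by_contra hxX
              refine hxy.2 (Or.inr ⟨by omega, ?_⟩)
              rcases hxy.1 with h | h
              · tauto
              · omega
            simp [this]
          · simp [hyx]
        · rw [if_neg hxN]
          rw [if_neg]
          · simp; split_ifs <;> simp
          · rintro ⟨h2, h3⟩
            rcases hxy.1 with h4 | h4
            · omega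
            · exact hxy.2 (Or.inl ⟨h2, hR _ h4.2 y h2 h3⟩)
      · rw [if_neg hxy]; split_ifs <;> simp
    calc cutValue (2 * N) (splitCapacity adj N k) C
        ≤ ∑ x ∈ Finset.range (2 * N), ∑ y ∈ Finset.range (2 * N),
          if y = x + N then (if x ∈ X then (1 : ℤ) else 0) else 0 :=
        Finset.sum_le_sum fun x hx => Finset.sum_le_sum fun y hy => h1 x hx y hy
      _ ≤ ∑ x ∈ Finset.range (2 * N), if x ∈ X then (1 : ℤ) else 0 := by
        refine Finset.sum_le_sum fun x _ => ?_
        rw [Finset.sum_ite_eq']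
        split_ifs <;> simp
      _ ≤ X.card := by
        rw [Finset.sum_boole]
        exact_mod_cast Finset.card_le_card fun x hx => (Finset.mem_filter.1 hx).2
      _ ≤ k := by exact_mod_cast hX

/-- A cut of the split digraph of capacity at most `k` gives a vertex cut. -/
lemma splits_of_cut {W S T : Finset ℕ} (hSW : S ⊆ W) (hTW : T ⊆ W) (hW : W ⊆ Finset.range N)
    (hS : k < S.card) (hT : k < T.card) {src sink : ℕ → Prop} (hsrc : ∀ x ∈ S, src x)
    (hsink : ∀ x ∈ T, sink (x + N)) {C : Finset ℕ} (hC : Separates (2 * N) src sink C)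
    (hcut : cutValue (2 * N) (splitCapacity adj N k) C ≤ k) {X : Finset ℕ}
    (hX : ∀ v, v ∈ X ↔ v < N ∧ v ∈ C ∧ v + N ∉ C) : ∃ R, Splits N adj k W X S T R := by
  have hterm : ∀ x < 2 * N, ∀ y < 2 * N, x ∈ C → y ∉ C → (splitCapacity adj N k x y : ℤ) ≤ k := by
    intro x hx y hy hxC hyC
    refine le_trans ?_ hcut
    unfold cutValue
    refine le_trans ?_ (Finset.single_le_sum (f := fun x => ∑ y ∈ Finset.range (2 * N),
      if x ∈ C ∧ y ∉ C then (splitCapacity adj N k x y : ℤ) else 0) (fun _ _ =>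
        Finset.sum_nonneg fun _ _ => by split_ifs <;> simp) (Finset.mem_range.2 hx))
    refine le_trans ?_ (Finset.single_le_sum (f := fun y =>
      if x ∈ C ∧ y ∉ C then (splitCapacity adj N k x y : ℤ) else 0) (fun _ _ => by
        split_ifs <;> simp) (Finset.mem_range.2 hy))
    simp [hxC, hyC]
  have hXN : X ⊆ Finset.range (2 * N) := fun v hv => by
    have := ((hX v).1 hv).1
    rw [Finset.mem_range]; omega
  refine ⟨(Finset.range N).filter fun v => v + N ∈ C, ?_, hSW, hTW, hS, hT, ?_, ?_, ?_⟩
  · have : (X.card : ℤ) ≤ cutValue (2 * N) (splitCapacity adj N k) C := by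
      calc (X.card : ℤ) = ∑ x ∈ X, 1 := by simp
        _ ≤ ∑ x ∈ X, ∑ y ∈ Finset.range (2 * N),
            if x ∈ C ∧ y ∉ C then (splitCapacity adj N k x y : ℤ) else 0 := by
          refine Finset.sum_le_sum fun x hx => ?_
          obtain ⟨h1, h2, h3⟩ := (hX x).1 hx
          refine le_trans ?_ (Finset.single_le_sum (f := fun y =>
            if x ∈ C ∧ y ∉ C then (splitCapacity adj N k x y : ℤ) else 0) (fun _ _ => by
            split_ifs <;> simp) (Finset.mem_range.2 (show x + N < 2 * N by omega)))
          simp [h2, h3, splitCapacity, h1]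
        _ ≤ _ := Finset.sum_le_sum_of_subset_of_nonneg hXN fun _ _ _ =>
            Finset.sum_nonneg fun _ _ => by split_ifs <;> simp
    exact_mod_cast this.trans hcut
  · intro x hx
    have hxN := Finset.mem_range.1 (hW (hSW hx))
    have h1 := hC.1 x (by omega) (hsrc x hx)
    rw [Finset.mem_union, hX]
    by_cases h2 : x + N ∈ C
    · left; simp [hxN, h2]
    · right; exact ⟨hxN, h1, h2⟩
  · rw [Finset.disjoint_left]
    intro x hx hxR
    have hxN := Finset.mem_range.1 (hW (hTW hx))
    exact hC.2 (x + N) (by omega) (hsink x hx) (Finset.mem_filter.1 hxR).2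
  · intro u hu v hv huv
    obtain ⟨h1, h2⟩ := Finset.mem_filter.1 hu
    rw [Finset.mem_range] at h1
    have h3 : v ∈ C := by
      by_contra h3
      have := hterm (u + N) (by omega) v (by omega) h2 h3
      simp [splitCapacity, hv, huv] at this
    rw [Finset.mem_union, hX]
    by_cases h4 : v + N ∈ C
    · left; simp [hv, h4]
    · right; exact ⟨hv, h3, h4⟩

end

/-! ### The program that computes the bags -/

namespace Stm

/-- The component of `xs` outside the processed vertices. -/
def component : Stm :=
  reach aC vN (Exp.eq (.var xu) (.var xs)) ((Exp.get aAdj xw xu).and (Exp.get aD vO xu).not)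

/-- The border of the component. -/
def boundary : Stm :=
  row aW vO xu vN <| (Exp.get aC vO xu).not.and <| .ex xw vN <|
    (Exp.get aC vO xw).and (.get aAdj xw xu)

/-- Assigns to each vertex of the border the digit of the code `xq` at its position in the border.
The vertices with digits `1` and `2` form the two subsets that are to be separated. -/
def select : Stm :=
  row aAB vO xu vN <| .ite (.get aW vO xu)
    (.bind xz vK (.count xv xu (.get aW vO xv)) (.get aDig xz xq)) (.const 0)

/-- A sink has been reached. -/
def sinkReached : Exp := .ex xu vNN <| sinkCond.and (.get aLev vO xu)

/-- Records the vertex cut if there is one: it consists of the vertices `v` whose arc to `v + N`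
leaves the set of vertices that are reachable in the residual digraph. -/
def record : Stm :=
  .ite sinkReached .skip <|
    (row aX vO xu vN <| (Exp.get aLev vO xu).and
      (Exp.bind xz vNN (.add (.var xu) (.var vN)) (.get aLev vO xz)).not).seq <|
    .store aFound vO vO (.const 1)

/-- Unless a cut has been found before, tries to find one between the subsets with code `xq`, if
both have more than `k` elements. -/
def tryCode : Stm :=
  .ite (.get aFound vO vO) .skip <| select.seq <|
    .ite ((Exp.lt (.var vk) (.count xu vN (Exp.eq (.get aAB vO xu) (.const 1)))).and
        (Exp.lt (.var vk) (.count xu vN (Exp.eq (.get aAB vO xu) (.const 2)))))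
      (maxFlow.seq record) .skip

/-- Searches for a cut between large subsets of the border, which are given by codes. -/
def searchCut : Stm := (Stm.store aFound vO vO (.const 0)).seq <| .loop xq vH tryCode

/-- The bag of stage `xs`. -/
def newBag : Stm :=
  row aBag xs xu vN <| (Exp.get aW vO xu).or <| (Exp.eq (.var xu) (.var xs)).or <|
    (Exp.get aFound vO vO).and <| (Exp.get aC vO xu).and (.get aX vO xu)

/-- Reports failure if the border has at least `m` elements and has not been split. -/
def checkFail : Stm :=
  .ite ((Exp.get aFound vO vO).not.and <| Exp.le (.var vm) (.count xu vN (.get aW vO xu)))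
    (.store aFail vO vO (.const 1)) .skip

/-- Stage `xs` of the construction adds a bag with vertex `xs`, unless it is in a bag already. -/
def stage : Stm :=
  .ite (.get aD vO xs) .skip <| component.seq <| boundary.seq <| searchCut.seq <| newBag.seq <|
    checkFail.seq <| row aD vO xu vN <| (Exp.get aD vO xu).or (.get aBag xs xu)

/-- Computes the bags. -/
def decompose : Stm :=
  (Stm.store aFail vO vO (.const 0)).seq <| (row aD vO xu vN (.const 0)).seq <|
    (table aBag xs vNs xu vN (.const 0)).seq <| .loop xs vN stage

end Stm

/-- The vertices below `N` at which `f` is not `0`. -/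
def support (N : ℕ) (f : ℕ → ℕ) : Finset ℕ := (Finset.range N).filter fun v => f v ≠ 0

@[simp] lemma mem_support {N : ℕ} {f : ℕ → ℕ} {v : ℕ} : v ∈ support N f ↔ v < N ∧ f v ≠ 0 := by
  simp [support]

/-- The parameters have these values. -/
structure Params (V : ℕ → ℕ) (L N k m K H : ℕ) : Prop where
  eqL : V vL = L
  eqN : V vN = N
  eqNN : V vNN = 2 * N
  eqk : V vk = k
  eqm : V vm = m
  eqK : V vK = K
  eqH : V vH = H
  eqNs : V vNs = N + 1
  eqO : V vO = 0

lemma Params.update {V : ℕ → ℕ} {L N k m K H : ℕ} (h : Params V L N k m K H) {x : ℕ} (hx : 9 < x)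
    (v : ℕ) : Params (Function.update V x v) L N k m K H := by
  constructor <;> rw [Function.update_of_ne (by omega)]
  exacts [h.eqL, h.eqN, h.eqNN, h.eqk, h.eqm, h.eqK, h.eqH, h.eqNs, h.eqO]

/-- Every function from positions to digits is given by a code below `H`. -/
def DigitsComplete (K H : ℕ) (dig : ℕ → ℕ → ℕ) : Prop :=
  ∀ f : ℕ → ℕ, (∀ z, f z < K) → ∃ q < H, ∀ z < K, dig z q = f z

namespace Stm

variable {I V : ℕ → ℕ} {A : Arrays} {L N k m K H : ℕ}

lemma exec_component (hV : Params V L N k m K H) (hs : V xs < N) {v : ℕ} (hv : v < N) :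
    component.exec I V A aC 0 v ≠ 0 ↔
      Conn N (fun a b => A aAdj a b ≠ 0) (support N (A aD 0)) (V xs) v := by
  obtain ⟨hl, -⟩ := exec_reach (I := I) (V := V) (A := A) (a := aC) (y := vN) (n := N)
    (src := Exp.eq (.var xu) (.var xs)) (edge := (Exp.get aAdj xw xu).and (Exp.get aD vO xu).not)
    (S := fun i => i = V xs) (E := fun a b => A aAdj a b ≠ 0 ∧ b ∉ support N (A aD 0))
    hV.eqN (by decide) hV.eqO (fun i _ A' h => by simp) (fun t i hi w hw A' h => by
      simp [hV.eqO, h aAdj (by decide), h aD (by decide), hi])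
  constructor
  · intro h
    obtain ⟨j, -, rfl, hr⟩ := hl.reachable hv h
    exact hr
  · intro h
    exact (hl.of_reachable hs rfl h).2

lemma exec_boundary (hV : Params V L N k m K H) {v : ℕ} (hv : v < N) :
    boundary.exec I V A aW 0 v ≠ 0 ↔ A aC 0 v = 0 ∧ ∃ w < N, A aC 0 w ≠ 0 ∧ A aAdj w v ≠ 0 := by
  have h := exec_row_of_not_reads (I := I) (V := V) (A := A) (a := aW) (z := vO) (x := xu) (y := vN)
    (e := (Exp.get aC vO xu).not.and <| .ex xw vN <| (Exp.get aC vO xw).and (.get aAdj xw xu))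
    (by decide) (by simp [Exp.and, Exp.not, Exp.ex, Exp.Reads]) v (by rwa [hV.eqN])
  rw [hV.eqO] at h
  rw [boundary, h]
  change Exp.Holds _ _ _ _ ↔ _
  simp [hV.eqO, hV.eqN]

/-- The vertices of the border whose position has digit `d` in the code `q`. -/
def selected (N K : ℕ) (A : Arrays) (q d : ℕ) : Finset ℕ :=
  (support N (A aW 0)).filter fun v =>
    A aDig (min ((Finset.range v).filter fun w => A aW 0 w ≠ 0).card K) q = d

lemma exec_select (hV : Params V L N k m K H) {d : ℕ} (hd : d ≠ 0) {v : ℕ} (hv : v < N) :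
    select.exec I V A aAB 0 v = d ↔ v ∈ selected N K A (V xq) d := by
  have h := exec_row_of_not_reads (I := I) (V := V) (A := A) (a := aAB) (z := vO) (x := xu)
      (y := vN)
    (e := .ite (.get aW vO xu)
      (.bind xz vK (.count xv xu (.get aW vO xv)) (.get aDig xz xq)) (.const 0))
    (by decide) (by simp [Exp.count, Exp.Reads]) v (by rwa [hV.eqN])
  rw [hV.eqO] at h
  rw [select, h]
  by_cases hw : A aW 0 v = 0
  · simp [selected, hw, hV.eqO, Ne.symm hd]
  · simp [selected, hw, hV.eqO, hV.eqK, hv]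

/-- If a cut is found, it is recorded; it is found if the two sets that the code selects can be
separated. -/
lemma exec_tryCode (hV : Params V L N k m K H) (hf : A aFound 0 0 = 0) :
    (tryCode.exec I V A aFound 0 0 ≠ 0 → ∃ S T R,
      Splits N (fun a b => A aAdj a b ≠ 0) k (support N (A aW 0))
        (support N (tryCode.exec I V A aX 0)) S T R) ∧
    ((∃ X R, Splits N (fun a b => A aAdj a b ≠ 0) k (support N (A aW 0)) X
        (selected N K A (V xq) 1) (selected N K A (V xq) 2) R) →
      tryCode.exec I V A aFound 0 0 ≠ 0) := by
  have hsel1 : ∀ v < N, select.exec I V A aAB 0 v = 1 ↔ v ∈ selected N K A (V xq) 1 :=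
    fun v hv => exec_select hV (by decide) hv
  have hsel2 : ∀ v < N, select.exec I V A aAB 0 v = 2 ↔ v ∈ selected N K A (V xq) 2 :=
    fun v hv => exec_select hV (by decide) hv
  have hfr : ∀ b ≠ aAB, select.exec I V A b = A b := fun b hb =>
    exec_of_not_writes (by simpa [select] using hb)
  rw [tryCode, exec_ite, if_neg (by simpa [hV.eqO] using hf), exec_seq]
  set S := selected N K A (V xq) 1 with hS
  set T := selected N K A (V xq) 2 with hT
  have hSW : S ⊆ support N (A aW 0) := Finset.filter_subset _ _
  have hTW : T ⊆ support N (A aW 0) := Finset.filter_subset _ _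
  have hWN : support N (A aW 0) ⊆ Finset.range N := Finset.filter_subset _ _
  revert hsel1 hsel2 hfr
  generalize select.exec I V A = A₁
  intro hfr hsel1 hsel2
  have hAdj : A₁ aAdj = A aAdj := hfr _ (by decide)
  have hcS : ((Finset.range N).filter fun v => A₁ aAB 0 v = 1) = S := by
    ext v
    rw [Finset.mem_filter, Finset.mem_range]
    exact ⟨fun ⟨h1, h2⟩ => (hsel1 v h1).1 h2, fun h =>
      have h1 := Finset.mem_range.1 (hWN (hSW h)); ⟨h1, (hsel1 v h1).2 h⟩⟩
  have hcT : ((Finset.range N).filter fun v => A₁ aAB 0 v = 2) = T := by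
    ext v
    rw [Finset.mem_filter, Finset.mem_range]
    exact ⟨fun ⟨h1, h2⟩ => (hsel2 v h1).1 h2, fun h =>
      have h1 := Finset.mem_range.1 (hWN (hTW h)); ⟨h1, (hsel2 v h1).2 h⟩⟩
  have hcond : ((Exp.lt (.var vk) (.count xu vN (Exp.eq (.get aAB vO xu) (.const 1)))).and
        (Exp.lt (.var vk) (.count xu vN (Exp.eq (.get aAB vO xu) (.const 2))))).Holds I V A₁ ↔
      k < S.card ∧ k < T.card := by
    simp [hV.eqk, hV.eqN, hV.eqO, hcS, hcT]
  have hf₁ : A₁ aFound 0 0 = 0 := by rw [hfr _ (by decide), hf]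
  rw [exec_ite]
  by_cases hc : ((Exp.lt (.var vk) (.count xu vN (Exp.eq (.get aAB vO xu) (.const 1)))).and
        (Exp.lt (.var vk) (.count xu vN (Exp.eq (.get aAB vO xu) (.const 2))))).Holds I V A₁
  swap
  · rw [if_neg hc, exec_skip]
    rw [hcond] at hc
    exact ⟨fun h => absurd hf₁ h, fun ⟨X, R, h⟩ => absurd ⟨h.2.2.2.1, h.2.2.2.2.1⟩ hc⟩
  rw [if_pos hc, exec_seq]
  rw [hcond] at hc
  obtain ⟨hflow1, hflow2⟩ := exec_maxFlow (I := I) (A := A₁) hV.eqN hV.eqNN hV.eqO hV.eqk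
  have hfr₂ : ∀ b, b ≠ aR → b ≠ aLev → b ≠ aCur → maxFlow.exec I V A₁ b = A₁ b := by
    intro b h1 h2 h3
    exact exec_of_not_writes (by
      simp [maxFlow, augment, searchResidual, reach, walk, Writes, h1, h2, h3])
  revert hflow1 hflow2 hfr₂
  generalize maxFlow.exec I V A₁ = A₂
  intro hflow1 hflow2 hfr₂
  rw [hAdj] at hflow1 hflow2
  have hsink : ∀ x, IsSink N A₁ x ↔ ∃ v ∈ T, x = v + N := by
    intro x
    constructor
    · rintro ⟨v, h1, h2, h3⟩
      exact ⟨v, (hsel2 v h1).1 h3, h2⟩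
    · rintro ⟨v, h1, h2⟩
      have h3 := Finset.mem_range.1 (hWN (hTW h1))
      exact ⟨v, h3, h2, (hsel2 v h3).2 h1⟩
  have hsrc : ∀ x, IsSource N A₁ x ↔ x ∈ S := by
    intro x
    constructor
    · rintro ⟨h1, h2⟩
      exact (hsel1 x h1).1 h2
    · intro h
      have h3 := Finset.mem_range.1 (hWN (hSW h))
      exact ⟨h3, (hsel1 x h3).2 h⟩
  have hIsSink : IsSink N A₂ = IsSink N A₁ := by
    funext x; simp only [IsSink, hfr₂ aAB (by decide) (by decide) (by decide)]
  have hreach : sinkReached.Holds I V A₂ ↔ ∃ x < 2 * N, IsSink N A₁ x ∧ A₂ aLev 0 x ≠ 0 := by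
    simp [sinkReached, hV.eqNN, holds_sinkCond hV.eqN hV.eqO, hV.eqO, hIsSink]
  rw [record, exec_ite]
  by_cases hr : sinkReached.Holds I V A₂
  · rw [if_pos hr, exec_skip]
    rw [hreach] at hr
    refine ⟨fun h => absurd ?_ h, ?_⟩
    · rw [hfr₂ _ (by decide) (by decide) (by decide), hf₁]
    · rintro ⟨X, R, hsp⟩
      classical
      obtain ⟨C, hC, hcut⟩ := exists_cut_of_splits hsp
        (src := IsSource N A₁) (sink := IsSink N A₁)
        (fun x _ hx => ⟨hx.1, (hsrc x).1 hx⟩) (fun x _ hx => (hsink x).1 hx)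
      have := hflow2 hr C hC
      exfalso
      refine absurd hcut (not_le.2 ?_)
      convert this
  · rw [if_neg hr]
    rw [hreach] at hr
    obtain ⟨C, hC, hC', hcut⟩ := hflow1 fun x hx hx' => by
      by_contra h
      exact hr ⟨x, hx, hx', h⟩
    have hX := exec_row_of_not_reads (I := I) (V := V) (A := A₂) (a := aX) (z := vO) (x := xu)
        (y := vN)
      (e := (Exp.get aLev vO xu).and
        (Exp.bind xz vNN (.add (.var xu) (.var vN)) (.get aLev vO xz)).not)
      (by decide) (by simp [Exp.and, Exp.not, Exp.Reads])
    rw [hV.eqO, hV.eqN] at hX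
    simp only [exec_seq, exec_store, hV.eqO, Exp.eval_const]
    generalize (row aX vO xu vN <| (Exp.get aLev vO xu).and
      (Exp.bind xz vNN (.add (.var xu) (.var vN)) (.get aLev vO xz)).not).exec I V A₂ = A₃ at hX ⊢
    refine ⟨fun _ => ?_, fun _ => by simp [Arrays.set]⟩
    have hset : (A₃.set aFound 0 0 1) aX = A₃ aX := by funext i j; simp [Arrays.set]
    rw [hset]
    classical
    obtain ⟨R, hR⟩ := splits_of_cut hSW hTW hWN hc.1 hc.2 (fun x hx => (hsrc x).2 hx)
      (fun x hx => (hsink _).2 ⟨x, hx, rfl⟩) hC (adj := fun a b => A aAdj a b ≠ 0)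
      (k := k) (X := support N (A₃ aX 0)) (by convert hcut) (by
        intro v
        rw [mem_support, and_congr_right_iff]
        intro hv
        rw [hX v hv]
        change Exp.Holds _ _ _ _ ↔ _
        rw [hC' v (by omega), hC' (v + N) (by omega)]
        simp [hV.eqO, hV.eqN, hV.eqNN, show v + N ≤ 2 * N by omega])
    exact ⟨S, T, R, hR⟩

/-- The arrays that are not changed by the search for a cut. -/
lemma exec_searchCut_of_ne {b : Fin 16} (h1 : b ≠ aR) (h2 : b ≠ aLev) (h3 : b ≠ aCur)
    (h4 : b ≠ aAB) (h5 : b ≠ aX) (h6 : b ≠ aFound) : searchCut.exec I V A b = A b :=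
  exec_of_not_writes (by
    simp [searchCut, tryCode, select, record, maxFlow, augment, searchResidual, reach, walk, Writes,
      h1, h2, h3, h4, h5, h6])

lemma exec_tryCode_of_ne {b : Fin 16} (h1 : b ≠ aR) (h2 : b ≠ aLev) (h3 : b ≠ aCur)
    (h4 : b ≠ aAB) (h5 : b ≠ aX) (h6 : b ≠ aFound) : tryCode.exec I V A b = A b :=
  exec_of_not_writes (by
    simp [tryCode, select, record, maxFlow, augment, searchResidual, reach, walk, Writes,
      h1, h2, h3, h4, h5, h6])

/-- Any two disjoint subsets of a small border are selected by some code. -/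
lemma exists_code (hdig : DigitsComplete K H (A aDig)) (hK : 3 ≤ K) {W S T : Finset ℕ}
    (hW : W = support N (A aW 0)) (hWK : W.card ≤ K) (hS : S ⊆ W) (hT : T ⊆ W)
    (hST : Disjoint S T) : ∃ q < H, selected N K A q 1 = S ∧ selected N K A q 2 = T := by
  classical
  let pos : ℕ → ℕ := fun v => ((Finset.range v).filter fun w => A aW 0 w ≠ 0).card
  have hmono : ∀ v ∈ W, ∀ v' ∈ W, v < v' → pos v < pos v' := by
    intro v hv v' hv' h
    refine Finset.card_lt_card ?_
    refine Finset.ssubset_iff_of_subset (fun w hw => ?_) |>.2 ⟨v, ?_, ?_⟩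
    · simp only [Finset.mem_filter, Finset.mem_range] at hw ⊢
      exact ⟨by omega, hw.2⟩
    · rw [hW, mem_support] at hv
      simp [h, hv.2]
    · simp
  have hinj : ∀ v ∈ W, ∀ v' ∈ W, pos v = pos v' → v = v' := by
    intro v hv v' hv' h
    rcases lt_trichotomy v v' with h1 | h1 | h1
    · have := hmono v hv v' hv' h1; omega
    · exact h1
    · have := hmono v' hv' v hv h1; omega
  have hpos : ∀ v ∈ W, pos v < K := by
    intro v hv
    refine lt_of_lt_of_le (Finset.card_lt_card (Finset.ssubset_iff_of_subset ?_ |>.2 ⟨v, hv, ?_⟩))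
        hWK
    · intro w hw
      rw [hW, mem_support] at hv ⊢
      simp only [Finset.mem_filter, Finset.mem_range] at hw
      exact ⟨by omega, hw.2⟩
    · simp
  obtain ⟨q, hq, hq'⟩ := hdig (fun z => if ∃ v ∈ S, pos v = z then 1 else
    if ∃ v ∈ T, pos v = z then 2 else 0) (by intro z; split_ifs <;> omega)
  have hmem : ∀ (d : ℕ) (v : ℕ), v ∈ selected N K A q d ↔ v ∈ W ∧
      (if v ∈ S then 1 else if v ∈ T then 2 else 0) = d := by
    intro d v
    rw [selected, Finset.mem_filter, ← hW]
    refine and_congr_right fun hv => ?_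
    have h1 := hpos v hv
    change A aDig (min (pos v) K) q = d ↔ _
    rw [min_eq_left h1.le, hq' _ h1]
    have hS' : (∃ v' ∈ S, pos v' = pos v) ↔ v ∈ S :=
      ⟨fun ⟨v', h2, h3⟩ => hinj v' (hS h2) v hv h3 ▸ h2, fun h => ⟨v, h, rfl⟩⟩
    have hT' : (∃ v' ∈ T, pos v' = pos v) ↔ v ∈ T :=
      ⟨fun ⟨v', h2, h3⟩ => hinj v' (hT h2) v hv h3 ▸ h2, fun h => ⟨v, h, rfl⟩⟩
    simp only [hS', hT']
  refine ⟨q, hq, ?_, ?_⟩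
  · ext v
    rw [hmem]
    constructor
    · rintro ⟨-, h⟩
      by_contra h1
      rw [if_neg h1] at h
      (split_ifs at h; omega)
    · exact fun h => ⟨hS h, by simp [h]⟩
  · ext v
    rw [hmem]
    constructor
    · rintro ⟨-, h⟩
      by_contra h1
      rw [if_neg h1] at h
      (split_ifs at h; omega)
    · exact fun h => ⟨hT h, by simp [h, Finset.disjoint_right.1 hST h]⟩

/-- The search finds a cut if some two disjoint large subsets of the border can be separated. -/
lemma exec_searchCut (hV : Params V L N k m K H) (hdig : DigitsComplete K H (A aDig))
    (hK : 3 ≤ K) (hWK : (support N (A aW 0)).card ≤ K) :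
    (searchCut.exec I V A aFound 0 0 ≠ 0 → ∃ S T R,
      Splits N (fun a b => A aAdj a b ≠ 0) k (support N (A aW 0))
        (support N (searchCut.exec I V A aX 0)) S T R) ∧
    (searchCut.exec I V A aFound 0 0 = 0 → ¬ ∃ X S T R, Disjoint S T ∧
      Splits N (fun a b => A aAdj a b ≠ 0) k (support N (A aW 0)) X S T R) := by
  have key := loop_induct (I := I) (V := V) (A := A.set aFound 0 0 0) (x := xq) (y := vH)
    (p := tryCode) (P := fun q A' => (A' aAdj = A aAdj ∧ A' aW = A aW ∧ A' aDig = A aDig) ∧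
      (A' aFound 0 0 ≠ 0 → ∃ S T R, Splits N (fun a b => A aAdj a b ≠ 0) k (support N (A aW 0))
        (support N (A' aX 0)) S T R) ∧
      (A' aFound 0 0 = 0 → ∀ q' < q, ¬ ∃ X R, Splits N (fun a b => A aAdj a b ≠ 0) k
        (support N (A aW 0)) X (selected N K A q' 1) (selected N K A q' 2) R)) ?_ ?_
  · rw [hV.eqH] at key
    have hE : searchCut.exec I V A = (Stm.loop xq vH tryCode).exec I V (A.set aFound 0 0 0) := by
      simp [searchCut, hV.eqO]
    rw [hE]
    refine ⟨key.2.1, fun h ⟨X, S, T, R, hST, hsp⟩ => ?_⟩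
    obtain ⟨q, hq, h1, h2⟩ := exists_code hdig hK rfl hWK hsp.2.1 hsp.2.2.1 hST
    exact key.2.2 h q hq ⟨X, R, by rwa [h1, h2]⟩
  · refine ⟨⟨?_, ?_, ?_⟩, fun h => absurd (by simp [Arrays.set]) h, fun _ q hq => by omega⟩ <;>
      funext i j <;> simp [Arrays.set]
  · rintro q A' hq ⟨⟨h1, h2, h3⟩, h4, h5⟩
    refine ⟨⟨?_, ?_, ?_⟩, ?_⟩
    · rw [exec_tryCode_of_ne (by decide) (by decide) (by decide) (by decide) (by decide)
        (by decide), h1]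
    · rw [exec_tryCode_of_ne (by decide) (by decide) (by decide) (by decide) (by decide)
        (by decide), h2]
    · rw [exec_tryCode_of_ne (by decide) (by decide) (by decide) (by decide) (by decide)
        (by decide), h3]
    · by_cases hf : A' aFound 0 0 = 0
      · obtain ⟨h6, h7⟩ := exec_tryCode (I := I) (hV.update (show 9 < xq by decide) q) hf
        have hsel : ∀ d, selected N K A' q d = selected N K A q d := by
          intro d; simp only [selected, h2, h3]
        rw [h1, h2] at h6 h7
        rw [Function.update_self, hsel, hsel] at h7
        refine ⟨h6, fun h q' hq' => ?_⟩
        rcases Nat.lt_succ_iff_lt_or_eq.1 hq' with hq' | rfl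
        · exact h5 hf q' hq'
        · exact fun h' => h7 h' h
      · have hE : tryCode.exec I (Function.update V xq q) A' = A' := by
          rw [tryCode, exec_ite, if_pos (by simpa [hV.eqO] using hf), exec_skip]
        rw [hE]
        exact ⟨h4, fun h => absurd h hf⟩

end Stm

/-! ### Correctness of the computed bags -/

namespace Stm

variable {I V : ℕ → ℕ} {A : Arrays} {L N k m K H : ℕ}

/-- The program determines the border of the component of `xs`. -/
lemma boundary_eq_border (hV : Params V L N k m K H) (hs : V xs < N)
    (hsD : V xs ∉ support N (A aD 0)) :
    support N (boundary.exec I V (component.exec I V A) aW 0) =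
      border N (fun a b => A aAdj a b ≠ 0) (support N (A aD 0)) (V xs) := by
  have hadj : component.exec I V A aAdj = A aAdj :=
    exec_of_not_writes (by simp [component, reach, Writes])
  ext v
  rw [mem_support, mem_border]
  constructor
  · rintro ⟨hv, h⟩
    rw [exec_boundary hV hv] at h
    obtain ⟨h1, w, hw, h2, h3⟩ := h
    rw [exec_component hV hs hw] at h2
    rw [hadj] at h3
    refine ⟨?_, w, h2, h3⟩
    by_contra hvD
    exact (exec_component hV hs hv).2 (h2.tail ⟨⟨h3, hvD⟩, hv⟩) h1
  · rintro ⟨hvD, y, h1, h2⟩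
    have hv : v < N := (mem_support.1 hvD).1
    have hy : y < N := h1.lt hs
    refine ⟨hv, (exec_boundary hV hv).2 ⟨?_, y, hy, (exec_component hV hs hy).2 h1, ?_⟩⟩
    · by_contra h
      exact ((exec_component hV hs hv).1 h).not_mem hsD hvD
    · rwa [hadj]

/-- The bags that are stored in the arrays. Bag `N` is always empty; it makes sure that there is a
bag, in which constraints of arity `0` are checked, even if there are no vertices. -/
def storedBag (N : ℕ) (A : Arrays) (i : ℕ) : Finset ℕ :=
  if i ≤ N then support N (A aBag i) else ∅

/-- Some set of at least `m` vertices cannot be split by a set of at most `k` vertices. -/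
def Unsplittable (N : ℕ) (adj : ℕ → ℕ → Prop) (k m : ℕ) : Prop :=
  ∃ W ⊆ Finset.range N, m ≤ W.card ∧ ¬ ∃ X S T R, Disjoint S T ∧ Splits N adj k W X S T R

/-- A stage without failure performs a step of the construction; it only fails if the border is
large and cannot be split. -/
lemma exec_stage (hV : Params V L N k m K H) (hs : V xs < N)
    (hdig : DigitsComplete K H (A aDig)) (hK : m + 1 + k ≤ K) (hK3 : 3 ≤ K)
    (hsymm : ∀ u < N, ∀ v < N, A aAdj u v ≠ 0 → A aAdj v u ≠ 0)
    (h : PartialBags N (fun a b => A aAdj a b ≠ 0) K m (V xs) (storedBag N A)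
      (support N (A aD 0))) (hfail : A aFail 0 0 = 0) :
    (stage.exec I V A aFail 0 0 = 0 → PartialBags N (fun a b => A aAdj a b ≠ 0) K m (V xs + 1)
      (storedBag N (stage.exec I V A)) (support N (stage.exec I V A aD 0))) ∧
    (stage.exec I V A aFail 0 0 ≠ 0 → Unsplittable N (fun a b => A aAdj a b ≠ 0) k m) := by
  set adj : ℕ → ℕ → Prop := fun a b => A aAdj a b ≠ 0 with hadj
  set s := V xs with hsdef
  set D := support N (A aD 0) with hD
  rw [stage, exec_ite]
  have hcond : (Exp.get aD vO xs).Holds I V A ↔ s ∈ D := by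
    simp [hV.eqO, hD, ← hsdef, hs]
  by_cases hsD : (Exp.get aD vO xs).Holds I V A
  · rw [if_pos hsD, exec_skip]
    exact ⟨fun _ => h.skip (hcond.1 hsD), fun h' => absurd hfail h'⟩
  rw [if_neg hsD]
  rw [hcond] at hsD
  simp only [exec_seq]
  have hW := boundary_eq_border (I := I) hV hs hsD
  have hC : ∀ v < N, boundary.exec I V (component.exec I V A) aC 0 v ≠ 0 ↔ Conn N adj D s v := by
    intro v hv
    rw [show boundary.exec I V (component.exec I V A) aC = component.exec I V A aC from
      exec_of_not_writes (by simp [boundary]), exec_component hV hs hv]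
  have hfr₂ : ∀ b, b ≠ aC → b ≠ aW → boundary.exec I V (component.exec I V A) b = A b := by
    intro b h1 h2
    rw [exec_of_not_writes (by simp [boundary, h2]),
      exec_of_not_writes (by simp [component, reach, Writes, h1])]
  generalize boundary.exec I V (component.exec I V A) = A₂ at hW hC hfr₂ ⊢
  have hadj₂ : A₂ aAdj = A aAdj := hfr₂ _ (by decide) (by decide)
  have hWm : (support N (A₂ aW 0)).card ≤ m := by rw [hW]; exact h.border_card s hs hsD
  obtain ⟨hfound, hnot⟩ := exec_searchCut (I := I) hV
    (A := A₂) (by rwa [hfr₂ _ (by decide) (by decide)]) hK3 (hWm.trans (by omega))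
  rw [hadj₂] at hfound hnot
  have hfr₃ : ∀ b, b ≠ aR → b ≠ aLev → b ≠ aCur → b ≠ aAB → b ≠ aX → b ≠ aFound →
      searchCut.exec I V A₂ b = A₂ b := fun b => exec_searchCut_of_ne
  generalize searchCut.exec I V A₂ = A₃ at hfound hnot hfr₃ ⊢
  have hC₃ : A₃ aC = A₂ aC := hfr₃ _ (by decide) (by decide) (by decide) (by decide) (by decide)
    (by decide)
  have hW₃ : A₃ aW = A₂ aW := hfr₃ _ (by decide) (by decide) (by decide) (by decide) (by decide)
    (by decide)
  have hD₃ : A₃ aD = A aD := (hfr₃ _ (by decide) (by decide) (by decide) (by decide) (by decide)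
    (by decide)).trans (hfr₂ _ (by decide) (by decide))
  have hF₃ : A₃ aFail = A aFail := (hfr₃ _ (by decide) (by decide) (by decide) (by decide)
    (by decide) (by decide)).trans (hfr₂ _ (by decide) (by decide))
  have hB₃ : A₃ aBag = A aBag := (hfr₃ _ (by decide) (by decide) (by decide) (by decide)
    (by decide) (by decide)).trans (hfr₂ _ (by decide) (by decide))
  set W := support N (A₂ aW 0) with hWdef
  set Y := (Finset.range N).filter fun v => A₃ aFound 0 0 ≠ 0 ∧ A₂ aC 0 v ≠ 0 ∧ A₃ aX 0 v ≠ 0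
    with hY
  have hbag₄ : ∀ v < N, newBag.exec I V A₃ aBag s v ≠ 0 ↔ v ∈ W ∪ insert s Y := by
    have := exec_row_of_not_reads (I := I) (V := V) (A := A₃) (a := aBag) (z := xs) (x := xu)
      (y := vN) (e := (Exp.get aW vO xu).or <| (Exp.eq (.var xu) (.var xs)).or <|
        (Exp.get aFound vO vO).and <| (Exp.get aC vO xu).and (.get aX vO xu)) (by decide)
      (by simp [Exp.or, Exp.and, Exp.eq, Exp.le, Exp.Reads])
    rw [hV.eqN] at this
    intro v hv
    rw [newBag, this v hv]
    change Exp.Holds _ _ _ _ ↔ _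
    simp [hV.eqO, hW₃, hC₃, hWdef, hY, hv, hsdef]
    tauto
  have hbag₄' : ∀ i ≠ s, newBag.exec I V A₃ aBag i = A₃ aBag i :=
    (exec_row (I := I) (V := V) (A := A₃) (a := aBag) (z := xs) (x := xu)
      (y := vN) (e := (Exp.get aW vO xu).or <| (Exp.eq (.var xu) (.var xs)).or <|
        (Exp.get aFound vO vO).and <| (Exp.get aC vO xu).and (.get aX vO xu)) (by decide)
      (fun i => Exp.eval I ((Exp.get aW vO xu).or <| (Exp.eq (.var xu) (.var xs)).or <|
        (Exp.get aFound vO vO).and <| (Exp.get aC vO xu).and (.get aX vO xu))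
        (Function.update V xu i) A₃)
      (fun i _ A' hA' _ _ _ => Exp.eval_congr fun b hb => hA' b (by
        rintro rfl; simp [Exp.or, Exp.and, Exp.eq, Exp.le, Exp.Reads] at hb))).2.2
  have hfr₄ : ∀ b ≠ aBag, newBag.exec I V A₃ b = A₃ b := fun b hb =>
    exec_of_not_writes (by simp [newBag, hb])
  generalize newBag.exec I V A₃ = A₄ at hbag₄ hbag₄' hfr₄ ⊢
  have hfr₅ : ∀ b ≠ aFail, checkFail.exec I V A₄ b = A₄ b := fun b hb =>
    exec_of_not_writes (by simp [checkFail, Writes, hb])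
  have hfail₅ : checkFail.exec I V A₄ aFail 0 0 ≠ 0 ↔ A₃ aFound 0 0 = 0 ∧ m ≤ W.card := by
    have hc : ((Exp.get aFound vO vO).not.and <|
        Exp.le (.var vm) (.count xu vN (.get aW vO xu))).Holds I V A₄ ↔
        A₃ aFound 0 0 = 0 ∧ m ≤ W.card := by
      simp [hV.eqO, hV.eqm, hV.eqN, hfr₄ aFound (by decide), hfr₄ aW (by decide), hW₃, hWdef,
        support]
    rw [checkFail, exec_ite]
    by_cases h' : ((Exp.get aFound vO vO).not.and <|
        Exp.le (.var vm) (.count xu vN (.get aW vO xu))).Holds I V A₄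
    · rw [if_pos h']
      simp only [← hc, h', iff_true, exec_store, hV.eqO]
      simp [Arrays.set]
    · rw [if_neg h', ← hc, exec_skip, hfr₄ _ (by decide), hF₃]
      exact ⟨fun h => absurd hfail h, fun h => absurd h h'⟩
  generalize checkFail.exec I V A₄ = A₅ at hfr₅ hfail₅ ⊢
  have hD₅ : A₅ aD = A aD := by rw [hfr₅ _ (by decide), hfr₄ _ (by decide), hD₃]
  have hD₆ : ∀ v < N, (row aD vO xu vN <| (Exp.get aD vO xu).or (.get aBag xs xu)).exec I V A₅ aD 0
      v
      ≠ 0 ↔ v ∈ D ∪ (W ∪ insert s Y) := by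
    have := exec_row_of_eq (I := I) (V := V) (A := A₅) (a := aD) (z := vO) (x := xu)
      (y := vN) (e := (Exp.get aD vO xu).or (.get aBag xs xu)) (by decide)
      (fun i _ A' h1 h2 h3 => by simp [Exp.or, h3 i le_rfl, h1 aBag (by decide)])
    rw [hV.eqN, hV.eqO] at this
    intro v hv
    rw [this v hv]
    change Exp.Holds _ _ _ _ ↔ _
    have := hbag₄ v hv
    rw [Finset.mem_union, ← this]
    simp [hV.eqO, hD₅, hD, hv, hfr₅ aBag (by decide), hsdef]
  have hfr₆ : ∀ b ≠ aD, (row aD vO xu vN <| (Exp.get aD vO xu).or (.get aBag xs xu)).exec I V A₅ b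
      = A₅ b := fun b hb => exec_of_not_writes (by simp [hb])
  generalize (row aD vO xu vN <| (Exp.get aD vO xu).or (.get aBag xs xu)).exec I V A₅ = A₆
    at hD₆ hfr₆ ⊢
  rw [hfr₆ aFail (by decide)]
  refine ⟨fun h0 => ?_, fun h0 => ?_⟩
  · have hsupD : support N (A₆ aD 0) = D ∪ (W ∪ insert s Y) := by
      ext v
      rw [mem_support]
      constructor
      · rintro ⟨h1, h2⟩
        exact (hD₆ v h1).1 h2
      · intro hv
        have : v < N := by
          simp only [Finset.mem_union, Finset.mem_insert] at hv
          rcases hv with hv | hv | rfl | hv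
          · exact (mem_support.1 hv).1
          · exact (mem_support.1 hv).1
          · exact hs
          · exact Finset.mem_range.1 (Finset.mem_filter.1 hv).1
        exact ⟨this, (hD₆ v this).2 hv⟩
    rw [hsupD]
    refine h.step hsymm hsD hs hK hW rfl (Y := Y) (fun i => ?_) ?_
    · have e : A₆ aBag i = A₄ aBag i := by rw [hfr₆ _ (by decide), hfr₅ _ (by decide)]
      unfold storedBag
      by_cases hi : i = s
      · subst hi
        rw [if_pos rfl, if_pos hs.le, e]
        ext v
        rw [mem_support]
        constructor
        · rintro ⟨h1, h2⟩
          exact (hbag₄ v h1).1 h2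
        · intro hv
          have : v < N := by
            simp only [Finset.mem_union, Finset.mem_insert] at hv
            rcases hv with hv | rfl | hv
            · exact (mem_support.1 hv).1
            · exact hs
            · exact Finset.mem_range.1 (Finset.mem_filter.1 hv).1
          exact ⟨this, (hbag₄ v this).2 hv⟩
      · rw [if_neg hi, e, hbag₄' i hi, hB₃]
    · by_cases hf : A₃ aFound 0 0 = 0
      · left
        refine ⟨?_, ?_⟩
        · rw [hY]; simp [hf]
        · by_contra h1
          exact hfail₅.2 ⟨hf, not_lt.1 h1⟩ h0
      · right
        obtain ⟨S, T, R, hsp⟩ := hfound hf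
        refine ⟨_, S, T, R, hsp, fun y => ?_⟩
        rw [hY, Finset.mem_filter, mem_support, Finset.mem_range]
        constructor
        · rintro ⟨h1, -, h2, h3⟩
          exact ⟨⟨h1, h3⟩, (hC y h1).1 h2⟩
        · rintro ⟨⟨h1, h2⟩, h3⟩
          exact ⟨h1, hf, (hC y h1).2 h3, h2⟩
  · obtain ⟨h1, h2⟩ := hfail₅.1 h0
    exact ⟨W, Finset.filter_subset _ _, h2, hnot h1⟩

lemma exec_stage_of_ne {b : Fin 16}
    (h : b ∉ [aD, aBag, aC, aW, aR, aLev, aX, aAB, aFail, aCur, aFound]) :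
    stage.exec I V A b = A b := by
  simp only [List.mem_cons, not_or, List.not_mem_nil] at h
  exact exec_of_not_writes (by
    simp [stage, component, boundary, newBag, checkFail, searchCut, tryCode, select, record,
        maxFlow,
      augment, searchResidual, reach, walk, Writes, h])

/-- A failure is never revoked. -/
lemma exec_stage_fail (hV : Params V L N k m K H) (h : A aFail 0 0 ≠ 0) :
    stage.exec I V A aFail 0 0 ≠ 0 := by
  rw [stage, exec_ite]
  split_ifs
  · exact h
  · simp only [exec_seq]
    rw [exec_of_not_writes (by simp)]
    have : newBag.exec I V (searchCut.exec I V (boundary.exec I V (component.exec I V A))) aFail =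
        A aFail := by
      rw [exec_of_not_writes (by simp [newBag]), exec_searchCut_of_ne (by decide) (by decide)
        (by decide) (by decide) (by decide) (by decide), exec_of_not_writes (by simp [boundary]),
        exec_of_not_writes (by simp [component, reach, Writes])]
    rw [checkFail, exec_ite]
    split_ifs
    · simp [Arrays.set, hV.eqO]
    · rwa [exec_skip, this]

lemma exec_decompose_of_ne {b : Fin 16}
    (h : b ∉ [aD, aBag, aC, aW, aR, aLev, aX, aAB, aFail, aCur, aFound]) :
    decompose.exec I V A b = A b := by
  simp only [List.mem_cons, not_or, List.not_mem_nil] at h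
  exact exec_of_not_writes (by
    simp [decompose, stage, component, boundary, newBag, checkFail, searchCut, tryCode, select,
      record, maxFlow, augment, searchResidual, reach, walk, Writes, h])

/-- Unless it reports failure, the program finds bags; failure implies that some large set cannot
be split. -/
lemma exec_decompose (hV : Params V L N k m K H) (hdig : DigitsComplete K H (A aDig))
    (hK : m + 1 + k ≤ K) (hK3 : 3 ≤ K)
    (hsymm : ∀ u < N, ∀ v < N, A aAdj u v ≠ 0 → A aAdj v u ≠ 0) :
    (decompose.exec I V A aFail 0 0 = 0 →
      BagSequence N (fun a b => A aAdj a b ≠ 0) K (N + 1) (storedBag N (decompose.exec I V A)) ∧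
      ∀ v < N, ∃ i < N + 1, v ∈ storedBag N (decompose.exec I V A) i) ∧
    (decompose.exec I V A aFail 0 0 ≠ 0 → Unsplittable N (fun a b => A aAdj a b ≠ 0) k m) := by
  have hE : decompose.exec I V A = (Stm.loop xs vN stage).exec I V
      ((table aBag xs vNs xu vN (.const 0)).exec I V
      ((row aD vO xu vN (.const 0)).exec I V (A.set aFail 0 0 0))) := by
    simp [decompose, hV.eqO]
  rw [hE]
  have h1 : ∀ v < N, (row aD vO xu vN (.const 0)).exec I V (A.set aFail 0 0 0) aD 0 v = 0 := by
    have := exec_row_of_not_reads (I := I) (V := V) (A := A.set aFail 0 0 0) (a := aD) (z := vO)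
      (x := xu) (y := vN) (e := .const 0) (by decide) (by simp [Exp.Reads])
    rw [hV.eqN, hV.eqO] at this
    exact this
  have h1' : ∀ b ≠ aD, (row aD vO xu vN (.const 0)).exec I V (A.set aFail 0 0 0) b =
      (A.set aFail 0 0 0) b := fun b hb => exec_of_not_writes (by simpa using hb)
  generalize (row aD vO xu vN (.const 0)).exec I V (A.set aFail 0 0 0) = A₁ at h1 h1' ⊢
  have h2 : ∀ i < N + 1, ∀ j < N, (table aBag xs vNs xu vN (.const 0)).exec I V A₁ aBag i j = 0 :=
      by
    have := exec_table (I := I) (V := V) (A := A₁) (a := aBag) (x := xs) (y := vNs) (x' := xu)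
      (y' := vN) (e := .const 0) (by decide) (by decide) (fun _ _ => 0)
      (fun _ _ _ _ _ _ _ => rfl)
    rw [hV.eqN, hV.eqNs] at this
    exact this
  have h2' : ∀ b ≠ aBag, (table aBag xs vNs xu vN (.const 0)).exec I V A₁ b = A₁ b :=
    fun b hb => exec_of_not_writes (by simpa using hb)
  generalize (table aBag xs vNs xu vN (.const 0)).exec I V A₁ = A₂ at h2 h2' ⊢
  have hadj : A₂ aAdj = A aAdj := by
    rw [h2' _ (by decide), h1' _ (by decide)]; funext i j; simp [Arrays.set]
  have hdg : A₂ aDig = A aDig := by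
    rw [h2' _ (by decide), h1' _ (by decide)]; funext i j; simp [Arrays.set]
  have hfl : A₂ aFail 0 0 = 0 := by
    rw [h2' _ (by decide), h1' _ (by decide)]; simp [Arrays.set]
  have hD : support N (A₂ aD 0) = ∅ := by
    ext v
    rw [mem_support, h2' _ (by decide)]
    simp only [Finset.notMem_empty, iff_false, not_and, not_not]
    exact h1 v
  have hbag : ∀ i, storedBag N A₂ i = ∅ := by
    intro i
    unfold storedBag
    split_ifs with hi
    · ext v
      rw [mem_support]
      simp only [Finset.notMem_empty, iff_false, not_and, not_not]
      exact h2 i (by omega) v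
    · rfl
  have key := loop_induct (I := I) (V := V) (A := A₂) (x := xs) (y := vN) (p := stage)
    (P := fun s A' => A' aAdj = A aAdj ∧ A' aDig = A aDig ∧
      (A' aFail 0 0 = 0 → PartialBags N (fun a b => A aAdj a b ≠ 0) K m s (storedBag N A')
        (support N (A' aD 0))) ∧
      (A' aFail 0 0 ≠ 0 → Unsplittable N (fun a b => A aAdj a b ≠ 0) k m)) ?_ ?_
  · rw [hV.eqN] at key
    refine ⟨fun h => ?_, key.2.2.2⟩
    have hp := key.2.2.1 h
    refine ⟨⟨hp.subset, hp.card, fun i hi => ?_, fun i hi => ?_⟩, fun v hv => ?_⟩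
    · rcases Nat.lt_succ_iff_lt_or_eq.1 hi with hi | rfl
      · exact hp.old i hi
      · left; simp [hp.later i le_rfl]
    · rcases Nat.lt_succ_iff_lt_or_eq.1 hi with hi | rfl
      · exact hp.edge i hi
      · simp [hp.later i le_rfl]
    · have := hp.processed v hv hv
      rw [hp.union, Finset.mem_biUnion] at this
      obtain ⟨i, hi, hi'⟩ := this
      exact ⟨i, by have := Finset.mem_range.1 hi; omega, hi'⟩
  · refine ⟨hadj, hdg, fun _ => ?_, fun h => absurd hfl h⟩
    rw [hD]
    refine ⟨⟨fun i => ?_, fun i => ?_, fun i hi => ?_, fun i hi => ?_⟩, ?_, fun v hv => ?_, fun i _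
        => hbag i,
      fun x _ _ => ?_, fun x _ _ => ?_⟩
    · simp [hbag]
    · simp [hbag]
    · omega
    · omega
    · simp
    · omega
    · simp [border]
    · simp [border]
  · rintro s A' hs ⟨e1, e2, h3, h4⟩
    rw [hV.eqN] at hs
    refine ⟨?_, ?_, ?_⟩
    · rw [exec_stage_of_ne (by decide), e1]
    · rw [exec_stage_of_ne (by decide), e2]
    · by_cases hf : A' aFail 0 0 = 0
      · have := exec_stage (I := I) (hV.update (show 9 < xs by decide) s) (A := A')
          (by simpa using hs)
          (by rwa [e2]) hK hK3 (by rwa [e1]) (by rw [e1]; simpa using h3 hf) hf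
        rw [e1] at this
        simpa using this
      · exact ⟨fun h => absurd h (exec_stage_fail (hV.update (by decide) s) hf), fun _ => h4 hf⟩

end Stm

/-! ### Digits -/

namespace Stm

/-- The quotient of the variable `xc` by `K`: the number of positive multiples of `K` up to it. -/
def quotient : Exp :=
  .sum xx xc (Exp.le (.sum xy vK (.add (.var xx) (.const 1))) (.var xc))

/-- Computes the digits to base `K` of all numbers below `H`. Digit `z` is the remainder modulo `K`
of the quotient by the power `K ^ z`, which is obtained by repeated division. -/
def digits : Stm :=
  (table aQ xz vK xq vH <| .ite (Exp.eq (.var xz) (.const 0)) (.var xq) <|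
    .bind xw vK (.sub (.var xz) (.const 1)) <| .bind xc vH (.get aQ xw xq) quotient).seq <|
  table aDig xz vK xq vH <| .bind xc vH (.get aQ xz xq) <|
    .sub (.var xc) (.sum xu vK quotient)

variable {I V : ℕ → ℕ} {A : Arrays} {L N k m K H : ℕ}

lemma eval_quotient (hV : V vK = K) (hK : 0 < K) : quotient.eval I V A = V xc / K := by
  have h : ∀ x, (K * (x + 1) ≤ V xc) = (x < V xc / K) := by
    intro x
    rw [← Nat.succ_le_iff, Nat.le_div_iff_mul_le hK, mul_comm]
  have h1 : V xc / K ≤ V xc := Nat.div_le_self _ _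
  simp only [quotient, Exp.eval_sum, Exp.eval_le, Exp.eval_add, Exp.eval_var, Exp.eval_const]
  simp only [ne_eq, Nat.reduceEqDiff, not_false_eq_true, Function.update_of_ne, hV,
    Function.update_self]
  simp only [Finset.sum_const, Finset.card_range, smul_eq_mul, h, Finset.sum_boole]
  rw [show ((Finset.range (V xc)).filter fun x => x < V xc / K) = Finset.range (V xc / K) by
    ext x; simp; omega]
  simp

lemma exec_digits (hV : Params V L N k m K (K ^ K)) (hK : 0 < K) :
    DigitsComplete K (K ^ K) (digits.exec I V A aDig) := by
  have hQ := exec_table (I := I) (V := V) (A := A) (a := aQ) (x := xz) (y := vK) (x' := xq)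
    (y' := vH) (e := .ite (Exp.eq (.var xz) (.const 0)) (.var xq) <|
    .bind xw vK (.sub (.var xz) (.const 1)) <| .bind xc vH (.get aQ xw xq) quotient) (by decide)
    (by decide) (fun z q => q / K ^ z) (by
      rw [hV.eqK, hV.eqH]
      intro z hz q hq A' _ h
      rw [Exp.eval_ite]
      by_cases hz0 : z = 0
      · subst hz0; simp
      · have hq' : q / K ^ (z - 1) ≤ K ^ K := (Nat.div_le_self _ _).trans hq.le
        have e := h (z - 1) (by omega) q hq
        simp only [Exp.holds_eq, Exp.eval_var, Exp.eval_const, ne_eq, Nat.reduceEqDiff,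
          not_false_eq_true, Function.update_of_ne, Function.update_self, hz0, if_false,
          Exp.eval_bind, Exp.eval_sub, Exp.eval_get, hV.eqK, hV.eqH,
          min_eq_left (show z - 1 ≤ K by omega), e, min_eq_left hq']
        rw [eval_quotient (K := K) (by simp [hV.eqK]) hK, Function.update_self,
            Nat.div_div_eq_div_mul,
          ← pow_succ, Nat.sub_add_cancel (by omega)])
  rw [hV.eqK, hV.eqH] at hQ
  rw [digits, exec_seq]
  generalize (table aQ xz vK xq vH _).exec I V A = A₁ at hQ
  have hD := exec_table (I := I) (V := V) (A := A₁) (a := aDig) (x := xz) (y := vK) (x' := xq)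
    (y' := vH) (e := .bind xc vH (.get aQ xz xq) <| .sub (.var xc) (.sum xu vK quotient))
        (by decide)
    (by decide) (fun z q => q / K ^ z % K) (by
      rw [hV.eqK, hV.eqH]
      intro z hz q hq A' h _
      have hq' : q / K ^ z ≤ K ^ K := (Nat.div_le_self _ _).trans hq.le
      simp only [Exp.eval_bind, Exp.eval_get, Exp.eval_sub, Exp.eval_var, Exp.eval_sum, ne_eq,
        Nat.reduceEqDiff, not_false_eq_true, Function.update_of_ne, Function.update_self,
        h aQ (by decide), hQ z hz q hq, hV.eqH, min_eq_left hq', hV.eqK]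
      rw [Finset.sum_congr rfl fun i _ => eval_quotient (K := K) (by simp [hV.eqK]) hK]
      simp only [ne_eq, Nat.reduceEqDiff, not_false_eq_true, Function.update_of_ne,
        Function.update_self, Finset.sum_const, Finset.card_range, smul_eq_mul]
      have := Nat.div_add_mod (q / K ^ z) K
      omega)
  rw [hV.eqK, hV.eqH] at hD
  intro f hf
  let g : Fin K → Fin K := fun z => ⟨f z, hf z⟩
  refine ⟨finFunctionFinEquiv g, (finFunctionFinEquiv g).2, fun z hz => ?_⟩
  rw [hD z hz _ (finFunctionFinEquiv g).2]
  have := congrFun (finFunctionFinEquiv.symm_apply_apply g) ⟨z, hz⟩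
  exact congrArg Fin.val this

end Stm

/-! ### Reading the constraints of an instance -/

/-- The part of the encoding of an instance that describes the constraint `c`. -/
def CSPConstraint.encode {D : Type} {Γ : ConstraintLanguage D} {n : ℕ} (c : CSPConstraint Γ n) :
    List ℕ :=
  (c.symbol : ℕ) :: List.ofFn fun j => (c.scope j : ℕ)

@[simp] lemma CSPConstraint.length_encode {D : Type} {Γ : ConstraintLanguage D} {n : ℕ}
    (c : CSPConstraint Γ n) : c.encode.length = 1 + Γ.arity c.symbol := by
  simp [encode, add_comm]

namespace CSPInstance

variable {D : Type} {Γ : ConstraintLanguage D} {J : CSPInstance Γ}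

/-- The contents of the memory if it is initialized with the encoding of an instance. -/
def input (J : CSPInstance Γ) (i : ℕ) : ℕ := J.encode.getD i 0

lemma encode_eq (J : CSPInstance Γ) :
    J.encode = J.numVars :: J.constraints.flatMap CSPConstraint.encode := rfl

@[simp] lemma input_zero : J.input 0 = J.numVars := rfl

lemma input_of_le {i : ℕ} (hi : J.encode.length ≤ i) : J.input i = 0 :=
  List.getD_eq_default _ _ hi

/-- The description of the constraint `c` starts at address `p`. -/
def IsStart (J : CSPInstance Γ) (p : ℕ) (c : CSPConstraint Γ J.numVars) : Prop :=
  ∃ pre post, J.constraints = pre ++ c :: post ∧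
    p = 1 + (pre.flatMap CSPConstraint.encode).length

lemma IsStart.mem {p : ℕ} {c : CSPConstraint Γ J.numVars} (h : J.IsStart p c) :
    c ∈ J.constraints := by
  obtain ⟨pre, post, h1, _⟩ := h
  simp [h1]

lemma exists_isStart {c : CSPConstraint Γ J.numVars} (h : c ∈ J.constraints) :
    ∃ p, J.IsStart p c := by
  obtain ⟨pre, post, h1⟩ := List.append_of_mem h
  exact ⟨_, pre, post, h1, rfl⟩

lemma IsStart.le_length {p : ℕ} {c : CSPConstraint Γ J.numVars} (h : J.IsStart p c) :
    p + 1 + Γ.arity c.symbol ≤ J.encode.length := by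
  obtain ⟨pre, post, h1, rfl⟩ := h
  simp only [encode_eq, h1, List.length_cons, List.flatMap_append, List.flatMap_cons,
    List.length_append, CSPConstraint.length_encode]
  omega

lemma IsStart.lt_length {p : ℕ} {c : CSPConstraint Γ J.numVars} (h : J.IsStart p c) :
    p < J.encode.length := by
  have := h.le_length
  omega

lemma IsStart.input_add {p : ℕ} {c : CSPConstraint Γ J.numVars} (h : J.IsStart p c) {j : ℕ}
    (hj : j < c.encode.length) : J.input (p + j) = c.encode.getD j 0 := by
  obtain ⟨pre, post, h1, rfl⟩ := h
  simp only [input, encode_eq, h1, List.flatMap_append, List.flatMap_cons]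
  rw [show 1 + (pre.flatMap CSPConstraint.encode).length + j =
    (pre.flatMap CSPConstraint.encode).length + j + 1 by omega, List.getD_cons_succ,
    List.getD_append_right _ _ _ _ (by omega), Nat.add_sub_cancel_left,
    List.getD_append _ _ _ _ hj]

lemma IsStart.input_self {p : ℕ} {c : CSPConstraint Γ J.numVars} (h : J.IsStart p c) :
    J.input p = c.symbol := h.input_add (j := 0) (by simp [CSPConstraint.encode])

lemma IsStart.input_scope {p : ℕ} {c : CSPConstraint Γ J.numVars} (h : J.IsStart p c)
    (j : Fin (Γ.arity c.symbol)) : J.input (p + (j + 1)) = c.scope j := by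
  rw [h.input_add (by have := j.2; simp; omega), CSPConstraint.encode, List.getD_cons_succ,
    List.getD_eq_getElem _ _ (by simp)]
  simp

/-- Except for the first one, a description starts where another one ends; this is how the starting
addresses can be computed from left to right. -/
lemma exists_isStart_iff {p : ℕ} (hp : p < J.encode.length) :
    (∃ c, J.IsStart p c) ↔
      p = 1 ∨ ∃ w < p, ∃ c, J.IsStart w c ∧ p = w + 1 + Γ.arity c.symbol := by
  constructor
  · rintro ⟨c, pre, post, h1, h2⟩
    rcases List.eq_nil_or_concat' pre with rfl | ⟨pre', c', rfl⟩
    · exact Or.inl h2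
    · right
      refine ⟨1 + (pre'.flatMap CSPConstraint.encode).length, ?_, c',
        ⟨pre', c :: post, by simp [h1], rfl⟩, ?_⟩
      all_goals
        rw [h2]
        simp only [List.flatMap_append, List.flatMap_cons, List.flatMap_nil, List.append_nil,
          List.length_append, CSPConstraint.length_encode]
        omega
  · have key : ∀ pre post : List (CSPConstraint Γ J.numVars), J.constraints = pre ++ post →
        p = 1 + (pre.flatMap CSPConstraint.encode).length → ∃ c, J.IsStart p c := by
      rintro pre (_ | ⟨c, post⟩) h1 h2
      · simp only [encode_eq, h1, List.append_nil, List.length_cons] at hp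
        omega
      · exact ⟨c, pre, post, h1, h2⟩
    rintro (rfl | ⟨_, _, c, ⟨pre, post, h1, rfl⟩, h2⟩)
    · exact key [] _ rfl rfl
    · refine key (pre ++ [c]) post (by simp [h1]) ?_
      rw [h2]
      simp only [List.flatMap_append, List.flatMap_cons, List.flatMap_nil, List.append_nil,
        List.length_append, CSPConstraint.length_encode]
      omega

/-- The adjacency relation of the primal graph in terms of the numbers of the vertices. -/
lemma primalGraph_adj_iff {u v : Fin J.numVars} : J.primalGraph.Adj u v ↔
    u ≠ v ∧ ∃ p c, J.IsStart p c ∧ (∃ i, c.scope i = u) ∧ ∃ j, c.scope j = v := by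
  refine and_congr_right fun _ => ⟨?_, ?_⟩
  · rintro ⟨c, hc, h⟩
    obtain ⟨p, hp⟩ := exists_isStart hc
    exact ⟨p, c, hp, h⟩
  · rintro ⟨p, c, hp, h⟩
    exact ⟨c, hp.mem, h⟩

end CSPInstance

namespace Exp

variable {D : Type} (Γ : ConstraintLanguage D)

/-- The arity of the relation symbol whose number is the value of `e`. -/
def symbolArity (e : Exp) : Exp :=
  (List.finRange Γ.card).foldr
    (fun (i : Fin Γ.card) r => .ite (eq e (.const i)) (.const (Γ.arity i)) r) (.const 0)

/-- If the description of a constraint starts at `xw`, the condition `P i` for its relation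
symbol `i`. -/
def symbolCase (P : Fin Γ.card → Exp) : Exp :=
  any ((List.finRange Γ.card).map fun i : Fin Γ.card =>
    (eq (.inp (.var xw)) (.const i)).and (P i))

/-- If the description of a constraint starts at `xw`, entry `j` of its scope. -/
def scopeEntry (j : ℕ) : Exp := .inp (.add (.var xw) (.const (j + 1)))

variable {Γ} {J : CSPInstance Γ} {V : ℕ → ℕ} {A : Arrays} {c : CSPConstraint Γ J.numVars}

lemma eval_symbolArity {I : ℕ → ℕ} {e : Exp} {i : Fin Γ.card} (h : e.eval I V A = i) :
    (symbolArity Γ e).eval I V A = Γ.arity i := by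
  have : ∀ l : List (Fin Γ.card), i ∈ l → (l.foldr (fun (i : Fin Γ.card) r =>
      Exp.ite (eq e (.const i)) (.const (Γ.arity i)) r) (.const 0)).eval I V A = Γ.arity i := by
    intro l hl
    induction l with
    | nil => simp at hl
    | cons a l ih =>
      by_cases ha : i = a
      · subst ha; simp [h]
      · have h' : ¬ (i : ℕ) = a := fun hh => ha (Fin.ext hh)
        simp only [List.mem_cons, ha, false_or] at hl
        simp [h, h', ih hl]
  exact this _ (List.mem_finRange i)

lemma holds_symbolCase {P : Fin Γ.card → Exp} (h : J.IsStart (V xw) c) :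
    (symbolCase Γ P).Holds J.input V A ↔ (P c.symbol).Holds J.input V A := by
  simp only [symbolCase, holds_any, List.mem_map, List.mem_finRange, true_and,
    exists_exists_eq_and, holds_and, holds_eq, eval_inp, eval_var, eval_const, h.input_self]
  constructor
  · rintro ⟨i, h1, h2⟩
    rwa [Fin.ext h1]
  · exact fun h => ⟨_, rfl, h⟩

lemma eval_scopeEntry (h : J.IsStart (V xw) c) (j : Fin (Γ.arity c.symbol)) :
    (scopeEntry j).eval J.input V A = c.scope j := h.input_scope j

end Exp

namespace Stm

variable {D : Type} (Γ : ConstraintLanguage D)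

/-- Marks the addresses at which the descriptions of the constraints start. -/
def starts : Stm :=
  row aStart vO xu vL <| .ite
    ((Exp.eq (.var xu) (.const 1)).or <| .ex xw xu <| (Exp.get aStart vO xw).and <|
      .eq (.var xu) (.add (.add (.var xw) (.const 1)) (.symbolArity Γ (.inp (.var xw)))))
    (.const 1) (.const 0)

/-- Computes the adjacency matrix of the primal graph. -/
def adjacency : Stm :=
  table aAdj xt vN xu vN <| .ite
    ((Exp.eq (.var xt) (.var xu)).not.and <| .ex xw vL <| (Exp.get aStart vO xw).and <|
      .symbolCase Γ fun i =>
        (Exp.any ((List.finRange (Γ.arity i)).map fun j : Fin (Γ.arity i) =>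
          .eq (.scopeEntry j) (.var xt))).and <|
        Exp.any ((List.finRange (Γ.arity i)).map fun j : Fin (Γ.arity i) =>
          .eq (.scopeEntry j) (.var xu)))
    (.const 1) (.const 0)

variable {Γ} {J : CSPInstance Γ} {V : ℕ → ℕ} {A : Arrays} {N k m K H : ℕ}

lemma exec_starts (hV : Params V J.encode.length N k m K H) :
    ∀ p < J.encode.length, (starts Γ).exec J.input V A aStart 0 p ≠ 0 ↔ ∃ c, J.IsStart p c := by
  classical
  have := (exec_row (I := J.input) (V := V) (A := A) (a := aStart) (z := vO) (x := xu) (y := vL)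
    (e := .ite
    ((Exp.eq (.var xu) (.const 1)).or <| .ex xw xu <| (Exp.get aStart vO xw).and <|
      .eq (.var xu) (.add (.add (.var xw) (.const 1)) (.symbolArity Γ (.inp (.var xw)))))
    (.const 1) (.const 0)) (by decide) (fun p => if ∃ c, J.IsStart p c then 1 else 0) (by
      rw [hV.eqL, hV.eqO]
      intro p hp A' _ _ h _
      rw [Exp.eval_ite]
      refine if_congr ?_ rfl rfl
      rw [CSPInstance.exists_isStart_iff hp]
      simp only [Exp.holds_or, Exp.holds_eq, Exp.holds_ex, Exp.holds_and, Exp.holds_get,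
        Exp.eval_var, Exp.eval_const, Exp.eval_add, Function.update_self, ne_eq, Nat.reduceEqDiff,
        not_false_eq_true, Function.update_of_ne, hV.eqO]
      refine or_congr_right (exists_congr fun w => and_congr_right fun hw => ?_)
      rw [h w hw]
      constructor
      · rintro ⟨h1, h2⟩
        obtain ⟨c, hc⟩ : ∃ c, J.IsStart w c := by
          by_contra h3
          simp [h3] at h1
        refine ⟨c, hc, ?_⟩
        rwa [Exp.eval_symbolArity (i := c.symbol) (by simp [hc.input_self])] at h2
      · rintro ⟨c, hc, h2⟩
        rw [Exp.eval_symbolArity (i := c.symbol) (by simp [hc.input_self])]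
        exact ⟨by simp [show ∃ c, J.IsStart w c from ⟨c, hc⟩], h2⟩)).1
  rw [hV.eqL, hV.eqO] at this
  intro p hp
  rw [starts, this p hp]
  simp

lemma exec_adjacency (hV : Params V J.encode.length J.numVars k m K H)
    (hA : ∀ p < J.encode.length, A aStart 0 p ≠ 0 ↔ ∃ c, J.IsStart p c) (u v : Fin J.numVars) :
    (adjacency Γ).exec J.input V A aAdj u v ≠ 0 ↔ J.primalGraph.Adj u v := by
  classical
  have := exec_table (I := J.input) (V := V) (A := A) (a := aAdj) (x := xt) (y := vN) (x' := xu)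
    (y' := vN) (e := .ite
    ((Exp.eq (.var xt) (.var xu)).not.and <| .ex xw vL <| (Exp.get aStart vO xw).and <|
      .symbolCase Γ fun i =>
        (Exp.any ((List.finRange (Γ.arity i)).map fun j : Fin (Γ.arity i) =>
          .eq (.scopeEntry j) (.var xt))).and <|
        Exp.any ((List.finRange (Γ.arity i)).map fun j : Fin (Γ.arity i) =>
          .eq (.scopeEntry j) (.var xu)))
    (.const 1) (.const 0)) (by decide) (by decide)
    (fun u v => if u ≠ v ∧ ∃ p c, J.IsStart p c ∧ (∃ i, c.scope i = u) ∧ ∃ j, c.scope j = v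
      then 1 else 0) (by
      rw [hV.eqN]
      intro u _ v _ A' h _
      rw [Exp.eval_ite]
      refine if_congr ?_ rfl rfl
      simp only [Exp.holds_not, Exp.holds_eq, Exp.holds_ex, Exp.holds_and, Exp.holds_get,
        Exp.eval_var, Function.update_self, ne_eq, Nat.reduceEqDiff,
        not_false_eq_true, Function.update_of_ne, hV.eqO, hV.eqL, h aStart (by decide)]
      refine and_congr_right fun _ => exists_congr fun p => ?_
      constructor
      · rintro ⟨h1, h2, h3⟩
        obtain ⟨c, hc⟩ := (hA p h1).1 h2
        have hc' : ∀ V : ℕ → ℕ, J.IsStart (Function.update V xw p xw) c := by simpa using hc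
        rw [Exp.holds_symbolCase (hc' _)] at h3
        simp only [Exp.holds_and, Exp.holds_any, List.mem_map, List.mem_finRange, true_and,
          exists_exists_eq_and, Exp.holds_eq, Exp.eval_scopeEntry (hc' _)] at h3
        simp at h3
        exact ⟨c, hc, h3⟩
      · rintro ⟨c, hc, h3⟩
        have hc' : ∀ V : ℕ → ℕ, J.IsStart (Function.update V xw p xw) c := by simpa using hc
        refine ⟨hc.lt_length, (hA p hc.lt_length).2 ⟨c, hc⟩, ?_⟩
        rw [Exp.holds_symbolCase (hc' _)]
        simp only [Exp.holds_and, Exp.holds_any, List.mem_map, List.mem_finRange, true_and,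
          exists_exists_eq_and, Exp.holds_eq, Exp.eval_scopeEntry (hc' _)]
        simpa using h3)
  rw [hV.eqN] at this
  rw [adjacency, this u u.2 v v.2, CSPInstance.primalGraph_adj_iff]
  simp [Fin.ext_iff]

end Stm

/-! ### Dynamic programming along the bags -/

/-- The quantifier-free formula `φ` as a condition on the values of expressions. -/
def QFFormula.toExp {n : ℕ} (val : Fin n → Exp) : QFFormula rationalOrder n → Exp
  | .falsum => .const 0
  | .atom _ v => .lt (val (v (0 : Fin 2))) (val (v (1 : Fin 2)))
  | .neg φ => (φ.toExp val).not
  | .conj φ ψ => (φ.toExp val).and (ψ.toExp val)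
  | .disj φ ψ => (φ.toExp val).or (ψ.toExp val)

lemma QFFormula.holds_toExp {n : ℕ} {val : Fin n → Exp} {I V : ℕ → ℕ} {A : Arrays}
    (φ : QFFormula rationalOrder n) :
    (φ.toExp val).Holds I V A ↔ φ.Holds fun j => ((val j).eval I V A : ℚ) := by
  induction φ with
  | falsum => simp [toExp, QFFormula.Holds, Exp.Holds]
  | atom i v =>
    rw [toExp, Exp.holds_lt, ← Nat.cast_lt (α := ℚ)]
    exact Iff.rfl
  | neg φ ih => simp [toExp, QFFormula.Holds, ih]
  | conj φ ψ ih ih' => simp [toExp, QFFormula.Holds, ih, ih']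
  | disj φ ψ ih ih' => simp [toExp, QFFormula.Holds, ih, ih']

/-- The truth of a quantifier-free formula only depends on the order of the entries. -/
lemma QFFormula.holds_congr {n : ℕ} (φ : QFFormula rationalOrder n) {t t' : Fin n → ℚ}
    (h : ∀ i j, t i < t j ↔ t' i < t' j) : φ.Holds t ↔ φ.Holds t' := by
  induction φ with
  | falsum => exact Iff.rfl
  | atom i v => exact h _ _
  | neg φ ih => exact not_congr ih
  | conj φ ψ ih ih' => exact and_congr ih ih'
  | disj φ ψ ih ih' => exact or_congr ih ih'

namespace Stm

/-- The value that the valuation number `h` of the bag `s` gives to `u`: if `z` elements of the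
bag are smaller than `u`, it is digit `z` of `h`. -/
def valuation (K : ℕ) (A : Arrays) (s h u : ℕ) : ℕ :=
  A aDig (min ((Finset.range u).filter fun v => A aBag s v ≠ 0).card K) h

/-- The value of `u` in the valuation `h` of the bag `s`, where `s`, `h`, `u` are variables. -/
def value (s h u : ℕ) : Exp :=
  .bind xz vK (.count xv u (.get aBag s xv)) (.get aDig xz h)

variable {Γ : ConstraintLanguage ℚ} (φ : ∀ i, QFFormula rationalOrder (Γ.arity i))

/-- The valuation `xq` of the bag `xs` satisfies all constraints with scope in the bag. -/
def satisfies : Exp :=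
  .all xw vL <| (Exp.get aStart vO xw).not.or <| .symbolCase Γ fun i =>
    (Exp.every ((List.finRange (Γ.arity i)).map fun j : Fin (Γ.arity i) =>
      .bind xu vN (.scopeEntry j) (.get aBag xs xu))).not.or <|
    (φ i).toExp fun j => .bind xu vN (.scopeEntry j) (value xs xq xu)

/-- The valuation `xq` of the bag `xs` and the valuation `xc` of the bag `xt` order the common
elements of the bags in the same way. -/
def compatible : Exp :=
  .all xx vN <| .all xy vN <|
    (((Exp.get aBag xs xx).and (.get aBag xt xx)).and
      ((Exp.get aBag xs xy).and (.get aBag xt xy))).not.or <|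
    (((value xs xq xx).lt (value xs xq xy)).and ((value xt xc xx).lt (value xt xc xy))).or <|
    ((value xs xq xx).lt (value xs xq xy)).not.and ((value xt xc xx).lt (value xt xc xy)).not

/-- The condition for keeping the valuation `xq` of the bag `xs`: it satisfies the constraints in
the bag, and each later bag has a kept valuation that is compatible with it. -/
def keepCond : Exp :=
  (satisfies φ).and <| .all xt vNs <| ((Exp.var xs).lt (.var xt)).not.or <|
    .ex xc vH <| (Exp.get aAlive xt xc).and compatible

/-- Determines which valuations of the bags are kept, from the last bag to the first. -/
def filterValuations : Stm :=
  .loop xj vNs <| .bind xs vNs (.sub (.var vN) (.var xj)) <|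
    row aAlive xs xq vH <| .ite (keepCond φ) (.const 1) (.const 0)

/-- Every bag has a valuation that is kept. -/
def allAlive : Exp := .all xs vNs <| .ex xq vH <| .get aAlive xs xq

variable {J : CSPInstance Γ} {I V : ℕ → ℕ} {A : Arrays} {L N k m K H : ℕ}

lemma eval_value (hV : V vK = K) {s h u : ℕ} (hs : s ≠ xv) (hh : h ≠ xz) :
    (value s h u).eval I V A = valuation K A (V s) (V h) (V u) := by
  simp [value, valuation, hV, hs, hh]

lemma holds_satisfies (hV : Params V J.encode.length J.numVars k m K H)
    (hA : ∀ p < J.encode.length, A aStart 0 p ≠ 0 ↔ ∃ c, J.IsStart p c) :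
    (satisfies φ).Holds J.input V A ↔ ∀ c ∈ J.constraints,
      (∀ j, A aBag (V xs) (c.scope j) ≠ 0) →
        (φ c.symbol).Holds fun j => (valuation K A (V xs) (V xq) (c.scope j) : ℚ) := by
  have key : ∀ p c, J.IsStart p c → ((Exp.symbolCase Γ fun i =>
      (Exp.every ((List.finRange (Γ.arity i)).map fun j : Fin (Γ.arity i) =>
        .bind xu vN (.scopeEntry j) (.get aBag xs xu))).not.or <|
      (φ i).toExp fun j => .bind xu vN (.scopeEntry j) (value xs xq xu)).Holds J.input
        (Function.update V xw p) A ↔ ((∀ j, A aBag (V xs) (c.scope j) ≠ 0) →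
        (φ c.symbol).Holds fun j => (valuation K A (V xs) (V xq) (c.scope j) : ℚ))) := by
    intro p c hc
    have hc' : J.IsStart (Function.update V xw p xw) c := by simpa using hc
    rw [Exp.holds_symbolCase hc', Exp.holds_or, QFFormula.holds_toExp, Exp.holds_not,
        imp_iff_not_or]
    refine or_congr (not_congr ?_) (iff_of_eq ?_)
    · simp only [Exp.holds_every, List.mem_map, List.mem_finRange, true_and,
        forall_exists_index, forall_apply_eq_imp_iff, Exp.holds_bind, Exp.eval_scopeEntry hc',
        Exp.holds_get, Function.update_self]
      simp [hV.eqN]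
    · congr 1
      funext j
      rw [Exp.eval_bind, Exp.eval_scopeEntry hc', eval_value (K := K) (by simp [hV.eqK])
        (by decide) (by decide)]
      simp [hV.eqN]
  simp only [satisfies, Exp.holds_all, Exp.holds_or, Exp.holds_not, Exp.holds_get, hV.eqL,
    ne_eq, Nat.reduceEqDiff, not_false_eq_true, Function.update_of_ne, hV.eqO,
    Function.update_self]
  constructor
  · intro h c hc
    obtain ⟨p, hp⟩ := CSPInstance.exists_isStart hc
    refine (key p c hp).1 ((h p hp.lt_length).resolve_left ?_)
    exact not_not.2 ((hA p hp.lt_length).2 ⟨c, hp⟩)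
  · intro h p hp
    by_cases hs : A aStart 0 p = 0
    · exact Or.inl (not_not.2 hs)
    · obtain ⟨c, hc⟩ := (hA p hp).1 hs
      exact Or.inr ((key p c hc).2 (h c hc.mem))

lemma holds_compatible (hV : Params V L N k m K H) :
    compatible.Holds I V A ↔ ∀ u < N, ∀ v < N, A aBag (V xs) u ≠ 0 → A aBag (V xt) u ≠ 0 →
      A aBag (V xs) v ≠ 0 → A aBag (V xt) v ≠ 0 →
      (valuation K A (V xs) (V xq) u < valuation K A (V xs) (V xq) v ↔
        valuation K A (V xt) (V xc) u < valuation K A (V xt) (V xc) v) := by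
  simp only [compatible, Exp.holds_all, ne_eq, Nat.reduceEqDiff, not_false_eq_true,
    Function.update_of_ne, hV.eqN]
  refine forall₂_congr fun u _ => forall₂_congr fun v _ => ?_
  simp only [Exp.holds_or, Exp.holds_and, Exp.holds_not, Exp.holds_get, Exp.holds_lt]
  rw [eval_value (K := K) (by simp [hV.eqK]) (by decide) (by decide),
    eval_value (K := K) (by simp [hV.eqK]) (by decide) (by decide),
    eval_value (K := K) (by simp [hV.eqK]) (by decide) (by decide),
    eval_value (K := K) (by simp [hV.eqK]) (by decide) (by decide)]
  simp only [ne_eq, Nat.reduceEqDiff, not_false_eq_true, Function.update_of_ne,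
    Function.update_self]
  tauto

lemma valuation_congr {A' : Arrays} (h : ∀ b ≠ aAlive, A' b = A b) (s h u : ℕ) :
    valuation K A' s h u = valuation K A s h u := by
  simp [valuation, ‹∀ b ≠ aAlive, A' b = A b› aDig (by decide),
    ‹∀ b ≠ aAlive, A' b = A b› aBag (by decide)]

/-- The valuation `h` of the bag `s` satisfies all constraints with scope in the bag. -/
def Satisfies (J : CSPInstance Γ) (K : ℕ) (A : Arrays) (s h : ℕ) : Prop :=
  ∀ c ∈ J.constraints, (∀ j, (c.scope j : ℕ) ∈ storedBag J.numVars A s) →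
    (φ c.symbol).Holds fun j => (valuation K A s h (c.scope j) : ℚ)

/-- The valuations `h` of the bag `s` and `h'` of the bag `s'` order the common elements of the
bags in the same way. -/
def Compatible (N K : ℕ) (A : Arrays) (s h s' h' : ℕ) : Prop :=
  ∀ u ∈ storedBag N A s ∩ storedBag N A s', ∀ v ∈ storedBag N A s ∩ storedBag N A s',
    (valuation K A s h u < valuation K A s h v ↔ valuation K A s' h' u < valuation K A s' h' v)

/-- The kept valuations are those that satisfy the constraints in their bag and are compatible with
some kept valuation of each later bag. -/
lemma exec_filterValuations (hV : Params V J.encode.length J.numVars k m K H)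
    (hA : ∀ p < J.encode.length, A aStart 0 p ≠ 0 ↔ ∃ c, J.IsStart p c) :
    ∀ s ≤ J.numVars, ∀ h < H, (filterValuations φ).exec J.input V A aAlive s h ≠ 0 ↔
      Satisfies φ J K A s h ∧ ∀ s' ≤ J.numVars, s < s' → ∃ h' < H,
        (filterValuations φ).exec J.input V A aAlive s' h' ≠ 0 ∧
          Compatible J.numVars K A s h s' h' := by
  classical
  set N := J.numVars with hN
  have hmem : ∀ s ≤ N, ∀ u : ℕ, u ∈ storedBag N A s ↔ u < N ∧ A aBag s u ≠ 0 := by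
    intro s hs u
    rw [storedBag, if_pos hs, mem_support]
  have key := loop_induct (I := J.input) (V := V) (A := A) (x := xj) (y := vNs)
    (p := .bind xs vNs (.sub (.var vN) (.var xj)) <|
      row aAlive xs xq vH <| .ite (keepCond φ) (.const 1) (.const 0))
    (P := fun i A' => (∀ b ≠ aAlive, A' b = A b) ∧ ∀ s ≤ N, N < s + i → ∀ h < H,
      (A' aAlive s h ≠ 0 ↔ Satisfies φ J K A s h ∧ ∀ s' ≤ N, s < s' → ∃ h' < H,
        A' aAlive s' h' ≠ 0 ∧ Compatible N K A s h s' h'))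
    ⟨fun _ _ => rfl, fun s hs hs' => by omega⟩ ?_
  · rw [hV.eqNs] at key
    intro s hs
    exact key.2 s hs (by omega)
  rw [hV.eqNs]
  rintro i A' hi ⟨h1, h2⟩
  rw [exec_bind]
  have hmin : min ((Exp.sub (.var vN) (.var xj)).eval J.input (Function.update V xj i) A')
      (Function.update V xj i vNs) = N - i := by
    simp only [Exp.eval_sub, Exp.eval_var, ne_eq, Nat.reduceEqDiff, not_false_eq_true,
      Function.update_of_ne, Function.update_self, hV.eqN, hV.eqNs]
    omega
  rw [hmin]
  set V' := Function.update (Function.update V xj i) xs (N - i) with hV'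
  have hP : Params V' J.encode.length J.numVars k m K H :=
    (hV.update (by norm_num) _).update (by norm_num) _
  have hs : V' xs = N - i := by simp [hV']
  have hrow := exec_row (I := J.input) (V := V') (A := A') (a := aAlive) (z := xs) (x := xq)
    (y := vH) (e := .ite (keepCond φ) (.const 1) (.const 0)) (by decide)
    (fun h => if Satisfies φ J K A (N - i) h ∧ ∀ s' ≤ N, N - i < s' → ∃ h' < H,
        A' aAlive s' h' ≠ 0 ∧ Compatible N K A (N - i) h s' h' then 1 else 0) (by
      rw [hP.eqH, hs]
      intro h hh A'' h3 h4 _ _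
      have h5 : ∀ b ≠ aAlive, A'' b = A b := fun b hb => (h3 b hb).trans (h1 b hb)
      rw [Exp.eval_ite]
      refine if_congr ?_ rfl rfl
      rw [keepCond, Exp.holds_and]
      refine and_congr ?_ ?_
      · rw [holds_satisfies φ (hP.update (by norm_num) h) (by
          rw [h5 aStart (by decide)]; exact hA)]
        refine forall₂_congr fun c hc => ?_
        simp only [ne_eq, Nat.reduceEqDiff, not_false_eq_true, Function.update_of_ne,
          Function.update_self, hs, valuation_congr h5, h5 aBag (by decide), ← hN,
          hmem (N - i) (Nat.sub_le _ _)]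
        exact imp_congr_left (forall_congr' fun j => (and_iff_right (c.scope j).2).symm)
      · simp only [Exp.holds_all, Exp.holds_or, Exp.holds_not, Exp.holds_lt, Exp.eval_var,
          Exp.holds_ex, Exp.holds_and, Exp.holds_get, ne_eq, Nat.reduceEqDiff,
          not_false_eq_true, Function.update_of_ne, Function.update_self, hP.eqNs, hP.eqH, hs,
          Nat.lt_succ_iff, ← hN]
        refine forall₂_congr fun s' hs' => ?_
        rw [← imp_iff_not_or]
        refine imp_congr_right fun hlt => exists_congr fun h' => and_congr_right fun _ => ?_
        rw [h4 s' (by omega)]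
        refine and_congr_right fun _ => ?_
        rw [holds_compatible (((hP.update (by norm_num) h).update (by norm_num) s').update
          (by norm_num) h')]
        simp only [ne_eq, Nat.reduceEqDiff, not_false_eq_true, Function.update_of_ne,
          Function.update_self, hs, valuation_congr h5, h5 aBag (by decide), Compatible,
          Finset.mem_inter, hmem (N - i) (Nat.sub_le _ _), hmem s' hs', ← hN]
        constructor
        · intro h u hu v hv
          exact h u hu.1.1 v hv.1.1 hu.1.2 hu.2.2 hv.1.2 hv.2.2
        · intro h u hu v hv a b c d
          exact h u ⟨⟨hu, a⟩, hu, b⟩ v ⟨⟨hv, c⟩, hv, d⟩)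
  rw [hP.eqH, hs] at hrow
  refine ⟨fun b hb => ?_, fun s hsN hsi h hh => ?_⟩
  · rw [exec_of_not_writes (by simpa using hb), h1 b hb]
  · have hlater : ∀ s' ≤ N, s < s' → (row aAlive xs xq vH
        (.ite (keepCond φ) (.const 1) (.const 0))).exec J.input V' A' aAlive s' =
        A' aAlive s' := fun s' hs' hlt => hrow.2.2 s' (by omega)
    have e : (∀ s' ≤ N, s < s' → ∃ h' < H, (row aAlive xs xq vH
        (.ite (keepCond φ) (.const 1) (.const 0))).exec J.input V' A' aAlive s' h' ≠ 0 ∧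
          Compatible N K A s h s' h') ↔ ∀ s' ≤ N, s < s' → ∃ h' < H, A' aAlive s' h' ≠ 0 ∧
          Compatible N K A s h s' h' :=
      forall₂_congr fun s' hs' => imp_congr_right fun hlt => by rw [hlater s' hs' hlt]
    rw [e]
    by_cases hsi' : s = N - i
    · subst hsi'
      rw [hrow.1 h hh]
      simp
    · rw [hrow.2.2 s hsi']
      exact h2 s hsN (by omega) h hh

lemma holds_allAlive (hV : Params V L N k m K H) :
    allAlive.Holds I V A ↔ ∀ s ≤ N, ∃ h < H, A aAlive s h ≠ 0 := by
  simp [allAlive, hV.eqNs, hV.eqH]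

end Stm

/-! ### Correctness of the dynamic program -/

/-- Every clique lies in one of the bags: the bag in which its last vertex appears. -/
lemma BagSequence.exists_clique_subset {N : ℕ} {adj : ℕ → ℕ → Prop} {K s : ℕ}
    {bag : ℕ → Finset ℕ} (h : BagSequence N adj K (s + 1) bag)
    (hcover : ∀ v < N, ∃ i < s + 1, v ∈ bag i) {C : Finset ℕ} (hC : ∀ v ∈ C, v < N)
    (hadj : ∀ u ∈ C, ∀ v ∈ C, u ≠ v → adj u v) : ∃ i < s + 1, C ⊆ bag i := by
  classical
  rcases C.eq_empty_or_nonempty with rfl | hne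
  · exact ⟨0, by omega, by simp⟩
  have hfirst : ∀ v : ℕ, ∃ i, v ∈ C → i < s + 1 ∧ v ∈ bag i ∧ ∀ j < i, v ∉ bag j := by
    intro v
    by_cases hv : v ∈ C
    · have hex := hcover v (hC v hv)
      exact ⟨Nat.find hex, fun _ => ⟨(Nat.find_spec hex).1, (Nat.find_spec hex).2,
        fun j hj hj' => Nat.find_min hex hj ⟨hj.trans (Nat.find_spec hex).1, hj'⟩⟩⟩
    · exact ⟨0, fun h => absurd h hv⟩
  choose first hfirst using hfirst
  obtain ⟨v, hv, hmax⟩ := C.exists_max_image first hne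
  obtain ⟨h1, h2, h3⟩ := hfirst v hv
  refine ⟨first v, h1, fun u hu => ?_⟩
  obtain ⟨h4, h5, h6⟩ := hfirst u hu
  rcases (hmax u hu).lt_or_eq with hlt | heq
  · refine h.edge _ h1 v h2 (by simpa using fun j hj => h3 j hj) u ?_ (hadj v hv u hu ?_)
    · exact Finset.mem_biUnion.2 ⟨_, Finset.mem_range.2 hlt, h5⟩
    · rintro rfl
      exact hlt.ne rfl
  · rwa [← heq]

/-- A rational function that orders a finite set as `p` does can be changed outside this set so
that it orders a larger finite set as `p` does. -/
lemma exists_extend_order {S : Finset ℕ} {p : ℕ → ℕ} {g : ℕ → ℚ}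
    (h : ∀ u ∈ S, ∀ v ∈ S, g u < g v ↔ p u < p v) (B : Finset ℕ) :
    ∃ g' : ℕ → ℚ, (∀ u ∈ S, g' u = g u) ∧
      ∀ u ∈ S ∪ B, ∀ v ∈ S ∪ B, g' u < g' v ↔ p u < p v := by
  classical
  induction B using Finset.induction_on with
  | empty => exact ⟨g, fun _ _ => rfl, by simpa using h⟩
  | insert b B _ ih =>
    obtain ⟨g', h1, h2⟩ := ih
    have hU : S ∪ insert b B = insert b (S ∪ B) := by simp
    rw [hU]
    set U := S ∪ B with hUdef
    by_cases hb : b ∈ U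
    · rw [Finset.insert_eq_of_mem hb]
      exact ⟨g', h1, h2⟩
    obtain ⟨x, hlo, hhi⟩ : ∃ x : ℚ, (∀ u ∈ U, g' u < x ↔ p u < p b) ∧
        ∀ u ∈ U, x < g' u ↔ p b < p u := by
      by_cases hex : ∃ w ∈ U, p w = p b
      · obtain ⟨w, hw, hwb⟩ := hex
        rw [← hwb]
        exact ⟨g' w, fun u hu => h2 u hu w hw, fun u hu => h2 w hw u hu⟩
      · push Not at hex
        obtain ⟨x, hx1, hx2⟩ := Order.exists_between_finsets
          ((U.filter fun u => p u < p b).image g') ((U.filter fun u => p b < p u).image g') (by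
            simp only [Finset.mem_image, Finset.mem_filter]
            rintro _ ⟨u, ⟨hu, hu'⟩, rfl⟩ _ ⟨v, ⟨hv, hv'⟩, rfl⟩
            exact (h2 u hu v hv).2 (hu'.trans hv'))
        have hx1' : ∀ u ∈ U, p u < p b → g' u < x := fun u hu h =>
          hx1 _ (Finset.mem_image_of_mem _ (Finset.mem_filter.2 ⟨hu, h⟩))
        have hx2' : ∀ u ∈ U, p b < p u → x < g' u := fun u hu h =>
          hx2 _ (Finset.mem_image_of_mem _ (Finset.mem_filter.2 ⟨hu, h⟩))
        refine ⟨x, fun u hu => ⟨fun h => ?_, hx1' u hu⟩, fun u hu => ⟨fun h => ?_, hx2' u hu⟩⟩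
        · rcases (hex u hu).lt_or_gt with h' | h'
          · exact h'
          · exact absurd (hx2' u hu h') h.not_gt
        · rcases (hex u hu).lt_or_gt with h' | h'
          · exact absurd (hx1' u hu h') h.not_gt
          · exact h'
    have hne : ∀ u ∈ U, u ≠ b := fun u hu hub => hb (hub ▸ hu)
    refine ⟨Function.update g' b x, fun u hu => ?_, fun u hu v hv => ?_⟩
    · rw [Function.update_of_ne (hne u (Finset.mem_union_left _ hu)), h1 u hu]
    · rcases Finset.mem_insert.1 hu with rfl | hu' <;>
        rcases Finset.mem_insert.1 hv with rfl | hv'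
      · simp
      · rw [Function.update_self, Function.update_of_ne (hne v hv'), hhi v hv']
      · rw [Function.update_self, Function.update_of_ne (hne u hu'), hlo u hu']
      · rw [Function.update_of_ne (hne v hv'), Function.update_of_ne (hne u hu'), h2 u hu' v hv']

/-- If each bag has a valuation that is kept, and each kept valuation has compatible kept
valuations in the later bags, then there is a rational function that orders each bag as some kept
valuation does. It is defined bag by bag. -/
lemma BagSequence.exists_order {N : ℕ} {adj : ℕ → ℕ → Prop} {K s H : ℕ} {bag : ℕ → Finset ℕ}
    (hbag : BagSequence N adj K s bag) {alive : ℕ → ℕ → Prop} {val : ℕ → ℕ → ℕ → ℕ}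
    (halive : ∀ i < s, ∃ h < H, alive i h)
    (hext : ∀ i < s, ∀ j < i, ∀ h < H, alive j h → ∃ h' < H, alive i h' ∧
      ∀ u ∈ bag j ∩ bag i, ∀ v ∈ bag j ∩ bag i, val j h u < val j h v ↔ val i h' u < val i h' v) :
    ∃ g : ℕ → ℚ, ∀ i < s, ∃ h < H, alive i h ∧
      ∀ u ∈ bag i, ∀ v ∈ bag i, g u < g v ↔ val i h u < val i h v := by
  suffices ∀ t ≤ s, ∃ g : ℕ → ℚ, ∀ i < t, ∃ h < H, alive i h ∧
      ∀ u ∈ bag i, ∀ v ∈ bag i, g u < g v ↔ val i h u < val i h v from this s le_rfl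
  intro t
  induction t with
  | zero => exact fun _ => ⟨fun _ => 0, fun i hi => by omega⟩
  | succ t ih =>
    intro hts
    obtain ⟨g, hg⟩ := ih (by omega)
    set D := (Finset.range t).biUnion bag with hD
    obtain ⟨h', hh', h1, h2⟩ : ∃ h' < H, alive t h' ∧
        ∀ u ∈ bag t ∩ D, ∀ v ∈ bag t ∩ D, g u < g v ↔ val t h' u < val t h' v := by
      rcases hbag.old t hts with h | ⟨j, hj, hsub⟩
      · obtain ⟨h', hh', h1⟩ := halive t hts
        exact ⟨h', hh', h1, by simp [hD, h]⟩
      · obtain ⟨h, hh, h3, h4⟩ := hg j hj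
        obtain ⟨h', hh', h5, h6⟩ := hext t hts j hj h hh h3
        refine ⟨h', hh', h5, fun u hu v hv => ?_⟩
        have hmem : ∀ u ∈ bag t ∩ D, u ∈ bag j ∩ bag t := fun u hu =>
          Finset.mem_inter.2 ⟨hsub hu, (Finset.mem_inter.1 hu).1⟩
        rw [h4 u (hsub hu) v (hsub hv), h6 u (hmem u hu) v (hmem v hv)]
    obtain ⟨g', h3, h4⟩ := exists_extend_order h2 (bag t)
    -- The values on the old vertices stay, those on the new ones come from the extension.
    refine ⟨fun u => if u ∈ D then g u else g' u, fun i hi => ?_⟩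
    rcases Nat.lt_succ_iff_lt_or_eq.1 hi with hi | rfl
    · obtain ⟨h, hh, h5, h6⟩ := hg i hi
      have hmem : ∀ u ∈ bag i, u ∈ D := fun u hu =>
        Finset.mem_biUnion.2 ⟨i, Finset.mem_range.2 hi, hu⟩
      refine ⟨h, hh, h5, fun u hu v hv => ?_⟩
      dsimp only
      rw [if_pos (hmem u hu), if_pos (hmem v hv), h6 u hu v hv]
    · refine ⟨h', hh', h1, fun u hu v hv => ?_⟩
      have e : ∀ u ∈ bag i, (if u ∈ D then g u else g' u) = g' u := by
        intro u hu
        split_ifs with hu'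
        · exact (h3 u (Finset.mem_inter.2 ⟨hu, hu'⟩)).symm
        · rfl
      dsimp only
      rw [e u hu, e v hv, h4 u (Finset.mem_union_right _ hu) v (Finset.mem_union_right _ hv)]

namespace Stm

variable {Γ : ConstraintLanguage ℚ} {φ : ∀ i, QFFormula rationalOrder (Γ.arity i)}
  {J : CSPInstance Γ} {A : Arrays} {N K H : ℕ}

/-- Every order on a bag is induced by one of the valuations: number the elements by the sizes of
their initial segments. -/
lemma exists_valuation (hdig : DigitsComplete K H (A aDig)) (hK : 0 < K) {s : ℕ}
    (hcard : (storedBag N A s).card ≤ K) (hs : s ≤ N) (f : ℕ → ℚ) :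
    ∃ h < H, ∀ u ∈ storedBag N A s, ∀ v ∈ storedBag N A s,
      valuation K A s h u < valuation K A s h v ↔ f u < f v := by
  classical
  set B := storedBag N A s with hB
  have hmem : ∀ u, u ∈ B ↔ u < N ∧ A aBag s u ≠ 0 := by
    intro u
    rw [hB, storedBag, if_pos hs, mem_support]
  let pos : ℕ → ℕ := fun u => ((Finset.range u).filter fun v => A aBag s v ≠ 0).card
  have hmono : ∀ u ∈ B, ∀ v ∈ B, u < v → pos u < pos v := by
    intro u hu v hv h
    refine Finset.card_lt_card (Finset.ssubset_iff_of_subset (fun w hw => ?_) |>.2 ⟨u, ?_, ?_⟩)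
    · simp only [Finset.mem_filter, Finset.mem_range] at hw ⊢
      exact ⟨by omega, hw.2⟩
    · simp [h, ((hmem u).1 hu).2]
    · simp
  have hinj : ∀ u ∈ B, ∀ v ∈ B, pos u = pos v → u = v := by
    intro u hu v hv h
    rcases lt_trichotomy u v with h' | h' | h'
    · exact absurd h (hmono u hu v hv h').ne
    · exact h'
    · exact absurd h (hmono v hv u hu h').ne'
  have hpos : ∀ u ∈ B, pos u < K := by
    intro u hu
    refine lt_of_lt_of_le (Finset.card_lt_card (Finset.ssubset_iff_of_subset (fun w hw => ?_)
      |>.2 ⟨u, hu, by simp⟩)) hcard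
    simp only [Finset.mem_filter, Finset.mem_range] at hw
    exact (hmem w).2 ⟨hw.1.trans ((hmem u).1 hu).1, hw.2⟩
  -- The ranks are below `K`, so they are the digits of a code.
  let rank : ℕ → ℕ := fun u => (B.filter fun v => f v < f u).card
  have hrank : ∀ u ∈ B, rank u < K := fun u hu =>
    lt_of_lt_of_le (Finset.card_lt_card (Finset.filter_ssubset.2 ⟨u, hu, lt_irrefl _⟩)) hcard
  obtain ⟨h, hh, h1⟩ := hdig (fun z => if hz : ∃ u ∈ B, pos u = z then rank hz.choose else 0) (by
    intro z
    split_ifs with hz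
    · exact hrank _ hz.choose_spec.1
    · exact hK)
  have hval : ∀ u ∈ B, valuation K A s h u = rank u := by
    intro u hu
    have hz : ∃ v ∈ B, pos v = pos u := ⟨u, hu, rfl⟩
    have := h1 (pos u) (hpos u hu)
    rw [dif_pos hz, hinj _ hz.choose_spec.1 u hu hz.choose_spec.2] at this
    rw [valuation, min_eq_left (hpos u hu).le]
    exact this
  refine ⟨h, hh, fun u hu v hv => ?_⟩
  rw [hval u hu, hval v hv]
  constructor
  · intro hlt
    by_contra! hle
    refine hlt.not_ge (Finset.card_le_card fun w hw => ?_)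
    rw [Finset.mem_filter] at hw ⊢
    exact ⟨hw.1, hw.2.trans_le hle⟩
  · intro hlt
    refine Finset.card_lt_card (Finset.ssubset_iff_of_subset (fun w hw => ?_) |>.2 ⟨u, ?_, ?_⟩)
    · rw [Finset.mem_filter] at hw ⊢
      exact ⟨hw.1, hw.2.trans hlt⟩
    · simp [hu, hlt]
    · simp

/-- If each bag has a kept valuation, the values given by `BagSequence.exists_order` satisfy each
constraint, because its scope is a clique of the primal graph, so lies in a bag, and because its
relation only depends on the order of the entries. Conversely, the valuations that a solution
induces on the bags are all kept. -/
lemma satisfiable_iff (hφ : ∀ i t, t ∈ Γ.rel i ↔ (φ i).Holds t)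
    {adj : ℕ → ℕ → Prop} (hadj : ∀ u v : Fin J.numVars, J.primalGraph.Adj u v → adj u v)
    (hbag : BagSequence J.numVars adj K (J.numVars + 1) (storedBag J.numVars A))
    (hcover : ∀ v < J.numVars, ∃ i < J.numVars + 1, v ∈ storedBag J.numVars A i)
    (hdig : DigitsComplete K H (A aDig)) (hK : 0 < K) {alive : ℕ → ℕ → Prop}
    (halive : ∀ s ≤ J.numVars, ∀ h < H, alive s h ↔ Satisfies φ J K A s h ∧
      ∀ s' ≤ J.numVars, s < s' → ∃ h' < H, alive s' h' ∧ Compatible J.numVars K A s h s' h') :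
    (∀ s ≤ J.numVars, ∃ h < H, alive s h) ↔ J.Satisfiable := by
  classical
  set N := J.numVars with hN
  constructor
  · intro hall
    obtain ⟨g, hg⟩ := hbag.exists_order (alive := alive) (val := valuation K A) (H := H)
      (fun i hi => hall i (by omega)) (fun i hi j hj h hh hjh =>
        ((halive j (by omega) h hh).1 hjh).2 i (by omega) hj)
    refine ⟨fun u => g u, fun c hc => ?_⟩
    obtain ⟨i, hi, hsub⟩ := hbag.exists_clique_subset hcover
      (C := Finset.univ.image fun j => (c.scope j : ℕ)) (by
        simp only [Finset.mem_image, Finset.mem_univ, true_and]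
        rintro _ ⟨j, rfl⟩
        exact (c.scope j).2) (by
        simp only [Finset.mem_image, Finset.mem_univ, true_and]
        rintro _ ⟨j, rfl⟩ _ ⟨j', rfl⟩ hne
        exact hadj _ _ ⟨fun h => hne (congrArg Fin.val h), c, hc, ⟨j, rfl⟩, j', rfl⟩)
    have hmem : ∀ j, (c.scope j : ℕ) ∈ storedBag N A i := fun j =>
      hsub (Finset.mem_image_of_mem _ (Finset.mem_univ j))
    obtain ⟨h, hh, h1, h2⟩ := hg i hi
    have h3 := ((halive i (by omega) h hh).1 h1).1 c hc hmem
    rw [hφ]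
    refine ((φ c.symbol).holds_congr fun a b => ?_).1 h3
    rw [Nat.cast_lt, h2 _ (hmem a) _ (hmem b)]
  · rintro ⟨f, hf⟩
    let f' : ℕ → ℚ := fun u => if hu : u < N then f ⟨u, hu⟩ else 0
    have hf' : ∀ u : Fin N, f' u = f u := fun u => by simp [f']
    have hval : ∀ s, ∃ h, s ≤ N → h < H ∧ ∀ u ∈ storedBag N A s, ∀ v ∈ storedBag N A s,
        valuation K A s h u < valuation K A s h v ↔ f' u < f' v := by
      intro s
      by_cases hs : s ≤ N
      · obtain ⟨h, hh, h1⟩ := exists_valuation hdig hK (hbag.card s) hs f'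
        exact ⟨h, fun _ => ⟨hh, h1⟩⟩
      · exact ⟨0, fun h => absurd h hs⟩
    choose code hcode using hval
    have hsat : ∀ s ≤ N, Satisfies φ J K A s (code s) := by
      intro s hs c hc hmem
      refine ((φ c.symbol).holds_congr fun a b => ?_).1 ((hφ _ _).1 (hf c hc))
      rw [Nat.cast_lt, (hcode s hs).2 _ (hmem a) _ (hmem b), hf', hf']
    have key : ∀ t s, s ≤ N → N ≤ s + t → alive s (code s) := by
      intro t
      induction t with
      | zero =>
        intro s hs hst
        rw [halive s hs _ (hcode s hs).1]
        exact ⟨hsat s hs, fun s' hs' hlt => by omega⟩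
      | succ t ih =>
        intro s hs hst
        rw [halive s hs _ (hcode s hs).1]
        refine ⟨hsat s hs, fun s' hs' hlt => ?_⟩
        refine ⟨code s', (hcode s' hs').1, ih s' hs' (by omega), fun u hu v hv => ?_⟩
        rw [Finset.mem_inter] at hu hv
        rw [(hcode s hs).2 u hu.1 v hv.1, (hcode s' hs').2 u hu.2 v hv.2]
    exact fun s hs => ⟨code s, (hcode s hs).1, key N s hs (by omega)⟩

end Stm

/-! ### Graphs of small treewidth can be split -/

/-- The sets of ancestors in a rooted tree: an edge joins a vertex to its unique parent, and every
vertex except the root has a parent. -/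
structure AncestorSets {n : ℕ} (G : SimpleGraph (Fin n)) (r : Fin n)
    (anc : Fin n → Finset (Fin n)) : Prop where
  self_mem : ∀ x, x ∈ anc x
  root_mem : ∀ x, r ∈ anc x
  root : anc r = {r}
  adj : ∀ a b, G.Adj a b → (b ∉ anc a ∧ anc b = insert b (anc a)) ∨
    (a ∉ anc b ∧ anc a = insert a (anc b))
  parent : ∀ x, x ≠ r → ∃ b, x ∉ anc b ∧ anc x = insert x (anc b)
  inj : Function.Injective anc

/-- The ancestors of a vertex are the vertices of the path from the root to it. -/
lemma SimpleGraph.IsTree.exists_ancestorSets {n : ℕ} {G : SimpleGraph (Fin n)} (hG : G.IsTree)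
    (r : Fin n) : ∃ anc, AncestorSets G r anc := by
  choose P hP using fun x => (hG.existsUnique_path r x).exists
  have huniq : ∀ {x} (p : G.Walk r x), p.IsPath → p = P x := fun p hp =>
    (hG.existsUnique_path r _).unique hp (hP _)
  have hconcat : ∀ a b, G.Adj a b → a ∈ (P b).support → b ∉ (P a).support ∧
      (P b).support.toFinset = insert b (P a).support.toFinset := by
    intro a b hab ha
    refine ⟨hG.isAcyclic.ne_mem_support_of_support_of_adj_of_isPath (hP b) (hP a) hab.symm ha, ?_⟩
    rw [hG.isAcyclic.path_concat (hP a) (hP b) hab ha, SimpleGraph.Walk.support_concat]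
    ext x
    simp
  have hcard : ∀ x, (P x).support.toFinset.card = (P x).length + 1 := fun x => by
    rw [List.toFinset_card_of_nodup (hP x).support_nodup, SimpleGraph.Walk.length_support]
  refine ⟨fun x => (P x).support.toFinset, by simp, by simp, ?_, fun a b hab => ?_,
    fun x hx => ?_, fun x y hxy => ?_⟩
  · rw [← huniq SimpleGraph.Walk.nil (by simp)]
    simp
  · by_cases hb : b ∈ (P a).support
    · exact Or.inr (by simpa using hconcat b a hab.symm hb)
    · have ha : a ∈ (P b).support :=
        hG.isAcyclic.mem_support_of_ne_mem_support_of_adj_of_isPath (hP b) (hP a) hab.symm hb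
      exact Or.inl (by simpa using hconcat a b hab ha)
  · have hnil : ¬ (P x).Nil := fun h => hx h.eq.symm
    refine ⟨(P x).penultimate, ?_⟩
    simpa using hconcat _ x ((P x).adj_penultimate hnil) ((P x).getVert_mem_support _)
  · have hx : x ∈ (P y).support := by
      have : x ∈ (P x).support.toFinset := by simp
      simpa [show (P x).support.toFinset = _ from hxy] using this
    have h1 := huniq _ ((hP y).takeUntil hx)
    by_contra hne
    have h2 := SimpleGraph.Walk.length_takeUntil_lt_length hx hne
    have h3 := congrArg Finset.card hxy
    simp only [hcard] at h3
    rw [h1] at h2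
    omega

namespace AncestorSets

variable {n : ℕ} {G : SimpleGraph (Fin n)} {r : Fin n} {anc : Fin n → Finset (Fin n)}

/-- A proper descendant of `t` is a descendant of a child of `t`. -/
lemma exists_child (h : AncestorSets G r anc) {t x : Fin n} (htx : t ∈ anc x) (hne : x ≠ t) :
    ∃ c, c ∉ anc t ∧ anc c = insert c (anc t) ∧ c ∈ anc x := by
  induction hs : (anc x).card using Nat.strong_induction_on generalizing x with
  | _ s ih =>
    have hxr : x ≠ r := by
      rintro rfl
      rw [h.root, Finset.mem_singleton] at htx
      exact hne htx.symm
    obtain ⟨b, hb1, hb2⟩ := h.parent x hxr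
    rw [hb2, Finset.mem_insert] at htx
    have htb := htx.resolve_left hne.symm
    by_cases hbt : b = t
    · subst hbt
      exact ⟨x, hb1, hb2, h.self_mem x⟩
    · obtain ⟨c, hc1, hc2, hc3⟩ := ih _ (by rw [← hs, hb2, Finset.card_insert_of_notMem hb1]; omega)
        htb hbt rfl
      exact ⟨c, hc1, hc2, by rw [hb2]; exact Finset.mem_insert_of_mem hc3⟩

/-- A walk that leaves the subtree of a child of `t` passes through `t`. -/
lemma mem_support (h : AncestorSets G r anc) {t c x y : Fin n} (hc : c ∉ anc t)
    (hc' : anc c = insert c (anc t)) (hx : c ∈ anc x) (hy : c ∉ anc y) (p : G.Walk x y) :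
    t ∈ p.support := by
  obtain ⟨d, hd, h1, h2⟩ := p.exists_boundary_dart {z | c ∈ anc z} hx hy
  simp only [Set.mem_ofPred_eq] at h1 h2
  have hd' : d.snd ∈ p.support := p.dart_snd_mem_support_of_mem_darts hd
  rcases h.adj d.fst d.snd d.adj with ⟨_, h3⟩ | ⟨h3, h4⟩
  · exact absurd (by rw [h3]; exact Finset.mem_insert_of_mem h1) h2
  · rw [h4, Finset.mem_insert] at h1
    have hcd := h1.resolve_right h2
    rw [← hcd] at h3 h4
    have : anc d.snd = anc t := by
      rw [← Finset.erase_insert h3, ← h4, hc', Finset.erase_insert hc]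
    rwa [← h.inj this]

end AncestorSets

/-- If `f` grows by at most `b` with each new element, it cannot jump from `a` or less over all of
`a + 1, …, a + b`. -/
lemma Finset.exists_subset_between {α : Type*} [DecidableEq α] (f : Finset α → ℕ) (a b : ℕ)
    (h0 : f ∅ = 0) (C : Finset α) (hstep : ∀ c ∈ C, ∀ F, f (insert c F) ≤ f F + b)
    (hC : a < f C) : ∃ F ⊆ C, a < f F ∧ f F ≤ a + b := by
  induction C using Finset.induction_on with
  | empty => omega
  | insert c C _ ih =>
    by_cases h : a < f C
    · obtain ⟨F, h1, h2⟩ := ih (fun c hc => hstep c (Finset.mem_insert_of_mem hc)) h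
      exact ⟨F, h1.trans (Finset.subset_insert _ _), h2⟩
    · have := hstep c (Finset.mem_insert_self _ _) C
      exact ⟨_, subset_rfl, hC, by omega⟩

namespace TreeDecomposition

/-- If all bags have at most `k` vertices, every set of more than `5k` vertices is split by a bag:
the bag of a deepest node whose subtree contains more than `2k` of the vertices. -/
lemma exists_split {V : Type} [Fintype V] [DecidableEq V] {G : SimpleGraph V}
    (T : TreeDecomposition G) {k : ℕ} (hT : ∀ t, (T.bag t).card ≤ k) {W : Finset V}
    (hW : 5 * k + 1 ≤ W.card) :
    ∃ X R : Finset V, X.card ≤ k ∧ k < (W ∩ R).card ∧ k < (W \ (X ∪ R)).card ∧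
      ∀ u ∈ R, ∀ v, G.Adj u v → v ∈ R ∪ X := by
  classical
  obtain ⟨r⟩ := T.isTree.connected.nonempty
  obtain ⟨anc, hanc⟩ := T.isTree.exists_ancestorSets r
  -- The vertices in the bags of the subtree with root `t`.
  let below : Fin T.numNodes → Finset V := fun t =>
    (Finset.univ.filter fun x => t ∈ anc x).biUnion T.bag
  have hbelow : ∀ t v, v ∈ below t ↔ ∃ x, t ∈ anc x ∧ v ∈ T.bag x := by simp [below]
  have hroot : below r = Finset.univ := by
    ext v
    obtain ⟨t, ht⟩ := T.vertex_mem v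
    simp only [hbelow, Finset.mem_univ, iff_true]
    exact ⟨t, hanc.root_mem t, ht⟩
  obtain ⟨t, ht, hmax⟩ := (Finset.univ.filter fun t => 2 * k < (W ∩ below t).card).exists_max_image
    (fun t => (anc t).card) ⟨r, by simp [hroot]; omega⟩
  simp only [Finset.mem_filter, Finset.mem_univ, true_and] at ht hmax
  set C := Finset.univ.filter fun c => c ∉ anc t ∧ anc c = insert c (anc t) with hC
  have hCsmall : ∀ c ∈ C, (W ∩ below c).card ≤ 2 * k := by
    intro c hc
    simp only [hC, Finset.mem_filter, Finset.mem_univ, true_and] at hc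
    by_contra! hlt
    have := hmax c hlt
    rw [hc.2, Finset.card_insert_of_notMem hc.1] at this
    omega
  let R : Finset (Fin T.numNodes) → Finset V := fun F => F.biUnion below \ T.bag t
  obtain ⟨F, hFC, hF1, hF2⟩ := Finset.exists_subset_between (fun F => (W ∩ R F).card) k (2 * k)
    (by simp [R]) C (fun c hc F => by
      have hsub : W ∩ R (insert c F) ⊆ (W ∩ R F) ∪ (W ∩ below c) := by
        intro v hv
        simp only [R, Finset.mem_inter, Finset.mem_sdiff, Finset.biUnion_insert,
          Finset.mem_union] at hv ⊢
        tauto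
      have h1 := (Finset.card_le_card hsub).trans (Finset.card_union_le _ _)
      have h2 := hCsmall c hc
      omega) (by
      have hsub : W ∩ below t ⊆ (W ∩ R C) ∪ T.bag t := by
        intro v hv
        obtain ⟨hvW, hv⟩ := Finset.mem_inter.1 hv
        obtain ⟨x, hx, hvx⟩ := (hbelow t v).1 hv
        by_cases hvt : v ∈ T.bag t
        · exact Finset.mem_union_right _ hvt
        · have hxt : x ≠ t := by rintro rfl; exact hvt hvx
          obtain ⟨c, hc1, hc2, hc3⟩ := hanc.exists_child hx hxt
          refine Finset.mem_union_left _ (Finset.mem_inter.2 ⟨hvW, Finset.mem_sdiff.2 ⟨?_, hvt⟩⟩)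
          exact Finset.mem_biUnion.2 ⟨c, by simp [hC, hc1, hc2], (hbelow c v).2 ⟨x, hc3, hvx⟩⟩
      have h1 := (Finset.card_le_card hsub).trans (Finset.card_union_le _ _)
      have h2 := hT t
      omega)
  refine ⟨T.bag t, R F, hT t, hF1, ?_, fun u hu v huv => ?_⟩
  · have hsub : W ⊆ (W \ (T.bag t ∪ R F)) ∪ ((W ∩ R F) ∪ T.bag t) := by
      intro v hv
      simp only [Finset.mem_union, Finset.mem_sdiff, Finset.mem_inter]
      tauto
    have h1 := (Finset.card_le_card hsub).trans (Finset.card_union_le _ _)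
    have h2 := Finset.card_union_le (W ∩ R F) (T.bag t)
    have h3 := hT t
    omega
  · obtain ⟨hu1, hu2⟩ := Finset.mem_sdiff.1 hu
    obtain ⟨c, hcF, huc⟩ := Finset.mem_biUnion.1 hu1
    obtain ⟨x, hx, hux⟩ := (hbelow c u).1 huc
    have hc := hFC hcF
    simp only [hC, Finset.mem_filter, Finset.mem_univ, true_and] at hc
    obtain ⟨y, huy, hvy⟩ := T.edge_mem u v huv
    have hy : c ∈ anc y := by
      by_contra hy
      obtain ⟨p, hp, _⟩ := T.isTree.existsUnique_path x y
      exact hu2 (T.bag_inter x t y p hp (hanc.mem_support hc.1 hc.2 hx hy p)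
        (Finset.mem_inter.2 ⟨hux, huy⟩))
    by_cases hvt : v ∈ T.bag t
    · exact Finset.mem_union_right _ hvt
    · exact Finset.mem_union_left _ (Finset.mem_sdiff.2
        ⟨Finset.mem_biUnion.2 ⟨c, hcF, (hbelow c v).2 ⟨y, hy, hvy⟩⟩, hvt⟩)

end TreeDecomposition

lemma exists_treeDecomposition {V : Type} [Fintype V] [DecidableEq V] (G : SimpleGraph V) :
    ∃ T : TreeDecomposition G, ∀ t, (T.bag t).card ≤ treewidth G + 1 := by
  refine Nat.sInf_mem (s := {w : ℕ | ∃ T : TreeDecomposition G, ∀ t, (T.bag t).card ≤ w + 1})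
    ⟨Fintype.card V, ⟨1, ⊥, .of_subsingleton, fun _ => Finset.univ, by simp, by simp, by simp⟩,
      fun _ => ?_⟩
  simp [Finset.card_univ]

/-- In a graph of treewidth less than `k`, every set of at least `5 * k + 1` vertices can be split,
so the construction of the bags does not fail. -/
lemma not_unsplittable {N : ℕ} {G : SimpleGraph (Fin N)} {adj : ℕ → ℕ → Prop}
    (hadj : ∀ u v : Fin N, adj u v ↔ G.Adj u v) {k : ℕ} (hk : treewidth G + 1 ≤ k) :
    ¬ Stm.Unsplittable N adj k (5 * k + 1) := by
  rintro ⟨W, hWN, hW, hno⟩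
  obtain ⟨T, hT⟩ := exists_treeDecomposition G
  let W' : Finset (Fin N) := Finset.univ.filter fun u => (u : ℕ) ∈ W
  have hW' : W'.map Fin.valEmbedding = W := by
    ext u
    simp only [W', Finset.mem_map, Finset.mem_filter, Finset.mem_univ, true_and,
      Fin.valEmbedding_apply]
    exact ⟨by rintro ⟨u, hu, rfl⟩; exact hu,
      fun hu => ⟨⟨u, Finset.mem_range.1 (hWN hu)⟩, hu, rfl⟩⟩
  obtain ⟨X, R, h1, h2, h3, h4⟩ := T.exists_split (fun t => (hT t).trans hk) (W := W')
    (by rw [← Finset.card_map Fin.valEmbedding, hW']; exact hW)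
  have hWs : ∀ S ⊆ W', S.map Fin.valEmbedding ⊆ W := fun S hS => by
    rw [← hW']
    exact Finset.map_subset_map.2 hS
  have hdisj : Disjoint (W' \ (X ∪ R)) R :=
    Finset.disjoint_of_subset_right Finset.subset_union_right Finset.sdiff_disjoint
  refine hno ⟨X.map Fin.valEmbedding, (W' ∩ R).map Fin.valEmbedding,
    (W' \ (X ∪ R)).map Fin.valEmbedding, R.map Fin.valEmbedding, ?_, by simpa,
    hWs _ Finset.inter_subset_left, hWs _ Finset.sdiff_subset, by simpa, by simpa, ?_, ?_, ?_⟩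
  · rw [Finset.disjoint_map]
    exact (Finset.disjoint_of_subset_right Finset.inter_subset_right hdisj).symm
  · exact (Finset.map_subset_map.2 Finset.inter_subset_right).trans Finset.subset_union_left
  · rwa [Finset.disjoint_map]
  · intro u hu v hv huv
    obtain ⟨u, huR, rfl⟩ := Finset.mem_map.1 hu
    rw [← Finset.map_union]
    exact Finset.mem_map.2 ⟨⟨v, hv⟩, h4 u huR ⟨v, hv⟩ ((hadj u ⟨v, hv⟩).1 huv), rfl⟩

/-! ### The program -/

namespace Stm

/-- Computes `K ^ K` in a cell of an array. -/
def power : Stm :=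
  (store aQ vO vO (.const 1)).seq <|
  .loop xx vK <| store aQ vO vO (.sum xy vK (.get aQ vO vO))

lemma exec_power {I V : ℕ → ℕ} {A : Arrays} (hO : V vO = 0) :
    power.exec I V A aQ 0 0 = V vK ^ V vK := by
  have := loop_induct (I := I) (V := V) (A := A.set aQ 0 0 1) (x := xx) (y := vK)
    (p := store aQ vO vO (.sum xy vK (.get aQ vO vO))) (P := fun i A' => A' aQ 0 0 = V vK ^ i)
    (by simp [Arrays.set]) (fun i A' _ h => by simp [Arrays.set, hO, h, pow_succ, mul_comm])
  simpa [power, hO] using this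

/-- One round of the algorithm: for a fixed bound on the treewidth, it looks for a decomposition
and determines which valuations of its bags are kept. -/
def round {Γ : ConstraintLanguage ℚ} (φ : ∀ i, QFFormula rationalOrder (Γ.arity i)) : Stm :=
  (starts Γ).seq <| (adjacency Γ).seq <| digits.seq <| decompose.seq <| filterValuations φ

/-- A round that finds a decomposition decides satisfiability, and it finds one if the treewidth is
below `k`. The bags have at most `(5 * k + 1) + 1 + k` elements: border, new vertex and cut. -/
lemma exec_round {Γ : ConstraintLanguage ℚ} {φ : ∀ i, QFFormula rationalOrder (Γ.arity i)}
    (hφ : ∀ i t, t ∈ Γ.rel i ↔ (φ i).Holds t) {J : CSPInstance Γ} {V : ℕ → ℕ} {A : Arrays}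
    {k K : ℕ} (hk : 1 ≤ k) (hK : K = 6 * k + 2)
    (hV : Params V J.encode.length J.numVars k (5 * k + 1) K (K ^ K)) :
    ((round φ).exec J.input V A aFail 0 0 = 0 →
      (allAlive.Holds J.input V ((round φ).exec J.input V A) ↔ J.Satisfiable)) ∧
    (treewidth J.primalGraph + 1 ≤ k → (round φ).exec J.input V A aFail 0 0 = 0) := by
  simp only [round, exec_seq]
  have hstart := exec_starts (A := A) hV
  generalize (starts Γ).exec J.input V A = A₁ at hstart
  have hadj := exec_adjacency (A := A₁) hV hstart
  have hstart₂ : (adjacency Γ).exec J.input V A₁ aStart = A₁ aStart :=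
    exec_of_not_writes (by simp [adjacency])
  generalize (adjacency Γ).exec J.input V A₁ = A₂ at hadj hstart₂
  have hdig := exec_digits (I := J.input) (A := A₂) hV (by omega)
  have hfr₃ : ∀ b, b ≠ aQ → b ≠ aDig → digits.exec J.input V A₂ b = A₂ b := fun b h1 h2 =>
    exec_of_not_writes (by simp [digits, Writes, h1, h2])
  generalize digits.exec J.input V A₂ = A₃ at hdig hfr₃
  have hadj₃ : ∀ u v : Fin J.numVars, A₃ aAdj u v ≠ 0 ↔ J.primalGraph.Adj u v := fun u v => by
    rw [hfr₃ _ (by decide) (by decide), hadj]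
  have hdec := exec_decompose (I := J.input) (A := A₃) hV hdig (by omega) (by omega)
    (fun u hu v hv h => (hadj₃ ⟨v, hv⟩ ⟨u, hu⟩).2 ((hadj₃ ⟨u, hu⟩ ⟨v, hv⟩).1 h).symm)
  have hdig₄ : decompose.exec J.input V A₃ aDig = A₃ aDig :=
    exec_decompose_of_ne (by decide)
  have hstart₄ : decompose.exec J.input V A₃ aStart = A₁ aStart := by
    rw [exec_decompose_of_ne (by decide), hfr₃ _ (by decide) (by decide), hstart₂]
  generalize decompose.exec J.input V A₃ = A₄ at hdec hdig₄ hstart₄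
  have hkeep := exec_filterValuations φ (A := A₄) hV (by rw [hstart₄]; exact hstart)
  have hfail : (filterValuations φ).exec J.input V A₄ aFail = A₄ aFail :=
    exec_of_not_writes (by simp [filterValuations, Writes])
  rw [hfail]
  refine ⟨fun h0 => ?_, fun htw => ?_⟩
  · rw [holds_allAlive hV]
    exact satisfiable_iff hφ (fun u v h => (hadj₃ u v).2 h) (hdec.1 h0).1 (hdec.1 h0).2
      (by rw [hdig₄]; exact hdig) (by omega) hkeep
  · by_contra hne
    exact not_unsplittable hadj₃ htw (hdec.2 hne)

end Stm

namespace RAM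

/-- Assigns the value of an expression to a variable. -/
def assign (x : ℕ) (e : Exp) : RAMProgram := .seq (e.compile 0) (.copy (R x) (T 0))

section

variable {I V : ℕ → ℕ} {A : Arrays} {L B : ℕ} {s : RAMState}

lemma Runs.seq_pow {p q : RAMProgram} {X a b : ℕ} {Q Q' : RAMState → Prop} (hX : 2 ≤ X)
    (h : Runs p s (X ^ a) Q) (h' : ∀ s', Q s' → Runs q s' (X ^ b) Q') :
    Runs (.seq p q) s (X ^ (a + b + 1)) Q' :=
  (h.seq h').mono (bound_add hX le_rfl le_rfl) fun _ => id

lemma assign_runs (hI : ∀ i, L ≤ i → I i = 0) (h : Repr I L V A s) (hV : ∀ x, V x ≤ B) (x : ℕ)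
    (e : Exp) : Runs (assign x e) s ((B + 2) ^ (e.deg + 1)) fun s' =>
      Repr I L (Function.update V x (e.eval I V A)) A s' := by
  refine Runs.mono (c := (B + 2) ^ e.deg + 1) ((e.compile_runs hI 0 h hV).seq fun s' hs' =>
    Runs.copy ?_) (bound_add_one _ _) fun _ => id
  rw [hs'.2.1]
  exact hs'.1.setR _ _

/-- A loop that ends after at most `n` rounds, possibly earlier. -/
lemma Runs.while_until {x n c : ℕ} {p : RAMProgram} (Inv : ℕ → RAMState → Prop)
    (hstep : ∀ k < n, ∀ s, Inv k s → s.reg x ≠ 0 → Runs p s c (Inv (k + 1)))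
    (h_end : ∀ s, Inv n s → s.reg x = 0) (h : Inv 0 s) :
    Runs (.while x p) s (n * (c + 1) + 1) fun s' => s'.reg x = 0 ∧ ∃ k ≤ n, Inv k s' := by
  suffices ∀ j k s, k + j = n → Inv k s → Runs (.while x p) s (j * (c + 1) + 1)
      fun s' => s'.reg x = 0 ∧ ∃ k ≤ n, Inv k s' from this n 0 s (by omega) h
  intro j
  induction j with
  | zero =>
    rintro k s rfl h
    exact ⟨_, _, runsTo_while_of_eq_zero (h_end s h), by omega, h_end s h, k, le_rfl, h⟩
  | succ j ih =>
    intro k s hkj h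
    by_cases h0 : s.reg x = 0
    · exact ⟨_, _, runsTo_while_of_eq_zero h0, by omega, h0, k, by omega, h⟩
    · obtain ⟨t, s', h1, h2, h3⟩ := hstep k (by omega) s h h0
      obtain ⟨t', s'', h4, h5, h6⟩ := ih (k + 1) s' (by omega) h3
      exact ⟨_, _, .while_step h0 h1 h4, by rw [Nat.succ_mul]; omega, h6⟩

end

/-- Sets the parameters that only depend on the input. -/
def prologue : RAMProgram :=
  .seq (.copy (R vL) 0) <|
  .seq (assign vN (.inp (.const 0))) <|
  .seq (assign vNN (.add (.var vN) (.var vN))) <|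
  .seq (assign vNs (.add (.var vN) (.const 1))) <|
  assign vRun (.const 1)

/-- One round of the algorithm, for the next bound on the treewidth; the variable `vRun` tells
whether it has failed to find a decomposition. -/
def body {Γ : ConstraintLanguage ℚ} (φ : ∀ i, QFFormula rationalOrder (Γ.arity i)) : RAMProgram :=
  .seq (assign vk (.add (.var vk) (.const 1))) <|
  .seq (assign vm (.add (.sum xx vk (.const 5)) (.const 1))) <|
  .seq (assign vK (.add (.sum xx vk (.const 6)) (.const 2))) <|
  .seq (Stm.power.compile 0) <|
  .seq (assign vH (.get aQ vO vO)) <|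
  .seq ((Stm.round φ).compile 0) <|
  assign vRun (.ite (.get aFail vO vO) (.const 1) (.const 0))

/-- Writes the answer to register `0`. -/
def epilogue : RAMProgram :=
  .seq ((Exp.ite Stm.allAlive (.const 1) (.const 0)).compile 0) (.copy 0 (T 0))

/-- Decides satisfiability: rounds for larger and larger bounds on the treewidth are carried out
until one of them finds a decomposition. -/
def solver {Γ : ConstraintLanguage ℚ} (φ : ∀ i, QFFormula rationalOrder (Γ.arity i)) :
    RAMProgram :=
  .seq prologue <| .seq (.while (R vRun) (body φ)) epilogue

/-- A bound on all variables in the first `k` rounds; the power bounds the number of codes. -/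
def bound (L N k : ℕ) : ℕ := L + 2 * N + 1 + (6 * k + 2) ^ (6 * k + 2)

lemma le_bound (L N k : ℕ) : L + 2 * N + 1 + (6 * k + 2) ≤ bound L N k :=
  Nat.add_le_add_left (Nat.le_self_pow (by omega) _) _

lemma bound_mono {L N k k' : ℕ} (h : k ≤ k') : bound L N k ≤ bound L N k' := by
  refine Nat.add_le_add_left ((Nat.pow_le_pow_left ?_ _).trans (Nat.pow_le_pow_right ?_ ?_)) _ <;>
    omega

/-- The situation after `k` rounds. The last component gives the meaning of the arrays if the
last round was successful, and ensures success for a sufficiently large bound. -/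
structure AfterRounds {Γ : ConstraintLanguage ℚ} (J : CSPInstance Γ) (k : ℕ) (V : ℕ → ℕ)
    (A : Arrays) (s : RAMState) : Prop where
  repr : Repr J.input J.encode.length V A s
  eqL : V vL = J.encode.length
  eqN : V vN = J.numVars
  eqNN : V vNN = 2 * J.numVars
  eqk : V vk = k
  eqNs : V vNs = J.numVars + 1
  eqO : V vO = 0
  le : ∀ x, V x ≤ bound J.encode.length J.numVars k
  correct : V vRun = 0 → (Stm.allAlive.Holds J.input V A ↔ J.Satisfiable)
  success : treewidth J.primalGraph + 1 ≤ k → V vRun = 0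

variable {Γ : ConstraintLanguage ℚ} {J : CSPInstance Γ} {s : RAMState} {B : ℕ}

lemma _root_.CSPInstance.repr_init (J : CSPInstance Γ) :
    Repr J.input J.encode.length (fun _ => 0) (fun _ _ _ => 0) (RAMState.init J.encode) where
  base := by simp [RAMState.init]
  var x := by simp [RAMState.init]
  inp _ _ := rfl
  arr a i j := List.getD_eq_default _ _ (by unfold addr; omega)

lemma prologue_runs : ∃ D, ∀ {J : CSPInstance Γ} {B : ℕ},
    bound J.encode.length J.numVars 0 ≤ B →
    Runs prologue (RAMState.init J.encode) ((B + 2) ^ D) fun s' => ∃ V A, AfterRounds J 0 V A s' :=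
        by
  -- The exponents for the five instructions are `0`, `4`, `3`, `3` and `1`.
  refine ⟨15, fun {J B} hB => ?_⟩
  have hI : ∀ i, J.encode.length ≤ i → J.input i = 0 := fun _ => J.input_of_le
  have hle := (le_bound J.encode.length J.numVars 0).trans hB
  refine Runs.seq_pow (a := 0) (b := 14) (by omega) ((Runs.copy (J.repr_init.setR vL _)).mono
      (by simp) fun _ => id)
    fun s₁ h₁ => ?_
  rw [J.repr_init.base] at h₁
  have hV₁ := update_le (V := fun _ => 0) (B := B) (by simp)
    (show J.encode.length ≤ B by omega) vL
  refine Runs.seq_pow (a := 4) (b := 9) (by omega) (assign_runs hI h₁ hV₁ _ _) fun s₂ h₂ => ?_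
  simp only [Exp.eval_inp, Exp.eval_const, J.input_zero] at h₂
  have hV₂ := update_le hV₁ (show J.numVars ≤ B by omega) vN
  refine Runs.seq_pow (a := 3) (b := 5) (by omega) (assign_runs hI h₂ hV₂ _ _) fun s₃ h₃ => ?_
  simp only [Exp.eval_add, Exp.eval_var, Function.update_self, ← two_mul] at h₃
  have hV₃ := update_le hV₂ (show 2 * J.numVars ≤ B by omega) vNN
  refine Runs.seq_pow (a := 3) (b := 1) (by omega) (assign_runs hI h₃ hV₃ _ _) fun s₄ h₄ => ?_
  simp only [Exp.eval_add, Exp.eval_var, Exp.eval_const, Function.update_self, ne_eq,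
    Nat.reduceEqDiff, not_false_eq_true, Function.update_of_ne] at h₄
  have hV₄ := update_le hV₃ (show J.numVars + 1 ≤ B by omega) vNs
  refine (assign_runs hI h₄ hV₄ _ _).mono le_rfl fun s₅ h₅ => ?_
  rw [Exp.eval_const] at h₅
  refine ⟨_, _, h₅, ?_, ?_, ?_, ?_, ?_, ?_, ?_, ?_, ?_⟩
  case refine_7 =>
    have := le_bound J.encode.length J.numVars 0
    refine update_le (update_le (update_le (update_le (update_le (fun _ => Nat.zero_le _) ?_ _) ?_
        _)
      ?_ _) ?_ _) ?_ _ <;> omega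
  all_goals simp

/-- The exponent adds up those of the seven instructions of the round, with one more for each
composition. -/
lemma body_runs {φ : ∀ i, QFFormula rationalOrder (Γ.arity i)}
    (hφ : ∀ i t, t ∈ Γ.rel i ↔ (φ i).Holds t) : ∃ D, ∀ {J : CSPInstance Γ} {B k : ℕ} {s : RAMState},
    bound J.encode.length J.numVars (k + 1) ≤ B → (∃ V A, AfterRounds J k V A s) →
    Runs (body φ) s ((B + 2) ^ D) fun s' => ∃ V A, AfterRounds J (k + 1) V A s' := by
  refine ⟨3 + (10 + (10 + (Stm.power.deg + (6 + ((Stm.round φ).deg + 8 + 1) + 1) + 1) + 1) + 1) + 1,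
    fun {J B k s} hB => ?_⟩
  rintro ⟨V, A, h⟩
  have hI : ∀ i, J.encode.length ≤ i → J.input i = 0 := fun _ => J.input_of_le
  have hle := le_bound J.encode.length J.numVars (k + 1)
  set C := bound J.encode.length J.numVars (k + 1) with hC
  have hV : ∀ x, V x ≤ C := fun x => (h.le x).trans (bound_mono (by omega))
  have hCB : ∀ {V : ℕ → ℕ}, (∀ x, V x ≤ C) → ∀ x, V x ≤ B := fun h x => (h x).trans hB
  refine Runs.seq_pow (by omega) (assign_runs hI h.repr (hCB hV) _ _) fun s₁ h₁ => ?_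
  simp only [Exp.eval_add, Exp.eval_var, Exp.eval_const, h.eqk] at h₁
  have hV₁ := update_le hV (show k + 1 ≤ C by omega) vk
  refine Runs.seq_pow (by omega) (assign_runs hI h₁ (hCB hV₁) _ _) fun s₂ h₂ => ?_
  simp only [Exp.eval_add, Exp.eval_sum, Exp.eval_const, Function.update_self, Finset.sum_const,
    Finset.card_range, smul_eq_mul, mul_comm _ 5] at h₂
  have hV₂ := update_le hV₁ (show 5 * (k + 1) + 1 ≤ C by omega) vm
  refine Runs.seq_pow (by omega) (assign_runs hI h₂ (hCB hV₂) _ _) fun s₃ h₃ => ?_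
  simp only [Exp.eval_add, Exp.eval_sum, Exp.eval_const, Function.update_self, Finset.sum_const,
    Finset.card_range, smul_eq_mul, mul_comm _ 6, ne_eq, Nat.reduceEqDiff, not_false_eq_true,
    Function.update_of_ne] at h₃
  have hV₃ := update_le hV₂ (show 6 * (k + 1) + 2 ≤ C by omega) vK
  refine Runs.seq_pow (by omega) (Stm.power.compile_runs hI 0 h₃ (hCB hV₃))
    fun s₄ ⟨h₄, _⟩ => ?_
  have hpow := Stm.exec_power (I := J.input) (A := A) (V := Function.update (Function.update
    (Function.update V vk (k + 1)) vm (5 * (k + 1) + 1)) vK (6 * (k + 1) + 2)) (by simp [h.eqO])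
  rw [Function.update_self] at hpow
  refine Runs.seq_pow (by omega) (assign_runs hI h₄ (hCB hV₃) _ _) fun s₅ h₅ => ?_
  simp only [Exp.eval_get, ne_eq, Nat.reduceEqDiff, not_false_eq_true, Function.update_of_ne,
    h.eqO, hpow] at h₅
  have hV₅ := update_le hV₃ (show (6 * (k + 1) + 2) ^ (6 * (k + 1) + 2) ≤ C by
    rw [hC, bound]; omega) vH
  set V₅ := Function.update (Function.update (Function.update
    (Function.update V vk (k + 1)) vm (5 * (k + 1) + 1)) vK (6 * (k + 1) + 2)) vH
    ((6 * (k + 1) + 2) ^ (6 * (k + 1) + 2)) with hV₅def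
  refine Runs.seq_pow (by omega) ((Stm.round φ).compile_runs hI 0 h₅ (hCB hV₅))
    fun s₆ ⟨h₆, _⟩ => ?_
  have hP : Params V₅ J.encode.length J.numVars (k + 1) (5 * (k + 1) + 1) (6 * (k + 1) + 2)
      ((6 * (k + 1) + 2) ^ (6 * (k + 1) + 2)) := by
    constructor <;> simp [hV₅def, h.eqL, h.eqN, h.eqNN, h.eqNs, h.eqO]
  obtain ⟨h7, h8⟩ := Stm.exec_round hφ (A := Stm.power.exec J.input (Function.update
    (Function.update (Function.update V vk (k + 1)) vm (5 * (k + 1) + 1)) vK (6 * (k + 1) + 2)) A)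
    (by omega) rfl hP
  refine (assign_runs hI h₆ (hCB hV₅) _ _).mono le_rfl fun s₇ h₇ => ?_
  generalize (Stm.round φ).exec J.input V₅ _ = A₆ at *
  have hrun : (Exp.ite (.get aFail vO vO) (.const 1) (.const 0)).eval J.input V₅ A₆ = 0 ↔
      A₆ aFail 0 0 = 0 := by
    simp [hP.eqO]
  have hrun' : (Exp.ite (.get aFail vO vO) (.const 1) (.const 0)).eval J.input V₅ A₆ ≤ 1 := by
    rw [Exp.eval_ite]
    split_ifs <;> simp
  generalize (Exp.ite (.get aFail vO vO) (.const 1) (.const 0)).eval J.input V₅ A₆ = r at *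
  have hP' : Params (Function.update V₅ vRun r) J.encode.length J.numVars (k + 1)
      (5 * (k + 1) + 1) (6 * (k + 1) + 2) ((6 * (k + 1) + 2) ^ (6 * (k + 1) + 2)) := by
    constructor <;> simp [hP.eqL, hP.eqN, hP.eqNN, hP.eqNs, hP.eqO, hP.eqk, hP.eqm, hP.eqK, hP.eqH]
  refine ⟨_, _, h₇, hP'.eqL, hP'.eqN, hP'.eqNN, hP'.eqk, hP'.eqNs, hP'.eqO,
    update_le hV₅ (by omega) _, ?_, ?_⟩
  · rw [Function.update_self, hrun, Stm.holds_allAlive hP', ← Stm.holds_allAlive hP (I := J.input)]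
    exact h7
  · rw [Function.update_self, hrun]
    exact h8

/-- The loop ends after at most `treewidth + 1` rounds, so all variables stay below the bound for
this number of rounds. -/
lemma solver_runs {φ : ∀ i, QFFormula rationalOrder (Γ.arity i)}
    (hφ : ∀ i t, t ∈ Γ.rel i ↔ (φ i).Holds t) : ∃ D, ∀ J : CSPInstance Γ,
    Runs (solver φ) (RAMState.init J.encode)
      ((bound J.encode.length J.numVars (treewidth J.primalGraph + 1) + 2) ^ D)
      fun s => (J.Satisfiable → s.reg 0 = 1) ∧ (¬ J.Satisfiable → s.reg 0 = 0) := by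
  obtain ⟨D₁, h₁⟩ := prologue_runs (Γ := Γ)
  obtain ⟨D₂, h₂⟩ := body_runs hφ
  refine ⟨D₁ + (((D₂ + 1) + 1 + 1) +
    ((Exp.ite Stm.allAlive (.const 1) (.const 0)).deg + 1) + 1) + 1, fun J => ?_⟩
  set n := treewidth J.primalGraph + 1 with hn
  set B := bound J.encode.length J.numVars n with hB
  have hI : ∀ i, J.encode.length ≤ i → J.input i = 0 := fun _ => J.input_of_le
  have hnB : n ≤ B := by
    have := le_bound J.encode.length J.numVars n
    omega
  refine Runs.seq_pow (by omega) (h₁ (bound_mono (by omega))) fun s₁ hs₁ => ?_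
  refine Runs.seq_pow (by omega) (Runs.mono (Runs.while_until (n := n)
    (fun k s => ∃ V A, AfterRounds J k V A s)
    (fun k hk s hs _ => h₂ (bound_mono (by omega)) hs)
    (fun s ⟨V, A, h⟩ => by rw [h.repr.var]; exact h.success le_rfl) hs₁)
    ((Nat.add_le_add_right (bound_mul hnB (bound_add_one B D₂)) 1).trans (bound_add_one B _))
    fun _ => id) ?_
  rintro s₂ ⟨h0, k, hk, V, A, h⟩
  rw [h.repr.var] at h0
  have hsat := h.correct h0
  refine Runs.mono (c := (B + 2) ^ (Exp.ite Stm.allAlive (.const 1) (.const 0)).deg + 1)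
    (((Exp.ite Stm.allAlive (.const 1) (.const 0)).compile_runs hI 0 h.repr
      (fun x => (h.le x).trans (bound_mono hk))).seq fun s₃ hs₃ => Runs.copy ?_)
    (bound_add_one _ _) fun _ => id
  rw [hs₃.2.1, Exp.eval_ite]
  constructor <;> intro hJ <;> simp [hsat, hJ]

end RAM

lemma CSPInstance.length_encode_le {D : Type} {Γ : ConstraintLanguage D} (J : CSPInstance Γ) :
    J.encode.length + J.numVars = J.size + 1 := by
  simp only [encode_eq, size, List.length_cons, List.length_flatMap,
    CSPConstraint.length_encode]
  omega

lemma computable_timeBound (D : ℕ) :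
    Computable fun w => (8 + (6 * (w + 1) + 2) ^ (6 * (w + 1) + 2)) ^ D := by
  have hpow : Primrec₂ ((· ^ ·) : ℕ → ℕ → ℕ) := by
    refine ((Primrec.nat_rec (f := fun _ : ℕ => 1) (.const 1)
      (Primrec.nat_mul.comp₂ (Primrec.snd.comp₂ .right) .left)).of_eq fun a n => ?_)
    induction n with
    | zero => simp
    | succ n ih => simp [pow_succ, ih]
  have h1 : Primrec fun w : ℕ => 6 * (w + 1) + 2 :=
    Primrec.nat_add.comp (Primrec.nat_mul.comp (.const 6) (Primrec.succ)) (.const 2)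
  exact (hpow.comp (Primrec.nat_add.comp (.const 8) (hpow.comp h1 h1)) (.const D)).to_comp

theorem mainTheorem7 (Γ : ConstraintLanguage ℚ)
    (hΓ : ∀ i : Fin Γ.card, QFDefinable rationalOrder (Γ.rel i)) :
    CSPIsFPT Γ := by
  choose φ hφ using hΓ
  obtain ⟨D, hD⟩ := RAM.solver_runs hφ
  refine ⟨RAM.solver φ, _, D, computable_timeBound D, fun J => ?_⟩
  obtain ⟨t, s, h1, h2, h3⟩ := hD J
  refine ⟨t, s, h1, h2.trans ?_, h3⟩
  rw [← mul_pow]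
  refine Nat.pow_le_pow_left ?_ D
  have hL := J.length_encode_le
  have hN : J.numVars ≤ J.size := Nat.le_add_right _ _
  rw [RAM.bound]
  generalize (6 * (treewidth J.primalGraph + 1) + 2) ^ (6 * (treewidth J.primalGraph + 1) + 2) = M
  rw [add_mul, mul_add M]
  have := Nat.zero_le (M * J.size)
  omega
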